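/- **Theorem 3.** A sensor monitors a single source. Energy arrives at the sensor in units according to a Poisson process of unit rate and is stored in a unit-sized battery that is empty at time $0$; units arriving at a full battery are lost. Each update attempt consumes one energy unit, takes no time, and is erased with probability $q\in(0,1)$, independently of the other attempts and of the energy arrivals. A (feasible, online) policy chooses attempt times $0=l_0\le l_1\le l_2\le\cdots$ such that the battery is full at every attempt (a unit arriving at the instant of the attempt may be used) and such that, for all $n\ge 0$ and $t\ge0$, the event $\{l_{n+1}\le t\}$ is determined by the energy arrivals up to time $t$ and by the instantaneous, error-free feedback on whether each of the first $n$ attempts was erased. Let $0=s_0<s_1<s_2<\cdots$ be the times of the successful (non-erased) attempts, $y_i=s_i-s_{i-1}$ the epoch lengths, $n(t)$ the number of $i\geq 1$ with $s_i\le t$, and $$r(t)=\frac12\sum_{i=1}^{n(t)}y_i^2+\frac12\bigl(t-s_{n(t)}\bigr)^2$$ the area under the age-of-information curve on $[0,t]$. The policy is judged by its long-term average age of information $\limsup_{T\to\infty}\frac1T\mathbb E[r(T)]$. A policy is called uniformly bounded if its inter-update times have a bounded second moment, that is, if $\sup_i\mathbb E[(l_i-l_{i-1})^2]<\infty$ or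 $\sup_i\mathbb E[y_i^2]<\infty$. Then for every uniformly bounded policy there is a renewal policy, i.e. a policy whose epoch lengths $y_1,y_2,\dots$ are i.i.d. (and almost surely positive and finite), which satisfies both of these bounds and whose long-term average age of information is at most that of the given policy. -/

import Mathlib

open MeasureTheory ProbabilityTheory Filter
open scoped ENNReal NNReal Topology

namespace StatusUpdate

variable {Ω : Type*}

/-- `N t` is the number of energy units that have arrived in `[0, t]`; `N` is a Poisson process of
unit rate, with nondecreasing right-continuous integer-valued paths. -/
structure IsUnitPoissonProcess [MeasurableSpace Ω] (N : ℝ≥0 → Ω → ℕ) (P : Measure Ω) : Prop where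
  measurable : ∀ t, Measurable (N t)
  zero : ∀ ω, N 0 ω = 0
  mono : ∀ ω, Monotone (fun t => N t ω)
  right_continuous : ∀ ω t, ContinuousWithinAt (fun u => N u ω) (Set.Ici t) t
  indep_increments : HasIndepIncrements N P
  law_increments : ∀ s t : ℝ≥0, P.map (fun ω => N (s + t) ω - N s ω) = poissonMeasure t

/-- `er k ω = true` means that the `(k+1)`-st update attempt is erased. The attempts are erased
independently of each other, each with probability `q`. -/
structure IsErasureSequence [MeasurableSpace Ω] (q : ℝ) (er : ℕ → Ω → Bool) (P : Measure Ω) :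
    Prop where
  measurable : ∀ k, Measurable (er k)
  indep : iIndepFun er P
  prob_erased : ∀ k, P {ω | er k ω = true} = ENNReal.ofReal q

/-- The model of a single source, an energy harvesting sensor with Poisson energy arrivals of
unit rate, and a channel with erasure probability `q` that is independent of the arrivals. -/
structure IsModel [MeasurableSpace Ω] (q : ℝ) (N : ℝ≥0 → Ω → ℕ) (er : ℕ → Ω → Bool)
    (P : Measure Ω) : Prop where
  poisson : IsUnitPoissonProcess N P
  erasures : IsErasureSequence q er P
  indep : IndepFun (fun ω (t : ℝ≥0) => N t ω) (fun ω (k : ℕ) => er k ω) P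

/-- The information consisting of the energy arrivals up to time `t` and of the feedback on the
first `n` update attempts. -/
abbrev info (N : ℝ≥0 → Ω → ℕ) (er : ℕ → Ω → Bool) (n : ℕ) (t : ℝ≥0) : MeasurableSpace Ω :=
  (⨆ (u : ℝ≥0) (_ : u ≤ t), MeasurableSpace.comap (N u) ⊤) ⊔
    (⨆ (k : ℕ) (_ : k < n), MeasurableSpace.comap (er k) ⊤)

/-- The energy that arrives in the time interval `(a, b]`, for `a ≤ b < ∞`. -/
noncomputable def arrivals (N : ℝ≥0 → Ω → ℕ) (a b : ℝ≥0∞) (ω : Ω) : ℕ :=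
  N b.toNNReal ω - N a.toNNReal ω

/-- The content of the unit-sized battery just before the `(n+1)`-st update attempt, when `l i` is
the time of the `i`-th attempt and `l 0 = 0`, the battery is empty at time `0`, and every attempt
consumes one unit. (The subtraction is not truncated when every attempt has found a full battery.)
An energy unit that arrives at the instant of an attempt is available for it. -/
noncomputable def battery (N : ℝ≥0 → Ω → ℕ) (l : ℕ → Ω → ℝ≥0∞) : ℕ → Ω → ℕ
  | 0, ω => min (arrivals N (l 0 ω) (l 1 ω) ω) 1
  | n + 1, ω =>
      min (battery N l n ω - 1 + arrivals N (l (n + 1) ω) (l (n + 2) ω) ω) 1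

/-- A feasible online policy with perfect instantaneous feedback. `l n` is the time of the `n`-th
update attempt, `l 0 = 0`, and `l n = ∞` if there are fewer than `n` attempts. Whether the
`(n+1)`-st attempt has been made by time `t` is determined by the energy arrivals up to time `t`
and the feedback on the first `n` attempts (no attempt precedes an earlier one, so that this
feedback has been received by then). No attempt is made with an empty battery. -/
structure Policy (N : ℝ≥0 → Ω → ℕ) (er : ℕ → Ω → Bool) where
  l : ℕ → Ω → ℝ≥0∞
  l_zero : ∀ ω, l 0 ω = 0
  l_mono : ∀ ω n, l n ω ≤ l (n + 1) ω
  online : ∀ (n : ℕ) (t : ℝ≥0), MeasurableSet[info N er n t] {ω | l (n + 1) ω ≤ t}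
  energy_causality : ∀ ω n, l (n + 1) ω < ∞ → 1 ≤ battery N l n ω

namespace Policy

variable {N : ℝ≥0 → Ω → ℕ} {er : ℕ → Ω → Bool}

/-- `π.x n` is the delay between the `n`-th and the `(n+1)`-st update attempt. -/
noncomputable def x (π : Policy N er) (n : ℕ) (ω : Ω) : ℝ≥0∞ := π.l (n + 1) ω - π.l n ω

/-- `π.s i` is the time of the `i`-th successful update, with `π.s 0 = 0`; it is `∞` if there are
fewer than `i` successful updates. The `(i+1)`-st success is the `(k+1)`-st attempt if that attempt
is not erased and exactly `i` of the first `k` attempts are not erased. -/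
noncomputable def s (π : Policy N er) : ℕ → Ω → ℝ≥0∞
  | 0, _ => 0
  | i + 1, ω =>
      ⨅ (k : ℕ) (_ : er k ω = false ∧ Nat.count (fun j => er j ω = false) k = i), π.l (k + 1) ω

/-- `π.y i` is the length of the `(i+1)`-st epoch, i.e. the delay between the `i`-th and the
`(i+1)`-st successful update. -/
noncomputable def y (π : Policy N er) (i : ℕ) (ω : Ω) : ℝ≥0∞ := π.s (i + 1) ω - π.s i ω

/-- The number of successful updates received by time `t`. -/
noncomputable def successes (π : Policy N er) (t : ℝ≥0) (ω : Ω) : ℕ :=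
  Set.ncard {i : ℕ | π.s (i + 1) ω ≤ t}

/-- The area under the age-of-information curve on `[0, t]`. -/
noncomputable def area (π : Policy N er) (t : ℝ≥0) (ω : Ω) : ℝ≥0∞ :=
  2⁻¹ * ∑ i ∈ Finset.range (π.successes t ω), π.y i ω ^ 2 +
    2⁻¹ * ((t : ℝ≥0∞) - π.s (π.successes t ω) ω) ^ 2

variable [MeasurableSpace Ω]

/-- The long-term average age of information. -/
noncomputable def averageAoI (π : Policy N er) (P : Measure Ω) : ℝ≥0∞ :=
  limsup (fun T : ℝ≥0 => (∫⁻ ω, π.area T ω ∂P) / (T : ℝ≥0∞)) atTop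

/-- The delays between consecutive update attempts have a bounded second moment. -/
def AttemptDelaysBounded (π : Policy N er) (P : Measure Ω) : Prop :=
  ∃ C : ℝ≥0, ∀ n, ∫⁻ ω, π.x n ω ^ 2 ∂P ≤ C

/-- The delays between consecutive successful updates have a bounded second moment. -/
def EpochLengthsBounded (π : Policy N er) (P : Measure Ω) : Prop :=
  ∃ C : ℝ≥0, ∀ i, ∫⁻ ω, π.y i ω ^ 2 ∂P ≤ C

/-- The successful update times form a renewal process: the epoch lengths are i.i.d., and almost
surely positive and finite. -/
structure IsRenewal (π : Policy N er) (P : Measure Ω) : Prop where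
  indep : iIndepFun π.y P
  identDistrib : ∀ i, IdentDistrib (π.y i) (π.y 0) P P
  pos_finite : ∀ᵐ ω ∂P, ∀ i, 0 < π.y i ω ∧ π.y i ω < ∞

end Policy

end StatusUpdate

namespace StatusUpdate

variable {Ω : Type*}

/-! Write c = q/(1-q), let γ solve the equation in `IsThreshold`, and put λ = γ + c. The threshold
policy makes the first attempt of an epoch as soon as the age is at least γ and the battery is full,
and retries after an erasure at the next energy arrival. It is a renewal policy whose long-term
average age is at most λ, while λ bounds the average age of every policy from below. So this one
policy can be compared with any given one.

Optimality is a verification argument of dynamic programming. Charge t²/2 - λt for an epoch of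
length t. `fullCost` and `emptyCost` are the minimal expected charges of the current epoch, seen at
a given age with a full or an empty battery. They satisfy the optimality equations: `emptyCost` is
the mean of `fullCost` at the next arrival (`integral_nextCost`); `fullCost` is at most the mean
charge after an immediate attempt (`fullCost_le`), with equality from age γ on
(`fullCost_eq_of_le`); and the equation for γ says that a fresh epoch costs zero (`emptyCost_zero`).
Hence the charges of the completed epochs plus the expected charge of the current one, observed at
the attempts and stopped at time T, increase in mean for every policy and decrease in mean for the
threshold policy, for suitable boundary values at T. The charges add up to the area under the age
curve minus λ times the elapsed time. This gives λT ≤ (1+ε) E r(T) + C in general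
(`Policy.exists_le_integral_area`) and E r(T) ≤ λT + C for the threshold policy
(`Policy.exists_integral_area_le`). The averaging over the next arrival rests on the strong Markov
property (`IsModel.strong_markov`).

For the renewal property, the pairs of an energy waiting time and a feedback bit are i.i.d.
(`Policy.iIndepFun_step`). An epoch of the threshold policy is a fixed function of one block of
these pairs, blocks ending at successes, and the blocks of an i.i.d. sequence are i.i.d.
(`iIndepFun_blockSum`). The geometric tail of the block length bounds the second moment
(`lintegral_sq_blockSum_lt_top`). -/

theorem comap_apply_le_comap_pi {ι : Type*} {β : ι → Type*} [∀ i, MeasurableSpace (β i)]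
    (X : ∀ i, Ω → β i) (i : ι) :
    MeasurableSpace.comap (X i) inferInstance ≤
      MeasurableSpace.comap (fun ω i => X i ω) MeasurableSpace.pi := by
  rintro _ ⟨s, hs, rfl⟩
  exact ⟨(fun f => f i) ⁻¹' s, measurable_pi_apply i hs, rfl⟩

/-- In P(A ∩ B ∩ C) the factor of B splits off first, because A ∩ C lies in `m`; then A and C split.
This serves to join the erasures to the past arrivals, the arrivals to the past feedback, and the
next feedback to an energy waiting time. -/
theorem indep_sup_left_of_indep {m₁ m₂ m₃ m : MeasurableSpace Ω} {mΩ : MeasurableSpace Ω}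
    {P : Measure Ω} [IsProbabilityMeasure P] (h₁ : m₁ ≤ m) (h₃ : m₃ ≤ m) (hm : m ≤ mΩ)
    (h₂ : m₂ ≤ mΩ) (h₁₃ : Indep m₁ m₃ P) (hm₂ : Indep m m₂ P) : Indep (m₁ ⊔ m₂) m₃ P := by
  let p : Set (Set Ω) := {s | ∃ A B, MeasurableSet[m₁] A ∧ MeasurableSet[m₂] B ∧ s = A ∩ B}
  have hp : IsPiSystem p := by
    rintro _ ⟨A, B, hA, hB, rfl⟩ _ ⟨A', B', hA', hB', rfl⟩ -
    exact ⟨A ∩ A', B ∩ B', hA.inter hA', hB.inter hB', Set.inter_inter_inter_comm ..⟩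
  have hgen : m₁ ⊔ m₂ = MeasurableSpace.generateFrom p := by
    apply le_antisymm
    · refine sup_le (fun A hA => ?_) (fun B hB => ?_)
      · exact MeasurableSpace.measurableSet_generateFrom
          ⟨A, Set.univ, hA, MeasurableSet.univ, by simp⟩
      · exact MeasurableSpace.measurableSet_generateFrom
          ⟨Set.univ, B, MeasurableSet.univ, hB, by simp⟩
    · refine MeasurableSpace.generateFrom_le ?_
      rintro _ ⟨A, B, hA, hB, rfl⟩
      exact MeasurableSet.inter ((le_sup_left : m₁ ≤ m₁ ⊔ m₂) _ hA)
        ((le_sup_right : m₂ ≤ m₁ ⊔ m₂) _ hB)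
  refine IndepSets.indep (sup_le (h₁.trans hm) h₂) (h₃.trans hm) hp
    (@MeasurableSpace.isPiSystem_measurableSet Ω m₃) hgen
    (@MeasurableSpace.generateFrom_measurableSet Ω m₃).symm ?_
  rw [IndepSets_iff]
  rintro _ C ⟨A, B, hA, hB, rfl⟩ hC
  have e₁ := (Indep_iff _ _ _).1 hm₂ (A ∩ C) B ((h₁ _ hA).inter (h₃ _ hC)) hB
  have e₂ := (Indep_iff _ _ _).1 hm₂ A B (h₁ _ hA) hB
  have e₃ := (Indep_iff _ _ _).1 h₁₃ A C hA hC
  rw [Set.inter_right_comm, e₁, e₂, e₃]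
  ring

variable {N : ℝ≥0 → Ω → ℕ} {er : ℕ → Ω → Bool} {q : ℝ}

/-! ### Independence of future arrivals from the past -/

section Poisson

variable [mΩ : MeasurableSpace Ω] {P : Measure Ω}

namespace IsUnitPoissonProcess

theorem eventually_eq (hN : IsUnitPoissonProcess N P) (ω : Ω) (t : ℝ≥0) :
    ∀ᶠ u in 𝓝[≥] t, N u ω = N t ω := by
  have h := hN.right_continuous ω t
  have h2 : {N t ω} ∈ 𝓝 (N t ω) := by simp
  exact h h2

theorem exists_gt_eq (hN : IsUnitPoissonProcess N P) (ω : Ω) (t : ℝ≥0) :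
    ∃ s, t < s ∧ N s ω = N t ω := by
  have h : ∀ᶠ u in 𝓝[>] t, N u ω = N t ω :=
    (hN.eventually_eq ω t).filter_mono (nhdsWithin_mono _ Set.Ioi_subset_Ici_self)
  obtain ⟨s, hs, hs'⟩ := (h.and self_mem_nhdsWithin).exists
  exact ⟨s, hs', hs⟩

/-- It suffices to treat finitely many past times. Their counts are partial sums of increments over
one grid ending with t, t + d, and none of them involves the last increment. -/
theorem indepFun_past_increment [IsProbabilityMeasure P] (hN : IsUnitPoissonProcess N P)
    (t d : ℝ≥0) :
    IndepFun (fun ω (u : Set.Iic t) => N u ω) (fun ω => N (t + d) ω - N t ω) P := by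
  have hmeas : Measurable (fun ω => N (t + d) ω - N t ω) :=
    (hN.measurable _).sub (hN.measurable _)
  refine IndepFun.process_indepFun (fun u => hN.measurable u) hmeas fun I => ?_
  classical
  -- With 0 in the grid the partial sums telescope down to `N 0 = 0`; with t in it the last
  -- increment is over (t, t + d].
  let F : Finset ℝ≥0 := insert 0 (insert t (I.image Subtype.val))
  have hFt : ∀ u ∈ F, u ≤ t := by
    intro u hu
    simp only [F, Finset.mem_insert, Finset.mem_image] at hu
    rcases hu with rfl | rfl | ⟨v, -, rfl⟩
    · exact zero_le
    · exact le_rfl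
    · exact v.2
  have h0F : (0 : ℝ≥0) ∈ F := by simp [F]
  have htF : t ∈ F := by simp [F]
  obtain ⟨k, hk⟩ : ∃ k, F.card = k + 1 :=
    Nat.exists_eq_succ_of_ne_zero (Finset.card_ne_zero_of_mem h0F)
  let e := F.orderEmbOfFin hk
  let tt : ℕ → ℝ≥0 := fun i => if h : i < k + 1 then e ⟨i, h⟩ else t + d
  have hmem : ∀ i, e i ∈ F := fun i => F.orderEmbOfFin_mem hk i
  have hmono : Monotone tt := by
    intro i j hij
    by_cases hj : j < k + 1
    · have hi : i < k + 1 := lt_of_le_of_lt hij hj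
      simp only [tt, hi, hj, dif_pos]
      exact e.monotone hij
    · simp only [tt, hj, dif_neg, not_false_iff]
      split_ifs
      · exact (hFt _ (hmem _)).trans le_self_add
      · exact le_rfl
  have hsurj : ∀ u ∈ F, ∃ i, i ≤ k ∧ tt i = u := by
    intro u hu
    have : u ∈ Set.range e := by rw [Finset.range_orderEmbOfFin]; exact hu
    obtain ⟨i, rfl⟩ := this
    exact ⟨i, Nat.lt_succ_iff.1 i.2, dif_pos i.2⟩
  have htt0 : tt 0 = 0 := by
    obtain ⟨i, -, hi⟩ := hsurj 0 h0F
    exact le_antisymm (hi ▸ hmono (Nat.zero_le i)) zero_le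
  have httk : tt k = t := by
    obtain ⟨i, hik, hi⟩ := hsurj t htF
    refine le_antisymm ?_ (hi ▸ hmono hik)
    simp only [tt, Nat.lt_succ_self, dif_pos]
    exact hFt _ (hmem _)
  have httk1 : tt (k + 1) = t + d := by simp [tt]
  choose! idx hidx1 hidx2 using hsurj
  have hind := hN.indep_increments.nat hmono
  have hind2 := hind.indepFun_finset (Finset.range k) {k} (by simp)
    (fun i => (hN.measurable _).sub (hN.measurable _))
  have hind3 := hind2.comp
    (φ := fun (x : Finset.range k → ℕ) (u : I) =>
      ∑ j : Finset.range k, if (j : ℕ) < idx u then x j else 0)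
    (ψ := fun (x : ({k} : Finset ℕ) → ℕ) => x ⟨k, by simp⟩)
    Measurable.of_discrete Measurable.of_discrete
  convert hind3 using 1
  · funext ω u
    have huF : (u : ℝ≥0) ∈ F := by
      simp only [F, Finset.mem_insert, Finset.mem_image]
      exact Or.inr (Or.inr ⟨u, u.2, rfl⟩)
    have hle := hidx1 _ huF
    simp only [Function.comp]
    rw [Finset.sum_coe_sort (Finset.range k)
      (fun j => if j < idx u then N (tt (j + 1)) ω - N (tt j) ω else 0), ← Finset.sum_filter]
    have hf : (Finset.range k).filter (fun j => j < idx (u : ℝ≥0)) = Finset.range (idx u) := by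
      ext j; simp; omega
    rw [hf, Finset.sum_range_tsub (f := fun j => N (tt j) ω)
      (fun i j hij => hN.mono ω (hmono hij))]
    simp [htt0, hN.zero, hidx2 _ huF]
  · funext ω
    simp [httk, httk1]

end IsUnitPoissonProcess

end Poisson

/-- The information consisting of the energy arrivals up to time `t` and of all erasures. -/
abbrev history (N : ℝ≥0 → Ω → ℕ) (er : ℕ → Ω → Bool) (t : ℝ≥0) : MeasurableSpace Ω :=
  (⨆ (u : ℝ≥0) (_ : u ≤ t), MeasurableSpace.comap (N u) ⊤) ⊔
    (⨆ (k : ℕ), MeasurableSpace.comap (er k) ⊤)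

theorem info_le_history (n : ℕ) (t : ℝ≥0) : info N er n t ≤ history N er t :=
  sup_le_sup le_rfl (iSup_mono fun _ => iSup_le fun _ => le_rfl)

theorem history_mono : Monotone (history N er) := fun _ _ h =>
  sup_le_sup (biSup_mono fun _ hu => hu.trans h) le_rfl

section Model

variable [mΩ : MeasurableSpace Ω] {P : Measure Ω}

namespace IsModel

theorem history_le (hm : IsModel q N er P) (t : ℝ≥0) : history N er t ≤ mΩ :=
  sup_le (iSup₂_le fun u _ => (hm.poisson.measurable u).comap_le)
    (iSup_le fun k => (hm.erasures.measurable k).comap_le)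

/-- The filtration of the histories. -/
def filtration (hm : IsModel q N er P) : Filtration ℝ≥0 mΩ :=
  ⟨history N er, history_mono, hm.history_le⟩

/-- All erasures, future ones included, may be added to the past, being independent of the arrivals.
This makes the attempt times of a policy stopping times of a single filtration that does not depend
on the number of the attempt. -/
theorem indep_history_increment [IsProbabilityMeasure P] (hm : IsModel q N er P) (t d : ℝ≥0) :
    Indep (history N er t)
      (MeasurableSpace.comap (fun ω => N (t + d) ω - N t ω) ⊤) P := by
  have hNm : Measurable (fun ω (t : ℝ≥0) => N t ω) := measurable_pi_lambda _ hm.poisson.measurable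
  have hem : Measurable (fun ω (k : ℕ) => er k ω) := measurable_pi_lambda _ hm.erasures.measurable
  have h := hm.indep
  rw [IndepFun_iff_Indep] at h
  have hone : ∀ u : ℝ≥0, MeasurableSpace.comap (N u) ⊤ ≤
      MeasurableSpace.comap (fun ω (t : ℝ≥0) => N t ω) MeasurableSpace.pi :=
    comap_apply_le_comap_pi N
  have hpi : (⨆ (k : ℕ), MeasurableSpace.comap (er k) ⊤) ≤
      MeasurableSpace.comap (fun ω (k : ℕ) => er k ω) MeasurableSpace.pi :=
    iSup_le (comap_apply_le_comap_pi er)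
  have hpast : (⨆ (u : ℝ≥0) (_ : u ≤ t), MeasurableSpace.comap (N u) ⊤) ≤
      MeasurableSpace.comap (fun ω (u : Set.Iic t) => N u ω) MeasurableSpace.pi :=
    iSup₂_le fun u hu =>
      comap_apply_le_comap_pi (fun (v : Set.Iic t) => N v) ⟨u, hu⟩
  refine indep_sup_left_of_indep (m := MeasurableSpace.comap (fun ω (t : ℝ≥0) => N t ω)
    MeasurableSpace.pi) (iSup₂_le fun u _ => hone u) ?_ hNm.comap_le
    (hpi.trans hem.comap_le) ?_ ?_
  · have : Measurable[MeasurableSpace.comap (fun ω (t : ℝ≥0) => N t ω) MeasurableSpace.pi]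
        (fun ω => N (t + d) ω - N t ω) :=
      Measurable.sub (measurable_iff_comap_le.2 (hone _)) (measurable_iff_comap_le.2 (hone _))
    exact this.comap_le
  · have := hm.poisson.indepFun_past_increment t d
    rw [IndepFun_iff_Indep] at this
    exact indep_of_indep_of_le_left this hpast
  · exact indep_of_indep_of_le_right h hpi

theorem prob_no_arrival (hm : IsModel q N er P) (t d : ℝ≥0) :
    P {ω | N (t + d) ω = N t ω} = ENNReal.ofReal (Real.exp (-d)) := by
  have h := hm.poisson.law_increments t d
  have h2 : P {ω | N (t + d) ω = N t ω} =
      P.map (fun ω => N (t + d) ω - N t ω) {0} := by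
    have hmeas : Measurable (fun ω => N (t + d) ω - N t ω) :=
      (hm.poisson.measurable _).sub (hm.poisson.measurable _)
    rw [Measure.map_apply hmeas (by simp)]
    congr 1
    ext ω
    have := hm.poisson.mono ω (le_self_add : t ≤ t + d)
    simp only [Set.mem_ofPred_eq, Set.mem_preimage, Set.mem_singleton_iff] at this ⊢
    omega
  rw [h2, h, poissonMeasure_singleton]
  simp

theorem prob_inter_no_arrival [IsProbabilityMeasure P] (hm : IsModel q N er P) (t d : ℝ≥0)
    {H : Set Ω} (hH : MeasurableSet[history N er t] H) :
    P (H ∩ {ω | N (t + d) ω = N t ω}) = P H * ENNReal.ofReal (Real.exp (-d)) := by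
  rw [← hm.prob_no_arrival t d]
  have h := (Indep_iff _ _ _).1 (hm.indep_history_increment t d) H {ω | N (t + d) ω = N t ω} hH
  refine h ⟨{0}, trivial, ?_⟩
  ext ω
  have := hm.poisson.mono ω (le_self_add : t ≤ t + d)
  simp only [Set.mem_ofPred_eq, Set.mem_preimage, Set.mem_singleton_iff] at this ⊢
  omega

end IsModel

end Model

end StatusUpdate

/-! ### The next arrival and the strong Markov property -/

namespace StatusUpdate

variable {Ω : Type*} {N : ℝ≥0 → Ω → ℕ} {er : ℕ → Ω → Bool} {q : ℝ}

/-- The time of the first energy arrival after time `a`. -/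
noncomputable def nextArrival (N : ℝ≥0 → Ω → ℕ) (a : ℝ≥0∞) (ω : Ω) : ℝ≥0∞ :=
  ⨅ (u : ℝ≥0) (_ : a ≤ u ∧ N a.toNNReal ω < N u ω), (u : ℝ≥0∞)

theorem le_nextArrival (a : ℝ≥0∞) (ω : Ω) : a ≤ nextArrival N a ω :=
  le_iInf₂ fun _ h => h.1

variable [mΩ : MeasurableSpace Ω] {P : Measure Ω}

/-- Right-continuity makes the infimum attained: the count stays at its value at `t` up to some
later time s, so without an arrival by `t` the next one is not before s. -/
theorem nextArrival_le_iff (hN : IsUnitPoissonProcess N P) (a : ℝ≥0∞) (t : ℝ≥0) (ω : Ω) :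
    nextArrival N a ω ≤ t ↔ a ≤ t ∧ N a.toNNReal ω < N t ω := by
  refine ⟨fun h => ?_, fun h => iInf₂_le t h⟩
  have hat : a ≤ t := (le_nextArrival a ω).trans h
  refine ⟨hat, ?_⟩
  by_contra hlt
  push Not at hlt
  obtain ⟨s, hts, hs⟩ := hN.exists_gt_eq ω t
  have : (s : ℝ≥0∞) ≤ nextArrival N a ω := by
    refine le_iInf₂ fun u hu => ?_
    by_contra hsu
    push Not at hsu
    have h1 := hN.mono ω (ENNReal.coe_lt_coe.1 hsu).le
    simp only at h1
    omega
  have h2 := ENNReal.coe_le_coe.1 (this.trans h)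
  exact absurd hts (not_lt.2 h2)

theorem lt_nextArrival_add_iff (hN : IsUnitPoissonProcess N P) (a d : ℝ≥0) (ω : Ω) :
    ((a + d : ℝ≥0) : ℝ≥0∞) < nextArrival N a ω ↔ N (a + d) ω = N a ω := by
  rw [← not_le, nextArrival_le_iff hN]
  have h := hN.mono ω (le_self_add : a ≤ a + d)
  simp only at h
  have : (a : ℝ≥0∞) ≤ ((a + d : ℝ≥0) : ℝ≥0∞) := ENNReal.coe_le_coe.2 le_self_add
  simp only [this, true_and, ENNReal.toNNReal_coe]
  omega

/-- The waiting time from `a` until the next energy arrival. -/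
noncomputable def gap (N : ℝ≥0 → Ω → ℕ) (a : ℝ≥0∞) (ω : Ω) : ℝ :=
  (nextArrival N a ω - a).toReal

/-- The upper approximation of `a` by points of the grid of mesh `(m + 1)⁻¹`. -/
noncomputable def gridIndex (m : ℕ) (a : ℝ≥0) : ℕ := ⌊a * (m + 1)⌋₊

/-- The right end of the half-open cell with index `k`. It exceeds every point of the cell, so
whether a stopping time falls into the cell is known by then. -/
noncomputable def gridPoint (m k : ℕ) : ℝ≥0 := ((k : ℝ≥0) + 1) / (m + 1)

theorem gridIndex_eq_iff (m k : ℕ) (a : ℝ≥0) :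
    gridIndex m a = k ↔ (k : ℝ≥0) / (m + 1) ≤ a ∧ a < gridPoint m k := by
  have hm : (0 : ℝ≥0) < m + 1 := by positivity
  rw [gridIndex, Nat.floor_eq_iff (by positivity), gridPoint, div_le_iff₀ hm, lt_div_iff₀ hm]

theorem lt_gridPoint (m : ℕ) (a : ℝ≥0) : a < gridPoint m (gridIndex m a) :=
  ((gridIndex_eq_iff m _ a).1 rfl).2

theorem tendsto_gridPoint (a : ℝ≥0) :
    Tendsto (fun m => gridPoint m (gridIndex m a)) atTop (𝓝 a) := by
  have h : ∀ m, gridPoint m (gridIndex m a) ≤ a + 1 / ((m : ℝ≥0) + 1) := by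
    intro m
    have := ((gridIndex_eq_iff m _ a).1 rfl).1
    rw [gridPoint, add_div]
    gcongr
  refine tendsto_of_tendsto_of_tendsto_of_le_of_le tendsto_const_nhds ?_
    (fun m => (lt_gridPoint m a).le) h
  have h1 : Tendsto (fun m : ℕ => 1 / ((m : ℝ≥0) + 1)) atTop (𝓝 0) :=
    tendsto_one_div_add_atTop_nhds_zero_nat
  simpa using h1.const_add a

namespace IsModel

variable [IsProbabilityMeasure P]

/-- The strong Markov property: after a random time `τ`, the next energy arrival takes an
exponentially distributed time that is independent of the past. -/
theorem strong_markov (hm : IsModel q N er P) {τ : Ω → ℝ≥0∞} {H : Set Ω}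
    (hH : ∀ t : ℝ≥0, MeasurableSet[history N er t] (H ∩ {ω | τ ω ≤ t}))
    (hfin : ∀ ω ∈ H, τ ω ≠ ⊤) (d : ℝ≥0) :
    P (H ∩ {ω | τ ω + d < nextArrival N (τ ω) ω}) = P H * ENNReal.ofReal (Real.exp (-d)) := by
  -- The cells are half-open, so the strict inequality is needed; it is a union over countably many
  -- rational times.
  have hlt : ∀ t : ℝ≥0, MeasurableSet[history N er t] (H ∩ {ω | τ ω < t}) := by
    intro t
    have : H ∩ {ω | τ ω < t} = ⋃ (s : ℝ≥0) (_ : s ∈ {s : ℝ≥0 | s < t} ∩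
        Set.range (fun x : ℚ => Real.toNNReal x)), H ∩ {ω | τ ω ≤ s} := by
      ext ω
      simp only [Set.mem_inter_iff, Set.mem_ofPred_eq, Set.mem_iUnion, exists_prop]
      constructor
      · rintro ⟨h1, h2⟩
        obtain ⟨r, -, h3, h4⟩ := ENNReal.lt_iff_exists_rat_btwn.1 h2
        exact ⟨Real.toNNReal r, ⟨ENNReal.coe_lt_coe.1 h4, r, rfl⟩, h1, h3.le⟩
      · rintro ⟨s, ⟨h1, -⟩, h2, h3⟩
        exact ⟨h2, lt_of_le_of_lt h3 (ENNReal.coe_lt_coe.2 h1)⟩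
    rw [this]
    refine MeasurableSet.biUnion ((Set.countable_range _).mono Set.inter_subset_right) ?_
    intro s hs
    exact history_mono (le_of_lt hs.1) _ (hH s)
  have hcell : ∀ m k : ℕ, MeasurableSet[history N er (gridPoint m k)]
      (H ∩ {ω | gridIndex m (τ ω).toNNReal = k}) := by
    intro m k
    have e : H ∩ {ω | gridIndex m (τ ω).toNNReal = k} =
        (H ∩ {ω | τ ω < gridPoint m k}) \ (H ∩ {ω | τ ω < ((k : ℝ≥0) / (m + 1) : ℝ≥0)}) := by
      ext ω
      simp only [Set.mem_inter_iff, Set.mem_ofPred_eq, Set.mem_sdiff, gridIndex_eq_iff]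
      by_cases hω : ω ∈ H
      · have h1 := ENNReal.coe_toNNReal (hfin ω hω)
        rw [← h1]
        simp only [ENNReal.coe_lt_coe, ENNReal.toNNReal_coe, hω, true_and, not_lt]
        exact and_comm
      · simp [hω]
    rw [e]
    refine (hlt _).diff (history_mono ?_ _ (hlt _))
    rw [gridPoint]
    gcongr
    exact le_self_add
  have hHm : MeasurableSet H := by
    have : H = ⋃ n : ℕ, H ∩ {ω | τ ω ≤ (n : ℝ≥0)} := by
      ext ω
      simp only [Set.mem_iUnion, Set.mem_inter_iff, Set.mem_ofPred_eq]
      refine ⟨fun h => ?_, fun ⟨_, h, _⟩ => h⟩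
      obtain ⟨n, hn⟩ := ENNReal.exists_nat_gt (hfin ω h)
      exact ⟨n, h, by simpa using hn.le⟩
    rw [this]
    exact MeasurableSet.iUnion fun n => hm.history_le _ _ (hH n)
  -- Here τ is replaced by the right end of its cell. Splitting over the cells reduces to
  -- deterministic times, so `A m` has exactly the asserted probability for every `m`.
  let A : ℕ → Set Ω := fun m => H ∩ {ω |
    N (gridPoint m (gridIndex m (τ ω).toNNReal) + d) ω =
      N (gridPoint m (gridIndex m (τ ω).toNNReal)) ω}
  have hAeq : ∀ m, A m = ⋃ k, (H ∩ {ω | gridIndex m (τ ω).toNNReal = k}) ∩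
      {ω | N (gridPoint m k + d) ω = N (gridPoint m k) ω} := by
    intro m
    ext ω
    simp only [A, Set.mem_inter_iff, Set.mem_ofPred_eq, Set.mem_iUnion]
    constructor
    · rintro ⟨h1, h2⟩
      exact ⟨_, ⟨h1, rfl⟩, h2⟩
    · rintro ⟨k, ⟨h1, rfl⟩, h2⟩
      exact ⟨h1, h2⟩
  have hcellm : ∀ m k, MeasurableSet (H ∩ {ω | gridIndex m (τ ω).toNNReal = k}) :=
    fun m k => hm.history_le _ _ (hcell m k)
  have hNm : ∀ s t : ℝ≥0, MeasurableSet {ω | N s ω = N t ω} := fun s t =>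
    measurableSet_eq_fun (hm.poisson.measurable s) (hm.poisson.measurable t)
  have hdisj : ∀ m, Pairwise (Function.onFun Disjoint
      fun k => H ∩ {ω | gridIndex m (τ ω).toNNReal = k}) := by
    intro m i j hij
    rw [Function.onFun, Set.disjoint_left]
    rintro ω ⟨-, h1⟩ ⟨-, h2⟩
    exact hij (h1.symm.trans h2)
  have hAm : ∀ m, MeasurableSet (A m) := fun m => by
    rw [hAeq]
    exact MeasurableSet.iUnion fun k => (hcellm m k).inter (hNm _ _)
  have hPA : ∀ m, P (A m) = P H * ENNReal.ofReal (Real.exp (-d)) := by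
    intro m
    rw [hAeq, measure_iUnion]
    · simp_rw [hm.prob_inter_no_arrival _ d (hcell m _), ENNReal.tsum_mul_right]
      rw [← measure_iUnion (hdisj m) (hcellm m)]
      congr 2
      ext ω
      simp
    · intro i j hij
      exact (hdisj m hij).mono Set.inter_subset_left Set.inter_subset_left
    · exact fun k => (hcellm m k).inter (hNm _ _)
  have hlim : Tendsto (fun m => P (A m)) atTop
      (𝓝 (P (H ∩ {ω | τ ω + d < nextArrival N (τ ω) ω}))) := by
    -- The cell ends decrease towards τ from the right, and integer-valued right-continuous paths
    -- are constant just after τ and just after τ + d. So each indicator is eventually equal to its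
    -- limit.
    refine tendsto_measure_of_tendsto_indicator_of_isFiniteMeasure atTop P hAm ?_
    intro ω
    by_cases hω : ω ∈ H
    · have h1 := ENNReal.coe_toNNReal (hfin ω hω)
      set a := (τ ω).toNNReal with ha
      have hg := tendsto_gridPoint a
      have hg1 : Tendsto (fun m => gridPoint m (gridIndex m a)) atTop (𝓝[≥] a) :=
        tendsto_nhdsWithin_iff.2 ⟨hg, Eventually.of_forall fun m => (lt_gridPoint m a).le⟩
      have hg2 : Tendsto (fun m => gridPoint m (gridIndex m a) + d) atTop (𝓝[≥] (a + d)) :=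
        tendsto_nhdsWithin_iff.2 ⟨hg.add_const d, Eventually.of_forall fun m => by
          simpa using (lt_gridPoint m a).le⟩
      filter_upwards [hg1.eventually (hm.poisson.eventually_eq ω a),
        hg2.eventually (hm.poisson.eventually_eq ω (a + d))] with m h2 h3
      simp only [A, Set.mem_inter_iff, Set.mem_ofPred_eq, hω, true_and, ← ha]
      rw [h2, h3, ← h1, ← ENNReal.coe_add, lt_nextArrival_add_iff hm.poisson]
    · exact Eventually.of_forall fun m => by simp [A, hω]
  simp_rw [hPA] at hlim
  exact (tendsto_nhds_unique hlim tendsto_const_nhds)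

end IsModel

end StatusUpdate

/-! ### Energy waiting times: exponential law and independence of the past -/

namespace StatusUpdate

variable {Ω : Type*} {N : ℝ≥0 → Ω → ℕ} {er : ℕ → Ω → Bool} {q : ℝ}

theorem measurable_of_le_coe {m : MeasurableSpace Ω} {f : Ω → ℝ≥0∞}
    (h : ∀ t : ℝ≥0, MeasurableSet {ω | f ω ≤ t}) : Measurable f := by
  refine measurable_of_Iic fun x => ?_
  induction x with
  | top => simp
  | coe x => exact h x

theorem gap_nonneg (a : ℝ≥0∞) (ω : Ω) : 0 ≤ gap N a ω := ENNReal.toReal_nonneg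

theorem measurable_history (N : ℝ≥0 → Ω → ℕ) (er : ℕ → Ω → Bool) {u t : ℝ≥0} (h : u ≤ t) :
    Measurable[history N er t] (N u) :=
  measurable_iff_comap_le.2
    ((le_iSup₂ (f := fun (v : ℝ≥0) (_ : v ≤ t) => MeasurableSpace.comap (N v) ⊤) u h).trans
      le_sup_left)

theorem measurable_history_er (N : ℝ≥0 → Ω → ℕ) (er : ℕ → Ω → Bool) (k : ℕ) (t : ℝ≥0) :
    Measurable[history N er t] (er k) :=
  measurable_iff_comap_le.2
    ((le_iSup (fun k => MeasurableSpace.comap (er k) ⊤) k).trans le_sup_right)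

theorem measurable_gap {m : MeasurableSpace Ω} {τ : Ω → ℝ≥0∞}
    (hτ : Measurable[m] τ) (hτ' : Measurable[m] (fun ω => nextArrival N (τ ω) ω)) :
    Measurable[m] (fun ω => gap N (τ ω) ω) :=
  (hτ'.sub hτ).ennreal_toReal

/-- The paths do not jump right after τ, so an arrival in (τ, t] is still seen when counting starts
at a slightly later rational time. This writes the event as a countable union. -/
theorem IsModel.setOf_nextArrival_le {mΩ : MeasurableSpace Ω} {P : Measure Ω}
    (hm : IsModel q N er P) (τ : Ω → ℝ≥0∞) (t : ℝ≥0) :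
    {ω | nextArrival N (τ ω) ω ≤ t} = ⋃ (s : ℝ≥0) (_ : s ∈ {s : ℝ≥0 | s < t} ∩
        Set.range (fun x : ℚ => Real.toNNReal x)), {ω | τ ω ≤ s} ∩ {ω | N s ω < N t ω} := by
  ext ω
  simp only [Set.mem_inter_iff, Set.mem_ofPred_eq, Set.mem_iUnion, exists_prop,
    nextArrival_le_iff hm.poisson]
  constructor
  · rintro ⟨h1, h2⟩
    obtain ⟨a, ha⟩ := WithTop.ne_top_iff_exists.1 (h1.trans_lt ENNReal.coe_lt_top).ne
    replace ha : (a : ℝ≥0∞) = τ ω := ha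
    rw [← ha] at h1 h2 ⊢
    simp only [ENNReal.toNNReal_coe, ENNReal.coe_le_coe] at h1 h2 ⊢
    have hat : a < t := lt_of_le_of_ne h1 (by rintro rfl; exact lt_irrefl _ h2)
    have h3 : ∀ᶠ u in 𝓝[>] a, N u ω = N a ω :=
      (hm.poisson.eventually_eq ω a).filter_mono
        (nhdsWithin_mono _ Set.Ioi_subset_Ici_self)
    obtain ⟨b, hab, hb⟩ := (mem_nhdsGT_iff_exists_Ioo_subset' hat).1 h3
    obtain ⟨r, -, h4, h5⟩ :=
      ENNReal.lt_iff_exists_rat_btwn.1 (ENNReal.coe_lt_coe.2 (lt_min hab hat))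
    have h4' := ENNReal.coe_lt_coe.1 h4
    have h5' := ENNReal.coe_lt_coe.1 h5
    refine ⟨Real.toNNReal r, ⟨h5'.trans_le (min_le_right _ _), r, rfl⟩, h4'.le, ?_⟩
    have h6 : N (Real.toNNReal r) ω = N a ω := hb ⟨h4', h5'.trans_le (min_le_left _ _)⟩
    rw [h6]
    exact h2
  · rintro ⟨s, ⟨h1, -⟩, h2, h3⟩
    refine ⟨h2.trans (ENNReal.coe_le_coe.2 (le_of_lt h1)), lt_of_le_of_lt ?_ h3⟩
    exact hm.poisson.mono ω (ENNReal.toNNReal_mono ENNReal.coe_ne_top h2)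

variable [mΩ : MeasurableSpace Ω] {P : Measure Ω}

namespace IsModel

/-- The σ-algebra is left free because the lemma is applied to `history`, to `info` and to
`arrivalsAndFeedback`. -/
theorem measurableSet_nextArrival_le (hm : IsModel q N er P) {τ : Ω → ℝ≥0∞} {t : ℝ≥0}
    {m : MeasurableSpace Ω} (hN : ∀ u ≤ t, Measurable[m] (N u))
    (hτ : ∀ u ≤ t, MeasurableSet[m] {ω | τ ω ≤ u}) :
    MeasurableSet[m] {ω | nextArrival N (τ ω) ω ≤ t} := by
  rw [hm.setOf_nextArrival_le]
  refine MeasurableSet.biUnion ((Set.countable_range _).mono Set.inter_subset_right) ?_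
  intro s hs
  exact (hτ s (le_of_lt hs.1)).inter
    (measurableSet_lt (hN s (le_of_lt hs.1)) (hN t le_rfl))

theorem isStoppingTime_iff (hm : IsModel q N er P) {τ : Ω → ℝ≥0∞} :
    IsStoppingTime hm.filtration τ ↔
      ∀ t : ℝ≥0, MeasurableSet[history N er t] {ω | τ ω ≤ t} := Iff.rfl

theorem isStoppingTime_nextArrival (hm : IsModel q N er P) {τ : Ω → ℝ≥0∞}
    (hτ : IsStoppingTime hm.filtration τ) :
    IsStoppingTime hm.filtration (fun ω => nextArrival N (τ ω) ω) := by
  rw [isStoppingTime_iff] at hτ ⊢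
  intro t
  exact hm.measurableSet_nextArrival_le (fun u hu => measurable_history N er hu)
    (fun u hu => history_mono hu _ (hτ u))

theorem measurable_stoppingTime (hm : IsModel q N er P) {τ : Ω → ℝ≥0∞}
    (hτ : IsStoppingTime hm.filtration τ) : Measurable[hτ.measurableSpace] τ :=
  measurable_of_le_coe fun t => hτ.measurableSet_le' t

theorem measurable_er_past (hm : IsModel q N er P) {τ : Ω → ℝ≥0∞}
    (hτ : IsStoppingTime hm.filtration τ) (k : ℕ) : Measurable[hτ.measurableSpace] (er k) := by
  intro s hs
  refine ⟨?_, fun t => ?_⟩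
  · exact (le_iSup hm.filtration 0) _ (measurable_history_er N er k 0 hs)
  · exact MeasurableSet.inter (measurable_history_er N er k t hs) (hτ t)

variable [IsProbabilityMeasure P]

/-- By the strong Markov property, waiting forever is at most as likely as waiting longer than d,
which has probability at most e^(-d), for every d. -/
theorem ae_nextArrival_lt_top (hm : IsModel q N er P) {τ : Ω → ℝ≥0∞}
    (hτ : IsStoppingTime hm.filtration τ) (hfin : ∀ᵐ ω ∂P, τ ω < ⊤) :
    ∀ᵐ ω ∂P, nextArrival N (τ ω) ω < ⊤ := by
  have hH : MeasurableSet[hτ.measurableSpace] {ω | τ ω < ⊤} :=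
    hm.measurable_stoppingTime hτ measurableSet_Iio
  have h1 : ∀ d : ℝ≥0, P {ω | τ ω < ⊤ ∧ nextArrival N (τ ω) ω = ⊤} ≤
      ENNReal.ofReal (Real.exp (-d)) := by
    intro d
    have h2 := hm.strong_markov hH.2 (fun ω h => ne_of_lt h) d
    calc _ ≤ P ({ω | τ ω < ⊤} ∩ {ω | τ ω + d < nextArrival N (τ ω) ω}) := by
          refine measure_mono fun ω hω => ⟨hω.1, ?_⟩
          simp only [Set.mem_ofPred_eq]
          rw [hω.2]
          exact ENNReal.add_lt_top.2 ⟨hω.1, ENNReal.coe_lt_top⟩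
      _ ≤ 1 * _ := by
          rw [h2]
          gcongr
          exact prob_le_one
      _ = _ := one_mul _
  have h3 : Tendsto (fun d : ℝ≥0 => ENNReal.ofReal (Real.exp (-d))) atTop (𝓝 0) := by
    have : Tendsto (fun d : ℝ≥0 => Real.exp (-(d : ℝ))) atTop (𝓝 0) :=
      Real.tendsto_exp_neg_atTop_nhds_zero.comp (NNReal.tendsto_coe_atTop.2 tendsto_id)
    simpa using ENNReal.tendsto_ofReal this
  have h4 : P {ω | τ ω < ⊤ ∧ nextArrival N (τ ω) ω = ⊤} = 0 :=
    le_antisymm (ge_of_tendsto' h3 h1) zero_le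
  have h5 : ∀ᵐ ω ∂P, ¬ (τ ω < ⊤ ∧ nextArrival N (τ ω) ω = ⊤) := measure_eq_zero_iff_ae_notMem.1 h4
  filter_upwards [hfin, h5] with ω h6 h7
  exact lt_top_iff_ne_top.2 fun h => h7 ⟨h6, h⟩

theorem measure_inter_gap (hm : IsModel q N er P) {τ : Ω → ℝ≥0∞}
    (hτ : IsStoppingTime hm.filtration τ) (hfin : ∀ᵐ ω ∂P, τ ω < ⊤) {H : Set Ω}
    (hH : MeasurableSet[hτ.measurableSpace] H) {x : ℝ} (hx : 0 ≤ x) :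
    P (H ∩ {ω | x < gap N (τ ω) ω}) = P H * ENNReal.ofReal (Real.exp (-x)) := by
  lift x to ℝ≥0 using hx
  have hH' : MeasurableSet[hτ.measurableSpace] (H ∩ {ω | τ ω < ⊤}) :=
    hH.inter (hm.measurable_stoppingTime hτ measurableSet_Iio)
  have h2 := hm.strong_markov hH'.2 (fun ω h => ne_of_lt h.2) x
  have e1 : P (H ∩ {ω | τ ω < ⊤}) = P H := by
    refine measure_congr ?_
    filter_upwards [hfin] with ω h
    exact propext ⟨fun h' => h'.1, fun h' => ⟨h', h⟩⟩
  rw [e1] at h2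
  refine Eq.trans ?_ h2
  refine measure_congr ?_
  filter_upwards [hfin, hm.ae_nextArrival_lt_top hτ hfin] with ω h h'
  refine propext (and_congr ⟨fun a => ⟨a, h⟩, fun a => a.1⟩ ?_)
  change (x : ℝ) < (nextArrival N (τ ω) ω - τ ω).toReal ↔
    τ ω + (x : ℝ≥0∞) < nextArrival N (τ ω) ω
  rw [← lt_tsub_iff_left, ← ENNReal.toReal_lt_toReal ENNReal.coe_ne_top
    (tsub_le_self.trans_lt h').ne, ENNReal.coe_toReal]

theorem map_gap (hm : IsModel q N er P) {τ : Ω → ℝ≥0∞}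
    (hτ : IsStoppingTime hm.filtration τ) (hfin : ∀ᵐ ω ∂P, τ ω < ⊤) :
    P.map (fun ω => gap N (τ ω) ω) = expMeasure 1 := by
  have hτm : Measurable τ := (hm.measurable_stoppingTime hτ).mono hτ.measurableSpace_le le_rfl
  have hτ' := hm.isStoppingTime_nextArrival hτ
  have hgm : Measurable (fun ω => gap N (τ ω) ω) := measurable_gap hτm
    ((hm.measurable_stoppingTime hτ').mono hτ'.measurableSpace_le le_rfl)
  have := Measure.isProbabilityMeasure_map hgm.aemeasurable (μ := P)
  have := isProbabilityMeasure_expMeasure one_pos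
  refine Measure.eq_of_cdf _ _ ?_
  ext x
  rw [cdf_expMeasure_eq one_pos, cdf_eq_real, map_measureReal_apply hgm measurableSet_Iic]
  have hc : (fun ω => gap N (τ ω) ω) ⁻¹' Set.Iic x = {ω | x < gap N (τ ω) ω}ᶜ := by
    ext ω; simp
  split_ifs with hx
  · rw [hc, probReal_compl_eq_one_sub (measurableSet_lt measurable_const hgm), measureReal_def]
    have := hm.measure_inter_gap hτ hfin (H := Set.univ) MeasurableSet.univ hx
    rw [Set.univ_inter] at this
    rw [this]
    simp [ENNReal.toReal_ofReal (Real.exp_pos _).le]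
  · rw [measureReal_eq_zero_iff]
    have : (fun ω => gap N (τ ω) ω) ⁻¹' Set.Iic x = ∅ := by
      ext ω
      simp only [Set.mem_preimage, Set.mem_Iic, Set.mem_empty_iff_false, iff_false, not_le]
      exact (not_le.1 hx).trans_le (gap_nonneg _ _)
    rw [this, measure_empty]

theorem indep_past_gap (hm : IsModel q N er P) {τ : Ω → ℝ≥0∞}
    (hτ : IsStoppingTime hm.filtration τ) (hfin : ∀ᵐ ω ∂P, τ ω < ⊤) :
    Indep hτ.measurableSpace
      (MeasurableSpace.comap (fun ω => gap N (τ ω) ω) inferInstance) P := by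
  have hτm : Measurable τ := (hm.measurable_stoppingTime hτ).mono hτ.measurableSpace_le le_rfl
  have hτ' := hm.isStoppingTime_nextArrival hτ
  have hgm : Measurable (fun ω => gap N (τ ω) ω) := measurable_gap hτm
    ((hm.measurable_stoppingTime hτ').mono hτ'.measurableSpace_le le_rfl)
  refine IndepSets.indep hτ.measurableSpace_le hgm.comap_le
    (@MeasurableSpace.isPiSystem_measurableSet Ω hτ.measurableSpace)
    (isPiSystem_Ioi.comap (fun ω => gap N (τ ω) ω))
    (@MeasurableSpace.generateFrom_measurableSet Ω hτ.measurableSpace).symm ?_ ?_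
  · rw [BorelSpace.measurable_eq (α := ℝ), borel_eq_generateFrom_Ioi,
      MeasurableSpace.comap_generateFrom]
    rfl
  · rw [IndepSets_iff]
    rintro H _ hH ⟨_, ⟨x, rfl⟩, rfl⟩
    change P (H ∩ {ω | x < gap N (τ ω) ω}) = P H * P {ω | x < gap N (τ ω) ω}
    rcases le_or_gt 0 x with hx | hx
    · have := hm.measure_inter_gap hτ hfin (H := Set.univ) MeasurableSet.univ hx
      rw [Set.univ_inter, measure_univ, one_mul] at this
      rw [this, hm.measure_inter_gap hτ hfin hH hx]
    · have : {ω | x < gap N (τ ω) ω} = Set.univ :=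
        Set.eq_univ_of_forall fun ω => hx.trans_le (gap_nonneg _ _)
      rw [this, Set.inter_univ, measure_univ, mul_one]

theorem indepFun_gap (hm : IsModel q N er P) {τ : Ω → ℝ≥0∞}
    (hτ : IsStoppingTime hm.filtration τ) (hfin : ∀ᵐ ω ∂P, τ ω < ⊤) {β : Type*}
    [MeasurableSpace β] {f : Ω → β} (hf : Measurable[hτ.measurableSpace] f) :
    IndepFun f (fun ω => gap N (τ ω) ω) P := by
  rw [IndepFun_iff_Indep]
  exact indep_of_indep_of_le_left (hm.indep_past_gap hτ hfin) hf.comap_le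

end IsModel

end StatusUpdate

/-! ### The value functions and the optimality equations -/

namespace StatusUpdate

/-- The optimal threshold `γ` for the channel with erasure probability `q`. -/
structure IsThreshold (q γ : ℝ) : Prop where
  pos : 0 < γ
  eq : Real.exp (-γ) + q / (1 - q) = γ ^ 2 / 2 + γ * (q / (1 - q))

theorem exists_isThreshold {q : ℝ} (hq0 : 0 < q) (hq1 : q < 1) : ∃ γ, IsThreshold q γ := by
  set c := q / (1 - q) with hc
  have hc0 : 0 < c := div_pos hq0 (by linarith)
  let f : ℝ → ℝ := fun γ => γ ^ 2 / 2 + γ * c - Real.exp (-γ) - c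
  have hf : ContinuousOn f (Set.Icc 0 2) := by fun_prop
  have h := intermediate_value_Icc (by norm_num : (0 : ℝ) ≤ 2) hf
  -- The end values are f 0 = -1 - c and f 2 = 2 + c - e^(-2).
  have h0 : (0 : ℝ) ∈ Set.Icc (f 0) (f 2) := by
    have : Real.exp (-2) ≤ 1 := by simp
    constructor <;> simp only [f] <;> norm_num <;> linarith
  obtain ⟨γ, hγ, hγ0⟩ := h h0
  simp only [f] at hγ0
  refine ⟨γ, lt_of_le_of_ne hγ.1 ?_, by rw [← hc]; linarith⟩
  rintro rfl
  norm_num at hγ0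
  linarith

/-- The minimal long-term average age of information. -/
noncomputable def optAoI (q γ : ℝ) : ℝ := γ + q / (1 - q)

/-- The cost of an epoch of length `t`. -/
noncomputable def epochCost (q γ t : ℝ) : ℝ := t ^ 2 / 2 - optAoI q γ * t

/-- The expected cost of an epoch when an attempt is made at age `t ≥ γ`. -/
noncomputable def attemptCost (q γ t : ℝ) : ℝ :=
  t ^ 2 / 2 - γ * t + q / (1 - q) ^ 2 - optAoI q γ * (q / (1 - q))

/-- The minimal expected cost of an epoch at age `a` with a full battery. -/
noncomputable def fullCost (q γ a : ℝ) : ℝ := attemptCost q γ (max a γ)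

/-- The minimal expected cost of an epoch at age `a` with an empty battery. -/
noncomputable def emptyCost (q γ a : ℝ) : ℝ :=
  attemptCost q γ (max a γ) + (max a γ - γ) + Real.exp (-(max a γ - a))

variable {q γ : ℝ}

/-- If attempts are made at age t and then at every arrival, the epoch ends at age t + S, where S is
a sum of a geometric number of unit exponentials, E S = q/(1-q) and E S² = 2q/(1-q)². Averaging
`epochCost` over S gives `attemptCost`. The identity conditions on the first attempt: an erasure
adds one unit exponential to the age, which raises the mean by (t - γ) + 1. -/
theorem attemptCost_eq (hq1 : q < 1) (t : ℝ) :
    attemptCost q γ t = (1 - q) * epochCost q γ t + q * (attemptCost q γ t + (t - γ) + 1) := by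
  have : 1 - q ≠ 0 := by linarith
  simp only [attemptCost, epochCost, optAoI]
  field_simp
  ring

theorem fullCost_le_emptyCost (a : ℝ) : fullCost q γ a ≤ emptyCost q γ a := by
  have h1 : γ ≤ max a γ := le_max_right _ _
  have h2 := Real.exp_pos (-(max a γ - a))
  simp only [fullCost, emptyCost]
  linarith

theorem attemptCost_mono {s t : ℝ} (hs : γ ≤ s) (h : s ≤ t) :
    attemptCost q γ s ≤ attemptCost q γ t := by
  simp only [attemptCost]
  nlinarith

theorem fullCost_mono : Monotone (fullCost q γ) := fun _ _ h =>
  attemptCost_mono (le_max_right _ _) (max_le_max_right _ h)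

theorem emptyCost_of_le {a : ℝ} (h : γ ≤ a) :
    emptyCost q γ a = attemptCost q γ a + (a - γ) + 1 := by
  simp [emptyCost, max_eq_left h]

theorem emptyCost_of_ge {a : ℝ} (h : a ≤ γ) :
    emptyCost q γ a = attemptCost q γ γ + Real.exp (-(γ - a)) := by
  simp [emptyCost, max_eq_right h]

/-- An epoch starts at age zero with an empty battery. The threshold equation is the condition that,
with λ charged per unit of time, a whole epoch is free on average; so a success resets the current
charge to zero. -/
theorem emptyCost_zero (hq1 : q < 1) (hγ : IsThreshold q γ) : emptyCost q γ 0 = 0 := by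
  have h1 : 1 - q ≠ 0 := by linarith
  have h2 := hγ.eq
  rw [emptyCost_of_ge hγ.pos.le]
  have h3 : q / (1 - q) ^ 2 = q / (1 - q) + (q / (1 - q)) ^ 2 := by
    field_simp
    ring
  simp only [attemptCost, optAoI, h3, sub_zero]
  linear_combination h2

theorem fullCost_eq_of_le (hq1 : q < 1) {t : ℝ} (h : γ ≤ t) :
    (1 - q) * epochCost q γ t + q * emptyCost q γ t = fullCost q γ t := by
  rw [emptyCost_of_le h, fullCost, max_eq_left h, ← attemptCost_eq hq1]

/-- With δ = γ - t > 0, the loss caused by an attempt that is too early is (1-q)δ²/2 + q(e^(-δ) - 1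
+ δ), which is nonnegative. -/
theorem fullCost_le (hq0 : 0 < q) (hq1 : q < 1) (t : ℝ) :
    fullCost q γ t ≤ (1 - q) * epochCost q γ t + q * emptyCost q γ t := by
  rcases le_total γ t with h | h
  · rw [fullCost_eq_of_le hq1 h]
  · rw [emptyCost_of_ge h, fullCost, max_eq_right h]
    nth_rewrite 1 [attemptCost_eq hq1]
    have h1 : 1 - (γ - t) ≤ Real.exp (-(γ - t)) := by
      have := Real.add_one_le_exp (-(γ - t))
      linarith
    have h2 : (1 - q) * epochCost q γ t - (1 - q) * epochCost q γ γ =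
        q * (γ - t) + (1 - q) * (γ - t) ^ 2 / 2 := by
      have : 1 - q ≠ 0 := by linarith
      simp only [epochCost, optAoI]
      field_simp
      ring
    have h3 : 0 ≤ (1 - q) * (γ - t) ^ 2 / 2 := by
      have : 0 < 1 - q := by linarith
      positivity
    nlinarith

/-- This accounts for the unfinished epoch at time T in the upper bound. From γ on, `fullCost`
exceeds `epochCost` by q/(1-q) times the age, up to a constant, so only a constant is lost. -/
theorem epochCost_le_fullCost (hq0 : 0 < q) (hq1 : q < 1) (hγ : IsThreshold q γ) {t : ℝ}
    (ht : 0 ≤ t) :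
    epochCost q γ t ≤ fullCost q γ t + (γ ^ 2 + optAoI q γ * (q / (1 - q))) := by
  have hp : 0 < 1 - q := by linarith
  have hc : 0 < q / (1 - q) := div_pos hq0 hp
  have h2 : 0 < q / (1 - q) ^ 2 := by positivity
  have hg := hγ.pos
  simp only [fullCost, epochCost, attemptCost]
  rcases le_total γ t with h | h
  · rw [max_eq_left h]
    simp only [optAoI]
    nlinarith [mul_nonneg ht hc.le]
  · rw [max_eq_right h]
    simp only [optAoI]
    nlinarith [mul_nonneg ht hc.le]

/-- The counterpart for the lower bound. Here `emptyCost` may exceed `epochCost` by about (c + 1)t;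
completing the square absorbs this into εt²/2 at the price of (c + 1)²/(2ε). This is the origin of
the factor 1 + ε in the lower bound. -/
theorem emptyCost_le_epochCost (hq0 : 0 < q) (hq1 : q < 1) (hγ : IsThreshold q γ) {ε : ℝ}
    (hε : 0 < ε) : ∃ C, ∀ t, 0 ≤ t →
      emptyCost q γ t ≤ epochCost q γ t + ε * t ^ 2 / 2 + C := by
  have hp : 0 < 1 - q := by linarith
  have hc : 0 < q / (1 - q) := div_pos hq0 hp
  have hg := hγ.pos
  set c := q / (1 - q) with hcdef
  have key : ∀ t, 0 ≤ t → emptyCost q γ t ≤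
      t ^ 2 / 2 - γ * t + q / (1 - q) ^ 2 + t + 1 + γ ^ 2 := by
    intro t ht
    have hl : 0 < optAoI q γ := by rw [optAoI]; linarith
    have h5 := mul_pos hl hc
    rcases le_total γ t with h | h
    · rw [emptyCost_of_le h, attemptCost, ← hcdef]
      nlinarith
    · rw [emptyCost_of_ge h, attemptCost, ← hcdef]
      have : Real.exp (-(γ - t)) ≤ 1 := Real.exp_le_one_iff.2 (by linarith)
      nlinarith
  refine ⟨q / (1 - q) ^ 2 + 1 + γ ^ 2 + (c + 1) ^ 2 / (2 * ε), fun t ht => ?_⟩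
  have h1 : (c + 1) * t ≤ ε * t ^ 2 / 2 + (c + 1) ^ 2 / (2 * ε) := by
    have h2 : ε * t ^ 2 / 2 + (c + 1) ^ 2 / (2 * ε) - (c + 1) * t =
        (ε * t - (c + 1)) ^ 2 / (2 * ε) := by
      field_simp
      ring
    have h3 : 0 ≤ (ε * t - (c + 1)) ^ 2 / (2 * ε) := by positivity
    linarith
  have h4 := key t ht
  simp only [epochCost, optAoI, ← hcdef]
  linarith

@[fun_prop]
theorem continuous_epochCost : Continuous (epochCost q γ) := by
  unfold epochCost
  fun_prop

@[fun_prop]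
theorem continuous_fullCost : Continuous (fullCost q γ) := by
  unfold fullCost attemptCost
  fun_prop

@[fun_prop]
theorem continuous_emptyCost : Continuous (emptyCost q γ) := by
  unfold emptyCost attemptCost
  fun_prop

/-- The infinitesimal form of waiting for an arrival of rate one. The derivative from the right is
all that the fundamental theorem of calculus requires, and at γ it only sees the upper branch. -/
theorem hasDerivWithinAt_emptyCost (x : ℝ) :
    HasDerivWithinAt (emptyCost q γ) (emptyCost q γ x - fullCost q γ x) (Set.Ioi x) x := by
  rcases lt_or_ge x γ with h | h
  · have h1 : HasDerivAt (fun a => attemptCost q γ γ + Real.exp (-(γ - a)))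
        (Real.exp (-(γ - x))) x := by
      have : HasDerivAt (fun a : ℝ => -(γ - a)) 1 x := by
        simpa [neg_sub] using (hasDerivAt_id x).sub_const γ
      simpa using (this.exp).const_add (attemptCost q γ γ)
    have h2 : emptyCost q γ x - fullCost q γ x = Real.exp (-(γ - x)) := by
      simp [emptyCost_of_ge h.le, fullCost, max_eq_right h.le]
    rw [h2]
    refine (h1.congr_of_eventuallyEq ?_).hasDerivWithinAt
    filter_upwards [Iio_mem_nhds h] with a ha
    exact emptyCost_of_ge (le_of_lt ha)
  · have h1 : HasDerivAt (fun a => attemptCost q γ a + (a - γ) + 1) (x - γ + 1) x := by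
      have h3 : HasDerivAt (fun t => t ^ 2 / 2 - γ * t + q / (1 - q) ^ 2 -
          optAoI q γ * (q / (1 - q))) (x - γ) x := by
        have h4 := ((((hasDerivAt_id x).pow 2).div_const 2).sub
          ((hasDerivAt_id x).const_mul γ))
        have h5 := (h4.add_const (q / (1 - q) ^ 2)).sub_const (optAoI q γ * (q / (1 - q)))
        simpa using h5
      exact (h3.add ((hasDerivAt_id x).sub_const γ)).add_const 1
    have h2 : emptyCost q γ x - fullCost q γ x = x - γ + 1 := by
      simp [emptyCost_of_le h, fullCost, max_eq_left h]
      ring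
    rw [h2]
    refine h1.hasDerivWithinAt.congr (fun a ha => ?_) (emptyCost_of_le h)
    exact emptyCost_of_le (h.trans (le_of_lt ha))

/-- The cost-to-go at the next arrival `a + x` or at age `a + d`, whichever comes first. -/
noncomputable def nextCost (q γ a d x : ℝ) : ℝ :=
  if x ≤ d then fullCost q γ (a + x) else emptyCost q γ (a + d)

/-- By the differential equation for `emptyCost`, -e^(-x) `emptyCost` (a + x) is an antiderivative
of e^(-x) `fullCost` (a + x). The waiting is cut off at d because everything is stopped at a finite
horizon. -/
theorem integral_nextCost (a : ℝ) {d : ℝ} (hd : 0 ≤ d) :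
    ∫ x, nextCost q γ a d x ∂(expMeasure 1) = emptyCost q γ a := by
  have hprob := isProbabilityMeasure_expMeasure (r := 1) one_pos
  have hcdf : ∀ x, 0 ≤ x → (expMeasure 1).real (Set.Iic x) = 1 - Real.exp (-x) := by
    intro x hx
    rw [← cdf_eq_real, cdf_expMeasure_eq one_pos, if_pos hx, one_mul]
  have h0 : (expMeasure 1) (Set.Iic 0) = 0 := by
    have := hcdf 0 le_rfl
    simpa [measureReal_eq_zero_iff] using this
  have hIoc : (expMeasure 1).real (Set.Ioc 0 d)ᶜ = Real.exp (-d) := by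
    have h1 : (expMeasure 1).real (Set.Ioc 0 d) = 1 - Real.exp (-d) := by
      rw [← hcdf d hd]
      refine measureReal_congr ?_
      filter_upwards [measure_eq_zero_iff_ae_notMem.1 h0] with x hx
      exact propext ⟨fun h => h.2, fun h => ⟨not_le.1 hx, h⟩⟩
    rw [probReal_compl_eq_one_sub measurableSet_Ioc, h1]
    ring
  have hmeas : Measurable (nextCost q γ a d) := by
    unfold nextCost
    exact Measurable.ite measurableSet_Iic
      (continuous_fullCost.measurable.comp (measurable_const_add a)) measurable_const
  have hbdd : ∃ C, ∀ x ∈ Set.Ioc 0 d, ‖fullCost q γ (a + x)‖ ≤ C := by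
    obtain ⟨C, hC⟩ := isCompact_Icc.exists_bound_of_continuousOn (s := Set.Icc 0 d)
      (f := fun x => fullCost q γ (a + x)) (by fun_prop)
    exact ⟨C, fun x hx => hC x (Set.Ioc_subset_Icc_self hx)⟩
  have hint1 : ∀ x ∈ Set.Ioc 0 d, nextCost q γ a d x = fullCost q γ (a + x) :=
    fun x hx => if_pos hx.2
  have hI1 : IntegrableOn (nextCost q γ a d) (Set.Ioc 0 d) (expMeasure 1) := by
    obtain ⟨C, hC⟩ := hbdd
    refine IntegrableOn.of_bound (measure_lt_top _ _) hmeas.aestronglyMeasurable C ?_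
    filter_upwards [ae_restrict_mem measurableSet_Ioc] with x hx
    rw [hint1 x hx]
    exact hC x hx
  -- On x ≤ 0 the value of `nextCost` is different, but the exponential law gives no mass to it.
  have hae : ∀ᵐ x ∂(expMeasure 1), x ∈ (Set.Ioc 0 d)ᶜ →
      nextCost q γ a d x = emptyCost q γ (a + d) := by
    filter_upwards [measure_eq_zero_iff_ae_notMem.1 h0] with x hx hx'
    refine if_neg fun h => hx' ⟨not_le.1 hx, h⟩
  have hI2 : IntegrableOn (nextCost q γ a d) (Set.Ioc 0 d)ᶜ (expMeasure 1) :=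
    (integrableOn_const (C := emptyCost q γ (a + d)) (measure_ne_top _ _)).congr_fun_ae
      ((ae_restrict_iff' measurableSet_Ioc.compl).2 (hae.mono fun x hx h => (hx h).symm))
  have hI : Integrable (nextCost q γ a d) (expMeasure 1) := by
    have := hI1.union hI2
    rwa [Set.union_compl_self, integrableOn_univ] at this
  rw [← integral_add_compl measurableSet_Ioc hI, setIntegral_congr_ae measurableSet_Ioc.compl hae,
    setIntegral_const, hIoc, setIntegral_congr_fun measurableSet_Ioc hint1]
  have hden : ∫ x in Set.Ioc 0 d, fullCost q γ (a + x) ∂(expMeasure 1) =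
      ∫ x in (0 : ℝ)..d, Real.exp (-x) * fullCost q γ (a + x) := by
    rw [intervalIntegral.integral_of_le hd, expMeasure, gammaMeasure,
      setIntegral_withDensity_eq_setIntegral_toReal_smul
        (f := gammaPDF 1 1) (measurable_gammaPDFReal 1 1).ennreal_ofReal
        (Eventually.of_forall fun x => ENNReal.ofReal_lt_top) _ measurableSet_Ioc]
    refine setIntegral_congr_fun measurableSet_Ioc fun x hx => ?_
    simp only [gammaPDF, gammaPDFReal, if_pos hx.1.le]
    rw [ENNReal.toReal_ofReal (by simp [Real.exp_nonneg])]
    simp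
  have hftc : ∫ x in (0 : ℝ)..d, Real.exp (-x) * fullCost q γ (a + x) =
      -(Real.exp (-d) * emptyCost q γ (a + d)) - -(Real.exp (-0) * emptyCost q γ (a + 0)) := by
    refine intervalIntegral.integral_eq_sub_of_hasDeriv_right
      (f := fun x => -(Real.exp (-x) * emptyCost q γ (a + x))) (by fun_prop) (fun x _ => ?_)
      (Continuous.intervalIntegrable (by fun_prop) _ _)
    have h1 : HasDerivWithinAt (fun x => emptyCost q γ (a + x))
        (emptyCost q γ (a + x) - fullCost q γ (a + x)) (Set.Ioi x) x := by
      have h2 := (hasDerivWithinAt_emptyCost (q := q) (γ := γ) (a + x)).scomp x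
        (s := Set.Ioi x) (h := fun y => a + y)
        ((hasDerivAt_id x).const_add a).hasDerivWithinAt
        (fun y (hy : x < y) => by simpa using hy)
      simpa [Function.comp_def] using h2
    have h3 : HasDerivAt (fun x : ℝ => Real.exp (-x)) (-Real.exp (-x)) x := by
      simpa using (hasDerivAt_neg x).exp
    exact (h3.hasDerivWithinAt.fun_mul h1).fun_neg.congr_deriv (by ring)
  rw [hden, hftc]
  simp

end StatusUpdate

/-! ### Attempt times up to a horizon, and the freshness of the feedback -/

namespace StatusUpdate

variable {Ω : Type*} {N : ℝ≥0 → Ω → ℕ} {er : ℕ → Ω → Bool} {q : ℝ}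

theorem battery_le_one (l : ℕ → Ω → ℝ≥0∞) (n : ℕ) (ω : Ω) : battery N l n ω ≤ 1 := by
  cases n <;> exact min_le_right _ _

/-- A battery of capacity one is empty after an attempt whatever it held before, so only the
arrivals since the previous attempt matter. -/
theorem one_le_battery_iff {l : ℕ → Ω → ℝ≥0∞} {n : ℕ} {ω : Ω} :
    1 ≤ battery N l n ω ↔ N (l n ω).toNNReal ω < N (l (n + 1) ω).toNNReal ω := by
  cases n with
  | zero =>
    change _ ↔ N (l 0 ω).toNNReal ω < N (l 1 ω).toNNReal ω
    simp only [battery, arrivals, le_min_iff]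
    omega
  | succ n =>
    change _ ↔ N (l (n + 1) ω).toNNReal ω < N (l (n + 2) ω).toNNReal ω
    have := battery_le_one (N := N) l n ω
    simp only [battery, arrivals, le_min_iff]
    omega

namespace Policy

variable (π : Policy N er)

theorem l_monotone (ω : Ω) : Monotone fun n => π.l n ω := monotone_nat_of_le_succ (π.l_mono ω)

theorem measurableSet_info_l (n : ℕ) (t : ℝ≥0) :
    MeasurableSet[info N er n t] {ω | π.l n ω ≤ t} := by
  cases n with
  | zero => simp [π.l_zero]
  | succ n =>
    have h : info N er n t ≤ info N er (n + 1) t :=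
      sup_le_sup le_rfl (biSup_mono fun _ hk => Nat.lt_succ_of_lt hk)
    exact h _ (π.online n t)

theorem nextArrival_le_l (n : ℕ) (ω : Ω) :
    nextArrival N (π.l n ω) ω ≤ π.l (n + 1) ω := by
  by_cases h : π.l (n + 1) ω = ⊤
  · rw [h]; exact le_top
  have h' : π.l (n + 1) ω < ⊤ := lt_top_iff_ne_top.2 h
  have h1 := one_le_battery_iff.1 (π.energy_causality ω n h')
  rw [← ENNReal.coe_toNNReal h]
  refine iInf₂_le (π.l (n + 1) ω).toNNReal ⟨?_, h1⟩
  rw [ENNReal.coe_toNNReal h]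
  exact π.l_mono ω n

/-- Every attempt uses up an energy unit of its own. Hence only finitely many attempts precede a
horizon T, and limits over the number of attempts stabilise on every path. -/
theorem le_arrivals (ω : Ω) (n : ℕ) (h : π.l n ω ≠ ⊤) : n ≤ N (π.l n ω).toNNReal ω := by
  induction n with
  | zero => exact Nat.zero_le _
  | succ n ih =>
    have h1 := one_le_battery_iff.1 (π.energy_causality ω n (lt_top_iff_ne_top.2 h))
    have := ih ((π.l_mono ω n).trans_lt (lt_top_iff_ne_top.2 h)).ne
    omega

/-- The time of the `n`-th attempt, truncated at `T`. -/
noncomputable def truncated (T : ℝ≥0) (n : ℕ) (ω : Ω) : ℝ≥0∞ := min (π.l n ω) T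

/-- The time of the `n`-th attempt, truncated at `T`, as a real number. -/
noncomputable def attemptTime (T : ℝ≥0) (n : ℕ) (ω : Ω) : ℝ := (min (π.l n ω) T).toReal

/-- The time of the last success before time `T` among the first `n` attempts. -/
noncomputable def lastSuccess (T : ℝ≥0) : ℕ → Ω → ℝ
  | 0, _ => 0
  | n + 1, ω => if er n ω = false ∧ π.l (n + 1) ω ≤ T then π.attemptTime T (n + 1) ω
      else lastSuccess T n ω

variable {π} {T : ℝ≥0}

theorem attemptTime_nonneg (n : ℕ) (ω : Ω) : 0 ≤ π.attemptTime T n ω := ENNReal.toReal_nonneg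

theorem attemptTime_le (n : ℕ) (ω : Ω) : π.attemptTime T n ω ≤ T :=
  ENNReal.toReal_mono ENNReal.coe_ne_top (min_le_right _ _)

theorem attemptTime_mono (ω : Ω) : Monotone fun n => π.attemptTime T n ω := fun _ _ h =>
  ENNReal.toReal_mono (ne_top_of_le_ne_top ENNReal.coe_ne_top (min_le_right _ _))
    (min_le_min_right _ (π.l_monotone ω h))

theorem attemptTime_of_le {n : ℕ} {ω : Ω} (h : π.l n ω ≤ T) :
    π.attemptTime T n ω = (π.l n ω).toReal := by rw [attemptTime, min_eq_left h]

theorem attemptTime_of_ge {n : ℕ} {ω : Ω} (h : T ≤ π.l n ω) : π.attemptTime T n ω = T := by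
  rw [attemptTime, min_eq_right h, ENNReal.coe_toReal]

theorem ofReal_attemptTime {n : ℕ} {ω : Ω} (h : π.l n ω ≤ T) :
    ENNReal.ofReal (π.attemptTime T n ω) = π.l n ω := by
  rw [attemptTime_of_le h, ENNReal.ofReal_toReal (ne_top_of_le_ne_top ENNReal.coe_ne_top h)]

theorem attemptTime_zero (ω : Ω) : π.attemptTime T 0 ω = 0 := by
  simp [attemptTime, π.l_zero]

theorem lastSuccess_succ_of_success {n : ℕ} {ω : Ω} (h : er n ω = false)
    (h' : π.l (n + 1) ω ≤ T) : π.lastSuccess T (n + 1) ω = π.attemptTime T (n + 1) ω := by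
  rw [lastSuccess, if_pos ⟨h, h'⟩]

theorem lastSuccess_succ_of_erased {n : ℕ} {ω : Ω} (h : er n ω = true) :
    π.lastSuccess T (n + 1) ω = π.lastSuccess T n ω := by
  rw [lastSuccess, if_neg (by simp [h])]

theorem lastSuccess_succ_of_lt {n : ℕ} {ω : Ω} (h : ¬ π.l (n + 1) ω ≤ T) :
    π.lastSuccess T (n + 1) ω = π.lastSuccess T n ω := by
  rw [lastSuccess, if_neg (by simp [h])]

theorem lastSuccess_le_attemptTime (n : ℕ) (ω : Ω) :
    π.lastSuccess T n ω ≤ π.attemptTime T n ω := by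
  induction n with
  | zero => exact attemptTime_nonneg _ _
  | succ n ih =>
    rw [lastSuccess]
    split_ifs
    · exact le_rfl
    · exact ih.trans (attemptTime_mono ω (Nat.le_succ n))

theorem lastSuccess_mono (ω : Ω) : Monotone fun n => π.lastSuccess T n ω := by
  refine monotone_nat_of_le_succ fun n => ?_
  simp only [lastSuccess]
  split_ifs
  · exact (lastSuccess_le_attemptTime n ω).trans (attemptTime_mono ω (Nat.le_succ n))
  · exact le_rfl

theorem lastSuccess_nonneg (n : ℕ) (ω : Ω) : 0 ≤ π.lastSuccess T n ω :=
  lastSuccess_mono (π := π) (T := T) ω (Nat.zero_le n)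

theorem lastSuccess_le (n : ℕ) (ω : Ω) : π.lastSuccess T n ω ≤ T :=
  (lastSuccess_le_attemptTime n ω).trans (attemptTime_le n ω)

theorem measurable_attemptTime {m : MeasurableSpace Ω} {k : ℕ}
    (h : ∀ t ≤ T, MeasurableSet[m] {ω | π.l k ω ≤ t}) : Measurable[m] (π.attemptTime T k) := by
  refine Measurable.ennreal_toReal (measurable_of_le_coe fun t => ?_)
  by_cases ht : T ≤ t
  · have : {ω | min (π.l k ω) T ≤ t} = Set.univ :=
      Set.eq_univ_of_forall fun ω => (min_le_right _ _).trans (ENNReal.coe_le_coe.2 ht)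
    rw [this]
    exact MeasurableSet.univ
  · have : {ω | min (π.l k ω) T ≤ t} = {ω | π.l k ω ≤ t} := by
      ext ω
      simp [ht]
    rw [this]
    exact h t (not_le.1 ht).le

theorem measurable_lastSuccess {m : MeasurableSpace Ω} {n : ℕ}
    (h : ∀ k ≤ n, ∀ t ≤ T, MeasurableSet[m] {ω | π.l k ω ≤ t})
    (h' : ∀ k < n, Measurable[m] (er k)) : Measurable[m] (π.lastSuccess T n) := by
  induction n with
  | zero => exact measurable_const
  | succ n ih =>
    refine Measurable.ite ?_ (measurable_attemptTime (h _ le_rfl))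
      (ih (fun k hk => h k (hk.trans (Nat.le_succ n))) fun k hk => h' k (hk.trans n.lt_succ_self))
    exact MeasurableSet.inter (h' n n.lt_succ_self (measurableSet_singleton false))
      (h _ le_rfl T le_rfl)

variable [mΩ : MeasurableSpace Ω] {P : Measure Ω}

theorem isStoppingTime_l (hm : IsModel q N er P) (π : Policy N er) (n : ℕ) :
    IsStoppingTime hm.filtration (π.l n) := by
  rw [hm.isStoppingTime_iff]
  exact fun t => info_le_history _ _ _ (π.measurableSet_info_l n t)

theorem isStoppingTime_truncated (hm : IsModel q N er P) (π : Policy N er) (T : ℝ≥0) (n : ℕ) :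
    IsStoppingTime hm.filtration (π.truncated T n) :=
  (π.isStoppingTime_l hm n).min_const T

/-- If the truncated `n`-th time is at most i < T, then the `k`-th time is also at most i, so `t`
may be lowered to min t i and the event is known by time i. -/
theorem measurableSet_past_le (hm : IsModel q N er P) (π : Policy N er) {T t : ℝ≥0} {k n : ℕ}
    (hk : k ≤ n) (ht : t ≤ T) :
    MeasurableSet[(π.isStoppingTime_truncated hm T n).measurableSpace] {ω | π.l k ω ≤ t} := by
  have h := hm.isStoppingTime_iff.1 (π.isStoppingTime_l hm k)
  have hn := hm.isStoppingTime_iff.1 (π.isStoppingTime_l hm n)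
  refine ⟨(le_iSup hm.filtration t) _ (h t), fun i => ?_⟩
  change MeasurableSet[history N er i] ({ω | π.l k ω ≤ t} ∩ {ω | min (π.l n ω) (T : ℝ≥0∞) ≤ i})
  by_cases hi : T ≤ i
  · have : {ω | min (π.l n ω) (T : ℝ≥0∞) ≤ i} = Set.univ :=
      Set.eq_univ_of_forall fun ω => (min_le_right _ _).trans (ENNReal.coe_le_coe.2 hi)
    rw [this, Set.inter_univ]
    exact history_mono (ht.trans hi) _ (h t)
  · have : {ω | π.l k ω ≤ t} ∩ {ω | min (π.l n ω) (T : ℝ≥0∞) ≤ i} =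
        {ω | π.l k ω ≤ (min t i : ℝ≥0)} ∩ {ω | π.l n ω ≤ i} := by
      ext ω
      simp only [Set.mem_inter_iff, Set.mem_ofPred_eq, ENNReal.coe_min, le_min_iff, min_le_iff,
        ENNReal.coe_le_coe, hi, or_false]
      exact ⟨fun h => ⟨⟨h.1, (π.l_monotone ω hk).trans h.2⟩, h.2⟩, fun h => ⟨h.1.1, h.2⟩⟩
    rw [this]
    exact (history_mono (min_le_right _ _) _ (h _)).inter (hn i)

theorem measurableSet_l_le (hm : IsModel q N er P) (π : Policy N er) (n : ℕ) (t : ℝ≥0) :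
    MeasurableSet {ω | π.l n ω ≤ t} :=
  hm.history_le t _ (hm.isStoppingTime_iff.1 (π.isStoppingTime_l hm n) t)

theorem measurable_l (hm : IsModel q N er P) (π : Policy N er) (n : ℕ) : Measurable (π.l n) :=
  measurable_of_le_coe fun t => π.measurableSet_l_le hm n t

end Policy

/-- The information consisting of all energy arrivals and of the feedback on the first `n`
attempts. -/
abbrev arrivalsAndFeedback (N : ℝ≥0 → Ω → ℕ) (er : ℕ → Ω → Bool) (n : ℕ) : MeasurableSpace Ω :=
  (⨆ u, MeasurableSpace.comap (N u) ⊤) ⊔ (⨆ (k : ℕ) (_ : k < n), MeasurableSpace.comap (er k) ⊤)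

theorem info_le_arrivalsAndFeedback {k n : ℕ} (h : k ≤ n) (t : ℝ≥0) :
    info N er k t ≤ arrivalsAndFeedback N er n :=
  sup_le_sup (iSup_mono fun _ => iSup_le fun _ => le_rfl)
    (biSup_mono fun _ hj => lt_of_lt_of_le hj h)

namespace IsModel

variable [mΩ : MeasurableSpace Ω] {P : Measure Ω}

theorem arrivalsAndFeedback_le (hm : IsModel q N er P) (n : ℕ) :
    arrivalsAndFeedback N er n ≤ mΩ :=
  sup_le (iSup_le fun u => (hm.poisson.measurable u).comap_le)
    (iSup₂_le fun k _ => (hm.erasures.measurable k).comap_le)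

variable [IsProbabilityMeasure P]

/-- Whether and when the next attempt is made is determined by `arrivalsAndFeedback N er n`; its
feedback is therefore a fresh coin, even given all future arrivals. -/
theorem indep_feedback (hm : IsModel q N er P) (n : ℕ) :
    Indep (arrivalsAndFeedback N er n) (MeasurableSpace.comap (er n) ⊤) P := by
  have hem : Measurable (fun ω (k : ℕ) => er k ω) := measurable_pi_lambda _ hm.erasures.measurable
  have hNm : Measurable (fun ω (t : ℝ≥0) => N t ω) := measurable_pi_lambda _ hm.poisson.measurable
  have h := hm.indep
  rw [IndepFun_iff_Indep] at h
  have h1 : Indep (⨆ k ∈ Set.Iio n, MeasurableSpace.comap (er k) ⊤)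
      (⨆ k ∈ ({n} : Set ℕ), MeasurableSpace.comap (er k) ⊤) P :=
    indep_iSup_of_disjoint (fun k => (hm.erasures.measurable k).comap_le)
      hm.erasures.indep.iIndep (by simp)
  have h2 : (⨆ k ∈ Set.Iio n, MeasurableSpace.comap (er k) ⊤) =
    (⨆ (k : ℕ) (_ : k < n), MeasurableSpace.comap (er k) ⊤) := rfl
  rw [iSup_singleton, h2] at h1
  rw [arrivalsAndFeedback, sup_comm]
  refine indep_sup_left_of_indep (iSup₂_le fun k _ => comap_apply_le_comap_pi er k)
    (comap_apply_le_comap_pi er n) hem.comap_le ?_ h1 ?_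
  · exact iSup_le fun u => (hm.poisson.measurable u).comap_le
  · exact (indep_of_indep_of_le_left h (iSup_le (comap_apply_le_comap_pi N))).symm

theorem integral_ite_erased (hm : IsModel q N er P) (hq0 : 0 ≤ q) {n : ℕ} {A B : Ω → ℝ}
    (hA : Measurable[arrivalsAndFeedback N er n] A) (hB : Measurable[arrivalsAndFeedback N er n] B)
    (hAi : Integrable A P) (hBi : Integrable B P) :
    Integrable (fun ω => if er n ω = true then A ω else B ω) P ∧
    ∫ ω, (if er n ω = true then A ω else B ω) ∂P = ∫ ω, ((1 - q) * B ω + q * A ω) ∂P := by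
  have hle := hm.arrivalsAndFeedback_le n
  have hE : MeasurableSet {ω | er n ω = true} :=
    hm.erasures.measurable n (measurableSet_singleton true)
  let e : Bool → ℝ := fun b => if b = true then 1 else 0
  have he : Measurable (fun ω => e (er n ω)) :=
    (measurable_from_top (f := e)).comp (hm.erasures.measurable n)
  have hind : ∀ {A : Ω → ℝ}, Measurable[arrivalsAndFeedback N er n] A →
      ∫ ω, A ω * e (er n ω) ∂P = (∫ ω, A ω ∂P) * q := by
    intro A hA
    have h1 : IndepFun A (fun ω => e (er n ω)) P := by
      rw [IndepFun_iff_Indep]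
      refine indep_of_indep_of_le_left (indep_of_indep_of_le_right (hm.indep_feedback n) ?_)
        hA.comap_le
      exact ((measurable_from_top (f := e)).comp (comap_measurable (er n))).comap_le
    rw [h1.integral_fun_mul_eq_mul_integral (hA.mono hle le_rfl).aestronglyMeasurable
      he.aestronglyMeasurable]
    congr 1
    have h2 : (fun ω => e (er n ω)) = Set.indicator {ω | er n ω = true} 1 := by
      ext ω
      simp [e, Set.indicator_apply]
    rw [h2, integral_indicator_one hE, measureReal_def, hm.erasures.prob_erased n,
      ENNReal.toReal_ofReal hq0]
  have hform : (fun ω => if er n ω = true then A ω else B ω) =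
      fun ω => A ω * e (er n ω) + (B ω - B ω * e (er n ω)) := by
    ext ω
    by_cases h : er n ω = true <;> simp [e, h]
  have hmul : ∀ {A : Ω → ℝ}, Integrable A P → Integrable (fun ω => A ω * e (er n ω)) P := by
    intro A hA
    refine hA.mul_bdd (c := 1) he.aestronglyMeasurable (Eventually.of_forall fun ω => ?_)
    simp only [e]
    split_ifs <;> simp
  rw [hform]
  refine ⟨(hmul hAi).add (hBi.sub (hmul hBi)), ?_⟩
  have hBe : Integrable (fun ω => B ω - B ω * e (er n ω)) P := hBi.sub (hmul hBi)
  rw [integral_add (hmul hAi) hBe, integral_sub hBi (hmul hBi), hind hA, hind hB,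
    integral_add (hBi.const_mul _) (hAi.const_mul _), integral_const_mul, integral_const_mul]
  ring

end IsModel

end StatusUpdate

/-! ### The mean drift of the potential -/

namespace StatusUpdate

variable {Ω : Type*} {N : ℝ≥0 → Ω → ℕ} {er : ℕ → Ω → Bool} {q γ : ℝ}

theorem exists_bound_nextCost (q γ T : ℝ) : ∃ C, ∀ a d x, 0 ≤ a → 0 ≤ d → 0 ≤ x → a + d ≤ T →
    ‖nextCost q γ a d x‖ ≤ C := by
  obtain ⟨C, hC⟩ := isCompact_Icc.exists_bound_of_continuousOn (s := Set.Icc 0 T)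
    (continuous_fullCost (q := q) (γ := γ)).continuousOn
  obtain ⟨D, hD⟩ := isCompact_Icc.exists_bound_of_continuousOn (s := Set.Icc 0 T)
    (continuous_emptyCost (q := q) (γ := γ)).continuousOn
  refine ⟨max C D, fun a d x ha hd hx h => ?_⟩
  rw [nextCost]
  split_ifs with hxd
  · exact (hC _ ⟨by linarith, by linarith⟩).trans (le_max_left _ _)
  · exact (hD _ ⟨by linarith, by linarith⟩).trans (le_max_right _ _)

theorem measurable_nextCost :
    Measurable fun p : ℝ × ℝ × ℝ => nextCost q γ p.1 p.2.1 p.2.2 := by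
  unfold nextCost
  refine Measurable.ite (measurableSet_le (by fun_prop) (by fun_prop)) ?_ ?_
  · exact continuous_fullCost.measurable.comp (by fun_prop)
  · exact continuous_emptyCost.measurable.comp (by fun_prop)

section

variable [mΩ : MeasurableSpace Ω] {P : Measure Ω}

theorem integrable_comp_of_mem_Icc [IsFiniteMeasure P] {f : ℝ → ℝ} (hf : Continuous f) {X : Ω → ℝ}
    (hX : Measurable X) {a b : ℝ} (h : ∀ ω, X ω ∈ Set.Icc a b) :
    Integrable (fun ω => f (X ω)) P := by
  obtain ⟨C, hC⟩ := isCompact_Icc.exists_bound_of_continuousOn (s := Set.Icc a b) hf.continuousOn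
  exact Integrable.of_bound (hf.measurable.comp hX).aestronglyMeasurable C
    (Eventually.of_forall fun ω => hC _ (h ω))

theorem integrable_ite {p : Ω → Prop} [DecidablePred p] (hp : MeasurableSet {ω | p ω})
    {f g : Ω → ℝ} (hf : Integrable f P) (hg : Integrable g P) :
    Integrable (fun ω => if p ω then f ω else g ω) P :=
  Integrable.piecewise (s := {ω | p ω}) hp hf.integrableOn hg.integrableOn

end

namespace Policy

/-- The total cost of the epochs that are completed before time `T` by the first `n` attempts. -/
noncomputable def completedCost (π : Policy N er) (q γ : ℝ) (T : ℝ≥0) (n : ℕ) (ω : Ω) : ℝ :=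
  ∑ k ∈ Finset.range n,
    epochCost q γ (π.lastSuccess T (k + 1) ω - π.lastSuccess T k ω)

open Classical in
/-- The cost of the completed epochs, plus the expected cost of the current one right after the
`n`-th attempt, or `V` of the age at time `T` if that attempt comes later than `T`. -/
noncomputable def potential (π : Policy N er) (q γ : ℝ) (T : ℝ≥0) (V : ℝ → ℝ) (n : ℕ) (ω : Ω) :
    ℝ :=
  π.completedCost q γ T n ω + if π.l n ω ≤ T then
    emptyCost q γ (π.attemptTime T n ω - π.lastSuccess T n ω) else V (T - π.lastSuccess T n ω)

variable {π : Policy N er} {T : ℝ≥0} {V : ℝ → ℝ}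

theorem age_mem_Icc (n : ℕ) (ω : Ω) :
    π.attemptTime T n ω - π.lastSuccess T n ω ∈ Set.Icc (0 : ℝ) T :=
  ⟨sub_nonneg.2 (lastSuccess_le_attemptTime n ω),
    by linarith [attemptTime_le (π := π) (T := T) n ω, lastSuccess_nonneg (π := π) (T := T) n ω]⟩

theorem age_succ_mem_Icc (n : ℕ) (ω : Ω) :
    π.attemptTime T (n + 1) ω - π.lastSuccess T n ω ∈ Set.Icc (0 : ℝ) T :=
  ⟨sub_nonneg.2 ((lastSuccess_le_attemptTime n ω).trans (attemptTime_mono ω n.le_succ)),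
    by linarith [attemptTime_le (π := π) (T := T) (n + 1) ω,
      lastSuccess_nonneg (π := π) (T := T) n ω]⟩

theorem age_end_mem_Icc (n : ℕ) (ω : Ω) : T - π.lastSuccess T n ω ∈ Set.Icc (0 : ℝ) T :=
  ⟨sub_nonneg.2 (lastSuccess_le n ω), by linarith [lastSuccess_nonneg (π := π) (T := T) n ω]⟩

theorem epoch_mem_Icc (n : ℕ) (ω : Ω) :
    π.lastSuccess T (n + 1) ω - π.lastSuccess T n ω ∈ Set.Icc (0 : ℝ) T :=
  ⟨sub_nonneg.2 (lastSuccess_mono ω n.le_succ),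
    by linarith [lastSuccess_le (π := π) (T := T) (n + 1) ω,
      lastSuccess_nonneg (π := π) (T := T) n ω]⟩

variable [mΩ : MeasurableSpace Ω] {P : Measure Ω}

theorem measurable_attemptTime' (hm : IsModel q N er P) (π : Policy N er) (T : ℝ≥0) (n : ℕ) :
    Measurable (π.attemptTime T n) :=
  measurable_attemptTime fun t _ => π.measurableSet_l_le hm n t

theorem measurable_lastSuccess' (hm : IsModel q N er P) (π : Policy N er) (T : ℝ≥0) (n : ℕ) :
    Measurable (π.lastSuccess T n) :=
  measurable_lastSuccess (fun k _ t _ => π.measurableSet_l_le hm k t)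
    fun k _ => hm.erasures.measurable k

theorem integral_potential_zero (hq1 : q < 1) (hγ : IsThreshold q γ) (π : Policy N er) (T : ℝ≥0) :
    ∫ ω, π.potential q γ T V 0 ω ∂P = 0 := by
  have : ∀ ω, π.potential q γ T V 0 ω = 0 := by
    intro ω
    simp [potential, completedCost, π.l_zero, attemptTime_zero, lastSuccess,
      emptyCost_zero hq1 hγ]
  simp [this]

variable [IsProbabilityMeasure P]

theorem integrable_completedCost (hm : IsModel q N er P) (π : Policy N er) (T : ℝ≥0) (n : ℕ) :
    Integrable (π.completedCost q γ T n) P :=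
  integrable_finsetSum _ fun k _ => integrable_comp_of_mem_Icc continuous_epochCost
    ((π.measurable_lastSuccess' hm T (k + 1)).sub (π.measurable_lastSuccess' hm T k))
    (epoch_mem_Icc k)

theorem integrable_potential (hm : IsModel q N er P) (π : Policy N er) (T : ℝ≥0)
    (hV : Continuous V) (n : ℕ) : Integrable (π.potential q γ T V n) P := by
  refine (π.integrable_completedCost hm T n).add
    (integrable_ite (π.measurableSet_l_le hm n T) ?_ ?_)
  · exact integrable_comp_of_mem_Icc continuous_emptyCost
      ((π.measurable_attemptTime' hm T n).sub (π.measurable_lastSuccess' hm T n)) (age_mem_Icc n)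
  · exact integrable_comp_of_mem_Icc hV
      (measurable_const.sub (π.measurable_lastSuccess' hm T n)) (age_end_mem_Icc n)

/-- The age at the attempt belongs to the past of the truncated attempt time, which is independent
of the energy waiting time. Fubini integrates out the latter and `integral_nextCost` evaluates the
inner integral. The truncation keeps the stopping time finite even if no further attempt is made. -/
theorem integral_emptyCost_eq (hm : IsModel q N er P) (π : Policy N er) (T : ℝ≥0) (n : ℕ) :
    Integrable (fun ω => (if π.l n ω ≤ T then 1 else 0) *
      nextCost q γ (π.attemptTime T n ω - π.lastSuccess T n ω) (T - π.attemptTime T n ω)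
        (gap N (π.truncated T n ω) ω)) P ∧
    ∫ ω, (if π.l n ω ≤ T then 1 else 0) *
      emptyCost q γ (π.attemptTime T n ω - π.lastSuccess T n ω) ∂P =
    ∫ ω, (if π.l n ω ≤ T then 1 else 0) *
      nextCost q γ (π.attemptTime T n ω - π.lastSuccess T n ω) (T - π.attemptTime T n ω)
        (gap N (π.truncated T n ω) ω) ∂P := by
  have hτ := π.isStoppingTime_truncated hm T n
  have hτm : Measurable (π.truncated T n) :=
    (π.measurable_l hm n).min measurable_const
  have hfin : ∀ᵐ ω ∂P, π.truncated T n ω < ⊤ :=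
    Eventually.of_forall fun ω => (min_le_right _ _).trans_lt ENNReal.coe_lt_top
  have hτ' := hm.isStoppingTime_nextArrival hτ
  set D : Ω → ℝ := fun ω => gap N (π.truncated T n ω) ω with hD
  have hDm : Measurable D := measurable_gap hτm
    ((hm.measurable_stoppingTime hτ').mono hτ'.measurableSpace_le le_rfl)
  let f : Ω → ℝ × ℝ × ℝ := fun ω => (if π.l n ω ≤ T then 1 else 0,
    π.attemptTime T n ω - π.lastSuccess T n ω, T - π.attemptTime T n ω)
  have hf : Measurable[hτ.measurableSpace] f := by
    have h1 : Measurable[hτ.measurableSpace] (π.attemptTime T n) :=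
      measurable_attemptTime fun t ht => π.measurableSet_past_le hm le_rfl ht
    have h2 : Measurable[hτ.measurableSpace] (π.lastSuccess T n) :=
      measurable_lastSuccess (fun k hk t ht => π.measurableSet_past_le hm hk ht)
        fun k _ => hm.measurable_er_past hτ k
    refine Measurable.prodMk (Measurable.ite (π.measurableSet_past_le hm le_rfl le_rfl)
      measurable_const measurable_const) (Measurable.prodMk (h1.sub h2) (measurable_const.sub h1))
  have hfm : Measurable f := hf.mono hτ.measurableSpace_le le_rfl
  let F : (ℝ × ℝ × ℝ) × ℝ → ℝ := fun p => p.1.1 * nextCost q γ p.1.2.1 p.1.2.2 p.2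
  have hF : Measurable F := by
    refine Measurable.mul (by fun_prop) ?_
    exact measurable_nextCost.comp (g := fun p : ℝ × ℝ × ℝ => nextCost q γ p.1 p.2.1 p.2.2)
      (f := fun p : (ℝ × ℝ × ℝ) × ℝ => (p.1.2.1, p.1.2.2, p.2)) (by fun_prop)
  have hmap : P.map (fun ω => (f ω, D ω)) = (P.map f).prod (expMeasure 1) := by
    rw [(indepFun_iff_map_prod_eq_prod_map_map hfm.aemeasurable hDm.aemeasurable).1
      (hm.indepFun_gap hτ hfin hf), hD, hm.map_gap hτ hfin]
  have hint : Integrable (fun ω => F (f ω, D ω)) P := by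
    obtain ⟨C, hC⟩ := exists_bound_nextCost q γ T
    refine Integrable.of_bound (hF.comp (hfm.prodMk hDm)).aestronglyMeasurable C
      (Eventually.of_forall fun ω => ?_)
    have h1 := age_mem_Icc (π := π) (T := T) n ω
    have h2 := hC (π.attemptTime T n ω - π.lastSuccess T n ω) (T - π.attemptTime T n ω) (D ω)
      h1.1 (sub_nonneg.2 (attemptTime_le n ω)) (gap_nonneg _ _)
      (by linarith [lastSuccess_nonneg (π := π) (T := T) n ω])
    simp only [F, f]
    split_ifs
    · rwa [one_mul]
    · rw [zero_mul, norm_zero]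
      exact (norm_nonneg _).trans h2
  refine ⟨hint, ?_⟩
  have hprob := isProbabilityMeasure_expMeasure (r := 1) one_pos
  have hint' : Integrable F ((P.map f).prod (expMeasure 1)) := by
    rw [← hmap, integrable_map_measure hF.aestronglyMeasurable (hfm.prodMk hDm).aemeasurable]
    exact hint
  have := Measure.isProbabilityMeasure_map hfm.aemeasurable (μ := P)
  calc _ = ∫ ω, (∫ x, F (f ω, x) ∂(expMeasure 1)) ∂P := by
        refine integral_congr_ae (Eventually.of_forall fun ω => ?_)
        simp only [F, f]
        rw [integral_const_mul, integral_nextCost _ (sub_nonneg.2 (attemptTime_le n ω))]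
    _ = ∫ y, (∫ x, F (y, x) ∂(expMeasure 1)) ∂(P.map f) := by
        rw [integral_map hfm.aemeasurable]
        exact (hF.stronglyMeasurable.integral_prod_right).aestronglyMeasurable
    _ = ∫ p, F p ∂((P.map f).prod (expMeasure 1)) := (integral_prod _ hint').symm
    _ = ∫ ω, F (f ω, D ω) ∂P := by
        rw [← hmap, integral_map (hfm.prodMk hDm).aemeasurable hF.aestronglyMeasurable]

open Classical in
/-- The one-step drift of the potential. -/
noncomputable def drift (π : Policy N er) (q γ : ℝ) (T : ℝ≥0) (V : ℝ → ℝ) (n : ℕ) (ω : Ω) : ℝ :=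
  if π.l n ω ≤ T then
    (if π.l (n + 1) ω ≤ T then
      (1 - q) * epochCost q γ (π.attemptTime T (n + 1) ω - π.lastSuccess T n ω) +
        q * emptyCost q γ (π.attemptTime T (n + 1) ω - π.lastSuccess T n ω)
      else V (T - π.lastSuccess T n ω)) -
    nextCost q γ (π.attemptTime T n ω - π.lastSuccess T n ω) (T - π.attemptTime T n ω)
        (gap N (π.truncated T n ω) ω)
  else 0

/-- Two averages over different σ-algebras are combined: the next feedback is averaged given all
arrivals, and `emptyCost` is unfolded into `nextCost` given the past of the attempt. Only the means
agree, but `drift` then has a sign on almost every path. -/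
theorem integral_potential_succ (hm : IsModel q N er P) (hq0 : 0 ≤ q) (hq1 : q < 1)
    (hγ : IsThreshold q γ) (π : Policy N er) (T : ℝ≥0) (hV : Continuous V) (n : ℕ) :
    ∫ ω, π.potential q γ T V (n + 1) ω ∂P =
      ∫ ω, π.potential q γ T V n ω ∂P + ∫ ω, π.drift q γ T V n ω ∂P := by
  classical
  set a : Ω → ℝ := fun ω => π.attemptTime T n ω - π.lastSuccess T n ω with ha
  set b : Ω → ℝ := fun ω => π.attemptTime T (n + 1) ω - π.lastSuccess T n ω with hb
  set c : Ω → ℝ := fun ω => T - π.lastSuccess T n ω with hc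
  have hl : ∀ k ≤ n + 1, ∀ t ≤ T, MeasurableSet[arrivalsAndFeedback N er n] {ω | π.l k ω ≤ t} := by
    intro k hk t _
    cases k with
    | zero => simp [π.l_zero]
    | succ k =>
      exact info_le_arrivalsAndFeedback (Nat.succ_le_succ_iff.1 hk) t _ (π.online k t)
  have her : ∀ k < n, Measurable[arrivalsAndFeedback N er n] (er k) := fun k hk =>
    measurable_iff_comap_le.2 ((le_iSup₂ (f := fun (j : ℕ) (_ : j < n) =>
      MeasurableSpace.comap (er j) ⊤) k hk).trans le_sup_right)
  have hS : Measurable[arrivalsAndFeedback N er n] (π.lastSuccess T n) :=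
    measurable_lastSuccess (fun k hk => hl k (hk.trans n.le_succ)) her
  have hLn : Measurable[arrivalsAndFeedback N er n] (π.attemptTime T n) :=
    measurable_attemptTime (hl n n.le_succ)
  have hLn1 : Measurable[arrivalsAndFeedback N er n] (π.attemptTime T (n + 1)) :=
    measurable_attemptTime (hl _ le_rfl)
  have ham : Measurable[arrivalsAndFeedback N er n] a := hLn.sub hS
  have hbm : Measurable[arrivalsAndFeedback N er n] b := hLn1.sub hS
  have hcm : Measurable[arrivalsAndFeedback N er n] c := Measurable.sub measurable_const hS
  have hle : arrivalsAndFeedback N er n ≤ mΩ := hm.arrivalsAndFeedback_le n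
  -- The increments of the potential: `A` after an erasure, `B` after a success, both equal to `E`
  -- if the next attempt comes after T.
  let E : Ω → ℝ := fun ω => if π.l n ω ≤ T then V (c ω) - emptyCost q γ (a ω) else 0
  let A : Ω → ℝ := fun ω => if π.l (n + 1) ω ≤ T then
    emptyCost q γ (b ω) - emptyCost q γ (a ω) else E ω
  let B : Ω → ℝ := fun ω => if π.l (n + 1) ω ≤ T then
    epochCost q γ (b ω) - emptyCost q γ (a ω) else E ω
  have hEm : Measurable[arrivalsAndFeedback N er n] E := Measurable.ite (hl n n.le_succ T le_rfl)
    ((hV.measurable.comp hcm).sub (continuous_emptyCost.measurable.comp ham)) measurable_const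
  have hAm : Measurable[arrivalsAndFeedback N er n] A := Measurable.ite (hl _ le_rfl T le_rfl)
    ((continuous_emptyCost.measurable.comp hbm).sub (continuous_emptyCost.measurable.comp ham)) hEm
  have hBm : Measurable[arrivalsAndFeedback N er n] B := Measurable.ite (hl _ le_rfl T le_rfl)
    ((continuous_epochCost.measurable.comp hbm).sub (continuous_emptyCost.measurable.comp ham)) hEm
  have hia : ∀ {f : ℝ → ℝ}, Continuous f → Integrable (fun ω => f (a ω)) P := fun hf =>
    integrable_comp_of_mem_Icc hf (ham.mono hle le_rfl) (age_mem_Icc n)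
  have hib : ∀ {f : ℝ → ℝ}, Continuous f → Integrable (fun ω => f (b ω)) P := fun hf =>
    integrable_comp_of_mem_Icc hf (hbm.mono hle le_rfl) (age_succ_mem_Icc n)
  have hic : ∀ {f : ℝ → ℝ}, Continuous f → Integrable (fun ω => f (c ω)) P := fun hf =>
    integrable_comp_of_mem_Icc hf (hcm.mono hle le_rfl) (age_end_mem_Icc n)
  have hs := π.measurableSet_l_le hm n T
  have hs' := π.measurableSet_l_le hm (n + 1) T
  have hEi : Integrable E P :=
    integrable_ite hs ((hic hV).sub (hia continuous_emptyCost)) (integrable_zero _ _ _)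
  have hAi : Integrable A P :=
    integrable_ite hs' ((hib continuous_emptyCost).sub (hia continuous_emptyCost)) hEi
  have hBi : Integrable B P :=
    integrable_ite hs' ((hib continuous_epochCost).sub (hia continuous_emptyCost)) hEi
  have hstep : ∀ ω, π.potential q γ T V (n + 1) ω =
      π.potential q γ T V n ω + if er n ω = true then A ω else B ω := by
    intro ω
    have hg0 : epochCost q γ 0 = 0 := by simp [epochCost]
    simp only [potential, completedCost, Finset.sum_range_succ, A, B, E, a, b, c]
    by_cases h1 : π.l (n + 1) ω ≤ T
    · have h0 : π.l n ω ≤ T := (π.l_mono ω n).trans h1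
      by_cases he : er n ω = true
      · simp only [h1, h0, he, if_true, lastSuccess_succ_of_erased he, sub_self, hg0]
        ring
      · have he' : er n ω = false := by simpa using he
        simp only [h1, h0, he', if_true, Bool.false_eq_true, if_false,
          lastSuccess_succ_of_success he' h1, sub_self, emptyCost_zero hq1 hγ]
        ring
    · simp only [h1, if_false, lastSuccess_succ_of_lt h1, sub_self, hg0, ite_self]
      split_ifs <;> ring
  obtain ⟨hi1, he1⟩ := hm.integral_ite_erased hq0 hAm hBm hAi hBi
  simp_rw [hstep]
  rw [integral_add (π.integrable_potential hm T hV n) hi1, he1]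
  congr 1
  obtain ⟨hi2, he2⟩ := integral_emptyCost_eq (γ := γ) hm π T n
  have hi3 : Integrable (fun ω => (if π.l n ω ≤ T then 1 else 0) * emptyCost q γ (a ω)) P := by
    have := integrable_ite hs (hia (continuous_emptyCost (q := q) (γ := γ)))
      (integrable_zero Ω ℝ P)
    refine this.congr (Eventually.of_forall fun ω => ?_)
    simp only
    split_ifs <;> simp
  have hd1 : ∀ ω, (1 - q) * B ω + q * A ω =
      (if π.l n ω ≤ T then (if π.l (n + 1) ω ≤ T then
        (1 - q) * epochCost q γ (b ω) + q * emptyCost q γ (b ω) else V (c ω)) else 0) -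
      (if π.l n ω ≤ T then 1 else 0) * emptyCost q γ (a ω) := by
    intro ω
    simp only [A, B, E]
    by_cases h1 : π.l (n + 1) ω ≤ T
    · have h0 : π.l n ω ≤ T := (π.l_mono ω n).trans h1
      simp only [h1, h0, if_true]
      ring
    · simp only [h1, if_false]
      split_ifs <;> ring
  have hd2 : ∀ ω, π.drift q γ T V n ω =
      (if π.l n ω ≤ T then (if π.l (n + 1) ω ≤ T then
        (1 - q) * epochCost q γ (b ω) + q * emptyCost q γ (b ω) else V (c ω)) else 0) -
      (if π.l n ω ≤ T then 1 else 0) * nextCost q γ (a ω) (T - π.attemptTime T n ω)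
        (gap N (π.truncated T n ω) ω) := by
    intro ω
    simp only [drift]
    split_ifs <;> simp [a, b, c]
  have hi4 : Integrable (fun ω => if π.l n ω ≤ T then (if π.l (n + 1) ω ≤ T then
        (1 - q) * epochCost q γ (b ω) + q * emptyCost q γ (b ω) else V (c ω)) else 0) P :=
    integrable_ite hs (integrable_ite hs' (((hib continuous_epochCost).const_mul _).add
      ((hib continuous_emptyCost).const_mul _)) (hic hV)) (integrable_zero _ _ _)
  simp_rw [hd1, hd2]
  rw [integral_sub hi4 hi3, integral_sub hi4 hi2, he2]

end Policy

end StatusUpdate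

/-! ### The area under the age curve and the lower bound -/

namespace StatusUpdate

variable {Ω : Type*} {N : ℝ≥0 → Ω → ℕ} {er : ℕ → Ω → Bool} {q γ : ℝ}

namespace Policy

variable {π : Policy N er} {T : ℝ≥0}

/-- The number of successes among the first `m` attempts. -/
abbrev successCount (er : ℕ → Ω → Bool) (m : ℕ) (ω : Ω) : ℕ :=
  Nat.count (fun j => er j ω = false) m

theorem s_succ_eq {k i : ℕ} {ω : Ω} (h : er k ω = false) (hi : successCount er k ω = i) :
    π.s (i + 1) ω = π.l (k + 1) ω := by
  refine le_antisymm (iInf₂_le k ⟨h, hi⟩) (le_iInf₂ fun j hj => ?_)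
  rw [Nat.count_injective (p := fun j => er j ω = false) h hj.1 (hi.trans hj.2.symm)]

/-- The area under the age-of-information curve up to the `n`-th attempt or time `T`, whichever
comes first. -/
noncomputable def runningArea (π : Policy N er) (T : ℝ≥0) (n : ℕ) (ω : Ω) : ℝ :=
  (∑ k ∈ Finset.range n, (π.lastSuccess T (k + 1) ω - π.lastSuccess T k ω) ^ 2) / 2 +
    (π.attemptTime T n ω - π.lastSuccess T n ω) ^ 2 / 2

/-- The linear terms of the charges telescope to the elapsed time and the quadratic ones are the
area. This is the link between charges and age. -/
theorem completedCost_add_epochCost (n : ℕ) (ω : Ω) :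
    π.completedCost q γ T n ω +
        epochCost q γ (π.attemptTime T n ω - π.lastSuccess T n ω) =
      π.runningArea T n ω - optAoI q γ * π.attemptTime T n ω := by
  have h : π.completedCost q γ T n ω =
      (∑ k ∈ Finset.range n, (π.lastSuccess T (k + 1) ω - π.lastSuccess T k ω) ^ 2) / 2 -
        optAoI q γ * π.lastSuccess T n ω := by
    have h1 := Finset.sum_range_sub (fun k => π.lastSuccess T k ω) n
    simp only [completedCost, epochCost, Finset.sum_sub_distrib, ← Finset.mul_sum,
      ← Finset.sum_div]
    have h0 : π.lastSuccess T 0 ω = 0 := rfl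
    rw [← Finset.sum_sub_distrib, h1, h0, sub_zero]
  rw [h, runningArea, epochCost]
  ring

theorem runningArea_nonneg (n : ℕ) (ω : Ω) : 0 ≤ π.runningArea T n ω := by
  unfold runningArea
  positivity

/-- Each epoch is at most T long and the lengths add up to at most T. The bound is free of `n`, as
dominated convergence in `n` needs. -/
theorem runningArea_le (n : ℕ) (ω : Ω) : π.runningArea T n ω ≤ (T : ℝ) ^ 2 := by
  have h1 : ∑ k ∈ Finset.range n, (π.lastSuccess T (k + 1) ω - π.lastSuccess T k ω) ^ 2 ≤
      ∑ k ∈ Finset.range n, T * (π.lastSuccess T (k + 1) ω - π.lastSuccess T k ω) := by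
    refine Finset.sum_le_sum fun k _ => ?_
    have := epoch_mem_Icc (π := π) (T := T) k ω
    rw [sq]
    exact mul_le_mul_of_nonneg_right this.2 this.1
  have h0 : π.lastSuccess T 0 ω = 0 := rfl
  rw [← Finset.mul_sum, Finset.sum_range_sub (fun k => π.lastSuccess T k ω) n, h0, sub_zero] at h1
  have h2 := lastSuccess_le (π := π) (T := T) n ω
  have h3 := age_mem_Icc (π := π) (T := T) n ω
  have h4 : (0 : ℝ) ≤ T := T.2
  unfold runningArea
  have h5 : (π.attemptTime T n ω - π.lastSuccess T n ω) ^ 2 ≤ (T : ℝ) ^ 2 :=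
    pow_le_pow_left₀ h3.1 h3.2 2
  nlinarith

/-- Passes from sums over successes to sums over attempts; an erased attempt contributes a zero term
to the latter. -/
theorem s_successCount_and_sum {m : ℕ} {ω : Ω} (h : π.l m ω ≤ T) :
    π.s (successCount er m ω) ω = ENNReal.ofReal (π.lastSuccess T m ω) ∧
    ∑ i ∈ Finset.range (successCount er m ω), π.y i ω ^ 2 = ENNReal.ofReal
      (∑ k ∈ Finset.range m, (π.lastSuccess T (k + 1) ω - π.lastSuccess T k ω) ^ 2) := by
  induction m with
  | zero => simp [successCount, s, lastSuccess]
  | succ m ih =>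
    obtain ⟨ih1, ih2⟩ := ih ((π.l_mono ω m).trans h)
    by_cases he : er m ω = false
    · have hc : successCount er (m + 1) ω = successCount er m ω + 1 := by
        simp [successCount, Nat.count_succ, he]
      have hs : π.s (successCount er m ω + 1) ω = ENNReal.ofReal (π.lastSuccess T (m + 1) ω) := by
        rw [s_succ_eq he rfl, lastSuccess_succ_of_success he h, ofReal_attemptTime h]
      refine ⟨by rw [hc, hs], ?_⟩
      rw [hc, Finset.sum_range_succ, ih2, Finset.sum_range_succ, y, hs, ih1,
        ← ENNReal.ofReal_sub _ (lastSuccess_nonneg _ _),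
        ← ENNReal.ofReal_pow (epoch_mem_Icc m ω).1, ← ENNReal.ofReal_add]
      · exact Finset.sum_nonneg fun _ _ => sq_nonneg _
      · exact sq_nonneg _
    · have he' : er m ω = true := by simpa using he
      have hc : successCount er (m + 1) ω = successCount er m ω := by
        simp [successCount, Nat.count_succ, he]
      rw [hc, Finset.sum_range_succ, lastSuccess_succ_of_erased he', ih1, ih2]
      simp

theorem successes_eq {K : ℕ} {ω : Ω} (h : π.l K ω ≤ T) (h' : T < π.l (K + 1) ω) :
    π.successes T ω = successCount er K ω := by
  have : {i : ℕ | π.s (i + 1) ω ≤ T} =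
      ((Finset.range (successCount er K ω) : Finset ℕ) : Set ℕ) := by
    ext i
    simp only [Set.mem_ofPred_eq, Finset.coe_range, Set.mem_Iio]
    constructor
    · intro hi
      by_contra hlt
      push Not at hlt
      have : π.l (K + 1) ω ≤ π.s (i + 1) ω := by
        refine le_iInf₂ fun k hk => π.l_monotone ω ?_
        by_contra hkK
        have h1 : successCount er (k + 1) ω ≤ successCount er K ω :=
          Nat.count_monotone _ (by omega)
        have h2 : successCount er (k + 1) ω = successCount er k ω + 1 := by
          simp [successCount, Nat.count_succ, hk.1]
        have h3 : successCount er k ω = i := hk.2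
        omega
      exact absurd (this.trans hi) (not_le.2 h')
    · intro hi
      have h1 := Nat.nth_lt_of_lt_count hi
      have hfin : ∀ hf : (Set.ofPred fun j => er j ω = false).Finite, i < hf.toFinset.card :=
        fun hf => hi.trans_le (Nat.count_le_card hf K)
      have h2 := Nat.nth_mem i hfin
      have h3 := Nat.count_nth hfin
      rw [s_succ_eq h2 h3]
      exact (π.l_monotone ω h1).trans h
  rw [successes, this, Set.ncard_coe_finset, Finset.card_range]

theorem exists_last_attempt {n : ℕ} {ω : Ω} (h : T < π.l n ω) :
    ∃ K, K < n ∧ π.l K ω ≤ T ∧ T < π.l (K + 1) ω := by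
  induction n with
  | zero => simp [π.l_zero] at h
  | succ n ih =>
    by_cases hn : π.l n ω ≤ T
    · exact ⟨n, n.lt_succ_self, hn, h⟩
    · obtain ⟨K, h1, h2⟩ := ih (not_le.1 hn)
      exact ⟨K, h1.trans n.lt_succ_self, h2⟩

theorem area_eq {n : ℕ} {ω : Ω} (h : T < π.l n ω) :
    π.area T ω = ENNReal.ofReal (π.runningArea T n ω) := by
  obtain ⟨K, hKn, hK, hK'⟩ := exists_last_attempt h
  have hS : ∀ m, K ≤ m → π.lastSuccess T m ω = π.lastSuccess T K ω ∧
      ∑ k ∈ Finset.range m, (π.lastSuccess T (k + 1) ω - π.lastSuccess T k ω) ^ 2 =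
      ∑ k ∈ Finset.range K, (π.lastSuccess T (k + 1) ω - π.lastSuccess T k ω) ^ 2 := by
    intro m hm
    induction m, hm using Nat.le_induction with
    | base => exact ⟨rfl, rfl⟩
    | succ m hm ih =>
      have h1 : ¬ π.l (m + 1) ω ≤ T :=
        not_le.2 (hK'.trans_le (π.l_monotone ω (Nat.succ_le_succ hm)))
      rw [Finset.sum_range_succ, lastSuccess_succ_of_lt h1, ih.1, ih.2]
      simp
  obtain ⟨h1, h2⟩ := s_successCount_and_sum hK
  have hhalf : ∀ x : ℝ, (2 : ℝ≥0∞)⁻¹ * ENNReal.ofReal x = ENNReal.ofReal (x / 2) := by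
    intro x
    rw [div_eq_inv_mul, ENNReal.ofReal_mul (by positivity), ENNReal.ofReal_inv_of_pos two_pos,
      ENNReal.ofReal_ofNat]
  rw [area, successes_eq hK hK', h1, h2, runningArea, attemptTime_of_ge h.le, (hS n hKn.le).1,
    (hS n hKn.le).2, ENNReal.ofReal_add (by positivity) (by positivity), hhalf,
    ← ENNReal.ofReal_coe_nnreal, ← ENNReal.ofReal_sub _ (lastSuccess_nonneg _ _),
    ← ENNReal.ofReal_pow (age_end_mem_Icc K ω).1, hhalf]

theorem lt_l_of_arrivals_lt [MeasurableSpace Ω] {P : Measure Ω} (hN : IsUnitPoissonProcess N P)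
    {n : ℕ} {ω : Ω} (h : N T ω < n) : T < π.l n ω := by
  by_contra hle
  rw [not_lt] at hle
  have h1 := π.le_arrivals ω n (ne_top_of_le_ne_top ENNReal.coe_ne_top hle)
  have h2 := hN.mono ω (ENNReal.toNNReal_mono ENNReal.coe_ne_top hle)
  simp only [ENNReal.toNNReal_coe] at h2
  omega

variable [mΩ : MeasurableSpace Ω] {P : Measure Ω}

theorem measurable_runningArea (hm : IsModel q N er P) (π : Policy N er) (T : ℝ≥0) (n : ℕ) :
    Measurable (π.runningArea T n) := by
  have h1 := π.measurable_lastSuccess' hm T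
  have h2 := π.measurable_attemptTime' hm T n
  unfold runningArea
  fun_prop

theorem tendsto_runningArea (hm : IsModel q N er P) (π : Policy N er) (T : ℝ≥0) (ω : Ω) :
    Tendsto (fun n => π.runningArea T n ω) atTop (𝓝 (π.area T ω).toReal) := by
  refine tendsto_const_nhds.congr' ?_
  filter_upwards [eventually_gt_atTop (N T ω)] with n hn
  rw [area_eq (lt_l_of_arrivals_lt hm.poisson hn), ENNReal.toReal_ofReal (runningArea_nonneg _ _)]

theorem measurable_area (hm : IsModel q N er P) (π : Policy N er) (T : ℝ≥0) :
    Measurable fun ω => (π.area T ω).toReal :=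
  measurable_of_tendsto_metrizable (π.measurable_runningArea hm T)
    (tendsto_pi_nhds.2 (π.tendsto_runningArea hm T))

theorem area_ne_top (hm : IsModel q N er P) (π : Policy N er) (T : ℝ≥0) (ω : Ω) :
    π.area T ω ≠ ⊤ := by
  rw [area_eq (lt_l_of_arrivals_lt hm.poisson (Nat.lt_succ_self (N T ω)))]
  exact ENNReal.ofReal_ne_top

variable [IsProbabilityMeasure P]

theorem tendsto_integral_runningArea (hm : IsModel q N er P) (π : Policy N er) (T : ℝ≥0) :
    Tendsto (fun n => ∫ ω, π.runningArea T n ω ∂P) atTop (𝓝 (∫ ω, (π.area T ω).toReal ∂P)) := by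
  refine tendsto_integral_of_dominated_convergence (fun _ => (T : ℝ) ^ 2)
    (fun n => (π.measurable_runningArea hm T n).aestronglyMeasurable) (integrable_const _)
    (fun n => Eventually.of_forall fun ω => ?_)
    (Eventually.of_forall (π.tendsto_runningArea hm T))
  rw [Real.norm_of_nonneg (runningArea_nonneg _ _)]
  exact runningArea_le n ω

theorem integrable_runningArea (hm : IsModel q N er P) (π : Policy N er) (T : ℝ≥0) (n : ℕ) :
    Integrable (π.runningArea T n) P := by
  refine Integrable.of_bound (π.measurable_runningArea hm T n).aestronglyMeasurable ((T : ℝ) ^ 2)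
    (Eventually.of_forall fun ω => ?_)
  rw [Real.norm_of_nonneg (runningArea_nonneg _ _)]
  exact runningArea_le n ω

theorem integrable_attemptTime (hm : IsModel q N er P) (π : Policy N er) (T : ℝ≥0) (n : ℕ) :
    Integrable (π.attemptTime T n) P :=
  integrable_comp_of_mem_Icc (f := id) continuous_id (π.measurable_attemptTime' hm T n)
    (a := 0) (b := T) fun ω => ⟨attemptTime_nonneg n ω, attemptTime_le n ω⟩

theorem tendsto_integral_attemptTime (hm : IsModel q N er P) (π : Policy N er) (T : ℝ≥0) :
    Tendsto (fun n => ∫ ω, π.attemptTime T n ω ∂P) atTop (𝓝 T) := by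
  have h : Tendsto (fun n => ∫ ω, π.attemptTime T n ω ∂P) atTop (𝓝 (∫ _, (T : ℝ) ∂P)) := by
    refine tendsto_integral_of_dominated_convergence (fun _ => (T : ℝ))
      (fun n => (π.measurable_attemptTime' hm T n).aestronglyMeasurable) (integrable_const _)
      (fun n => Eventually.of_forall fun ω => ?_) (Eventually.of_forall fun ω => ?_)
    · rw [Real.norm_of_nonneg (attemptTime_nonneg _ _)]
      exact attemptTime_le n ω
    · refine tendsto_const_nhds.congr' ?_
      filter_upwards [eventually_gt_atTop (N T ω)] with n hn
      rw [attemptTime_of_ge (lt_l_of_arrivals_lt hm.poisson hn).le]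
  simpa using h

theorem lintegral_area (hm : IsModel q N er P) (π : Policy N er) (T : ℝ≥0) :
    ∫⁻ ω, π.area T ω ∂P = ENNReal.ofReal (∫ ω, (π.area T ω).toReal ∂P) := by
  rw [ofReal_integral_eq_lintegral_ofReal]
  · simp_rw [ENNReal.ofReal_toReal (π.area_ne_top hm T _)]
  · refine Integrable.of_bound (π.measurable_area hm T).aestronglyMeasurable ((T : ℝ) ^ 2)
      (Eventually.of_forall fun ω => ?_)
    rw [Real.norm_of_nonneg ENNReal.toReal_nonneg]
    exact le_of_tendsto' (π.tendsto_runningArea hm T ω) fun n => runningArea_le n ω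
  · exact Eventually.of_forall fun ω => ENNReal.toReal_nonneg

theorem ae_nextArrival_eq (hm : IsModel q N er P) (π : Policy N er) (T : ℝ≥0) (n : ℕ) :
    ∀ᵐ ω ∂P, π.l n ω ≤ T → nextArrival N (π.l n ω) ω =
      ENNReal.ofReal (π.attemptTime T n ω + gap N (π.truncated T n ω) ω) := by
  have hτ := π.isStoppingTime_truncated hm T n
  have hfin : ∀ᵐ ω ∂P, π.truncated T n ω < ⊤ :=
    Eventually.of_forall fun ω => (min_le_right _ _).trans_lt ENNReal.coe_lt_top
  filter_upwards [hm.ae_nextArrival_lt_top hτ hfin] with ω h hl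
  have h1 : π.truncated T n ω = π.l n ω := min_eq_left hl
  rw [h1] at h ⊢
  rw [ENNReal.ofReal_add (attemptTime_nonneg _ _) (gap_nonneg _ _), ofReal_attemptTime hl, gap,
    ENNReal.ofReal_toReal (tsub_le_self.trans_lt h).ne, add_tsub_cancel_of_le (le_nextArrival _ _)]

/-- The next attempt comes no earlier than the next arrival, `fullCost` is monotone, and an attempt
is never better than `fullCost`. If the horizon comes first, the boundary value `emptyCost`
dominates the value for either battery state. -/
theorem ae_drift_nonneg (hm : IsModel q N er P) (hq0 : 0 < q) (hq1 : q < 1)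
    (π : Policy N er) (T : ℝ≥0) (n : ℕ) :
    ∀ᵐ ω ∂P, 0 ≤ π.drift q γ T (emptyCost q γ) n ω := by
  filter_upwards [π.ae_nextArrival_eq hm T n] with ω h
  rw [drift]
  split_ifs with h0 h1
  · have h2 := (h h0).symm.trans_le (π.nextArrival_le_l n ω)
    rw [← ofReal_attemptTime h1, ENNReal.ofReal_le_ofReal_iff (attemptTime_nonneg _ _)] at h2
    have h3 := attemptTime_le (π := π) (T := T) (n + 1) ω
    rw [nextCost, if_pos (by linarith)]
    refine sub_nonneg.2 ((fullCost_mono ?_).trans (fullCost_le hq0 hq1 _))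
    linarith
  · rw [nextCost]
    split_ifs with h2
    · refine sub_nonneg.2 ((fullCost_mono ?_).trans (fullCost_le_emptyCost _))
      linarith
    · exact le_of_eq (by ring_nf)
  · exact le_rfl

theorem integral_potential_nonneg (hm : IsModel q N er P) (hq0 : 0 < q) (hq1 : q < 1)
    (hγ : IsThreshold q γ) (π : Policy N er) (T : ℝ≥0) (n : ℕ) :
    0 ≤ ∫ ω, π.potential q γ T (emptyCost q γ) n ω ∂P := by
  induction n with
  | zero => rw [π.integral_potential_zero hq1 hγ T]
  | succ n ih =>
    rw [π.integral_potential_succ hm hq0.le hq1 hγ T continuous_emptyCost n]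
    exact add_nonneg ih (integral_nonneg_of_ae (π.ae_drift_nonneg hm hq0 hq1 T n))

/-- A potential of nonnegative mean is bounded above through `emptyCost_le_epochCost` by the area
minus λ times the elapsed time, up to ε and a constant. As C does not depend on T, it disappears in
the average. -/
theorem exists_le_integral_area (hm : IsModel q N er P) (hq0 : 0 < q) (hq1 : q < 1)
    (hγ : IsThreshold q γ) {ε : ℝ} (hε : 0 < ε) (π : Policy N er) :
    ∃ C, ∀ T : ℝ≥0, optAoI q γ * T ≤ (1 + ε) * ∫ ω, (π.area T ω).toReal ∂P + C := by
  obtain ⟨C, hC⟩ := emptyCost_le_epochCost hq0 hq1 hγ hε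
  refine ⟨C, fun T => ?_⟩
  have key : ∀ n, optAoI q γ * ∫ ω, π.attemptTime T n ω ∂P ≤
      (1 + ε) * ∫ ω, π.runningArea T n ω ∂P + C := by
    intro n
    have h1 : ∀ ω, π.potential q γ T (emptyCost q γ) n ω ≤
        (1 + ε) * π.runningArea T n ω + C - optAoI q γ * π.attemptTime T n ω := by
      intro ω
      have h2 : π.potential q γ T (emptyCost q γ) n ω = π.completedCost q γ T n ω +
          emptyCost q γ (π.attemptTime T n ω - π.lastSuccess T n ω) := by
        rw [potential]
        split_ifs with h
        · rfl
        · rw [attemptTime_of_ge (not_le.1 h).le]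
      have h3 := hC _ (age_mem_Icc (π := π) (T := T) n ω).1
      have h4 := completedCost_add_epochCost (q := q) (γ := γ) (π := π) (T := T) n ω
      have h5 : (π.attemptTime T n ω - π.lastSuccess T n ω) ^ 2 / 2 ≤ π.runningArea T n ω := by
        unfold runningArea
        have : 0 ≤ ∑ k ∈ Finset.range n,
          (π.lastSuccess T (k + 1) ω - π.lastSuccess T k ω) ^ 2 := by positivity
        linarith
      have h6 := mul_le_mul_of_nonneg_left h5 hε.le
      linarith
    have hi1 := (π.integrable_runningArea hm T n).const_mul (1 + ε)
    have hi2 := (π.integrable_attemptTime hm T n).const_mul (optAoI q γ)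
    have h7 := (π.integral_potential_nonneg hm hq0 hq1 hγ T n).trans
      (integral_mono (π.integrable_potential hm T continuous_emptyCost n)
        ((hi1.add (integrable_const C)).sub hi2) h1)
    have h8 : ∫ ω, ((1 + ε) * π.runningArea T n ω + C - optAoI q γ * π.attemptTime T n ω) ∂P =
        (1 + ε) * ∫ ω, π.runningArea T n ω ∂P + C -
          optAoI q γ * ∫ ω, π.attemptTime T n ω ∂P := by
      have hi3 : Integrable (fun ω => (1 + ε) * π.runningArea T n ω + C) P :=
        hi1.add (integrable_const C)
      rw [integral_sub hi3 hi2, integral_add hi1 (integrable_const C),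
        integral_const_mul, integral_const_mul]
      simp
    have h9 : (0 : ℝ) ≤ ∫ ω, ((1 + ε) * π.runningArea T n ω + C -
      optAoI q γ * π.attemptTime T n ω) ∂P := h7
    rw [h8] at h9
    linarith
  exact le_of_tendsto_of_tendsto' ((π.tendsto_integral_attemptTime hm T).const_mul _)
    (((π.tendsto_integral_runningArea hm T).const_mul _).add_const C) key

theorem optAoI_le_averageAoI (hm : IsModel q N er P) (hq0 : 0 < q) (hq1 : q < 1)
    (hγ : IsThreshold q γ) (π : Policy N er) :
    ENNReal.ofReal (optAoI q γ) ≤ π.averageAoI P := by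
  have key : ∀ ε : ℝ, 0 < ε → ENNReal.ofReal (optAoI q γ / (1 + ε)) ≤ π.averageAoI P := by
    intro ε hε
    obtain ⟨C, hC⟩ := π.exists_le_integral_area hm hq0 hq1 hγ hε
    have hlim : Tendsto (fun T : ℝ≥0 => ENNReal.ofReal ((optAoI q γ - C / T) / (1 + ε))) atTop
        (𝓝 (ENNReal.ofReal (optAoI q γ / (1 + ε)))) := by
      refine ENNReal.tendsto_ofReal (Tendsto.div_const ?_ _)
      have : Tendsto (fun T : ℝ≥0 => C / (T : ℝ)) atTop (𝓝 0) :=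
        tendsto_const_nhds.div_atTop (NNReal.tendsto_coe_atTop.2 tendsto_id)
      simpa using this.const_sub (optAoI q γ)
    rw [← hlim.limsup_eq, averageAoI]
    refine limsup_le_limsup ?_
    filter_upwards [eventually_gt_atTop 0] with T hT
    have hT' : (0 : ℝ) < T := hT
    rw [π.lintegral_area hm T, ← ENNReal.ofReal_coe_nnreal, ← ENNReal.ofReal_div_of_pos hT']
    refine ENNReal.ofReal_le_ofReal ?_
    rw [div_le_div_iff₀ (by linarith) hT', sub_mul, div_mul_cancel₀ _ hT'.ne']
    linarith [hC T]
  have hlim : Tendsto (fun ε : ℝ => ENNReal.ofReal (optAoI q γ / (1 + ε))) (𝓝[>] 0)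
      (𝓝 (ENNReal.ofReal (optAoI q γ / (1 + 0)))) := by
    refine ENNReal.tendsto_ofReal (Tendsto.div tendsto_const_nhds ?_ (by norm_num))
    exact (tendsto_const_nhds.add tendsto_id).mono_left nhdsWithin_le_nhds
  rw [add_zero, div_one] at hlim
  refine le_of_tendsto hlim ?_
  filter_upwards [self_mem_nhdsWithin] with ε hε using key ε hε

end Policy

end StatusUpdate

/-! ### The threshold policy and the upper bound -/

namespace StatusUpdate

variable {Ω : Type*} {N : ℝ≥0 → Ω → ℕ} {er : ℕ → Ω → Bool} {q : ℝ} {γ : ℝ≥0}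

/-- The `n`-th attempt is the start of an epoch: it is successful, or `n = 0`. -/
abbrev StartsEpoch (er : ℕ → Ω → Bool) (n : ℕ) (ω : Ω) : Prop := n = 0 ∨ er (n - 1) ω = false

/-- The waiting time that the threshold policy imposes after the `n`-th attempt. -/
noncomputable def thresholdDelay (er : ℕ → Ω → Bool) (γ : ℝ≥0) (n : ℕ) (ω : Ω) : ℝ≥0 :=
  if StartsEpoch er n ω then γ else 0

/-- The attempt times of the threshold policy: after a success, the next attempt is made as soon as
the age is at least `γ` and the battery is full; after an erasure, it is made as soon as the
battery is full. -/
noncomputable def thresholdTime (N : ℝ≥0 → Ω → ℕ) (er : ℕ → Ω → Bool) (γ : ℝ≥0) : ℕ → Ω → ℝ≥0∞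
  | 0, _ => 0
  | n + 1, ω => max (nextArrival N (thresholdTime N er γ n ω) ω)
      (thresholdTime N er γ n ω + thresholdDelay er γ n ω)

theorem measurable_info (N : ℝ≥0 → Ω → ℕ) (er : ℕ → Ω → Bool) (n : ℕ) {u t : ℝ≥0} (h : u ≤ t) :
    Measurable[info N er n t] (N u) :=
  measurable_iff_comap_le.2
    ((le_iSup₂ (f := fun (v : ℝ≥0) (_ : v ≤ t) => MeasurableSpace.comap (N v) ⊤) u h).trans
      le_sup_left)

theorem measurable_info_er (N : ℝ≥0 → Ω → ℕ) (er : ℕ → Ω → Bool) {k n : ℕ} (h : k < n) (t : ℝ≥0) :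
    Measurable[info N er n t] (er k) :=
  measurable_iff_comap_le.2
    ((le_iSup₂ (f := fun (j : ℕ) (_ : j < n) => MeasurableSpace.comap (er j) ⊤) k h).trans
      le_sup_right)

theorem info_mono {k n : ℕ} (hk : k ≤ n) {u t : ℝ≥0} (h : u ≤ t) :
    info N er k u ≤ info N er n t :=
  sup_le_sup (biSup_mono fun _ hv => hv.trans h) (biSup_mono fun _ hj => lt_of_lt_of_le hj hk)

theorem measurableSet_startsEpoch (N : ℝ≥0 → Ω → ℕ) (er : ℕ → Ω → Bool) (n : ℕ) (t : ℝ≥0) :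
    MeasurableSet[info N er n t] {ω | StartsEpoch er n ω} := by
  cases n with
  | zero => simp [StartsEpoch]
  | succ n =>
    have : {ω | StartsEpoch er (n + 1) ω} = er n ⁻¹' {false} := by ext ω; simp [StartsEpoch]
    rw [this]
    exact measurable_info_er N er n.lt_succ_self t (measurableSet_singleton false)

section

variable [mΩ : MeasurableSpace Ω] {P : Measure Ω}

theorem measurableSet_thresholdTime_succ_le (hm : IsModel q N er P) (γ : ℝ≥0) {n : ℕ}
    (ih : ∀ t : ℝ≥0, MeasurableSet[info N er n t] {ω | thresholdTime N er γ n ω ≤ t}) (t : ℝ≥0) :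
    MeasurableSet[info N er n t] {ω | thresholdTime N er γ (n + 1) ω ≤ t} := by
  have h1 : MeasurableSet[info N er n t] {ω | nextArrival N (thresholdTime N er γ n ω) ω ≤ t} :=
    hm.measurableSet_nextArrival_le (fun u hu => measurable_info N er n hu)
      fun u hu => info_mono le_rfl hu _ (ih u)
  have h2 : MeasurableSet[info N er n t] {ω | thresholdTime N er γ n ω + γ ≤ t} := by
    by_cases hγ : γ ≤ t
    · have : {ω | thresholdTime N er γ n ω + γ ≤ t} =
          {ω | thresholdTime N er γ n ω ≤ (t - γ : ℝ≥0)} := by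
        ext ω
        rw [Set.mem_ofPred_eq, Set.mem_ofPred_eq, ENNReal.coe_sub,
          ENNReal.le_sub_iff_add_le_right ENNReal.coe_ne_top (ENNReal.coe_le_coe.2 hγ)]
      rw [this]
      exact info_mono le_rfl tsub_le_self _ (ih _)
    · have : {ω | thresholdTime N er γ n ω + γ ≤ t} = ∅ := by
        ext ω
        simp only [Set.mem_ofPred_eq, Set.mem_empty_iff_false, iff_false]
        exact fun h => hγ (ENNReal.coe_le_coe.1 (le_add_self.trans h))
      rw [this]
      exact @MeasurableSet.empty Ω (info N er n t)
  have h3 : {ω | thresholdTime N er γ (n + 1) ω ≤ t} =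
      {ω | nextArrival N (thresholdTime N er γ n ω) ω ≤ t} ∩
        (({ω | StartsEpoch er n ω} ∩ {ω | thresholdTime N er γ n ω + γ ≤ t}) ∪
          ({ω | StartsEpoch er n ω}ᶜ ∩ {ω | thresholdTime N er γ n ω ≤ t})) := by
    ext ω
    simp only [thresholdTime, thresholdDelay, Set.mem_ofPred_eq, max_le_iff, Set.mem_inter_iff,
      Set.mem_union, Set.mem_compl_iff]
    by_cases h : StartsEpoch er n ω <;> simp [h]
  have h4 := measurableSet_startsEpoch N er n t
  rw [h3]
  exact h1.inter ((h4.inter h2).union (h4.compl.inter (ih t)))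

theorem measurableSet_thresholdTime_le (hm : IsModel q N er P) (γ : ℝ≥0) (n : ℕ) (t : ℝ≥0) :
    MeasurableSet[info N er n t] {ω | thresholdTime N er γ n ω ≤ t} := by
  induction n generalizing t with
  | zero => simp [thresholdTime]
  | succ n ih =>
    exact info_mono n.le_succ le_rfl _ (measurableSet_thresholdTime_succ_le hm γ ih t)

/-- The threshold policy. -/
noncomputable def thresholdPolicy (hm : IsModel q N er P) (γ : ℝ≥0) : Policy N er where
  l := thresholdTime N er γ
  l_zero _ := rfl
  l_mono _ _ := (le_nextArrival _ _).trans (le_max_left _ _)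
  online n t :=
    measurableSet_thresholdTime_succ_le hm γ (measurableSet_thresholdTime_le hm γ n) t
  energy_causality ω n h := by
    rw [one_le_battery_iff]
    have h1 : nextArrival N (thresholdTime N er γ n ω) ω ≤ thresholdTime N er γ (n + 1) ω :=
      le_max_left _ _
    rw [← ENNReal.coe_toNNReal h.ne, nextArrival_le_iff hm.poisson] at h1
    exact h1.2

theorem thresholdPolicy_l_succ (hm : IsModel q N er P) (γ : ℝ≥0) (n : ℕ) (ω : Ω) :
    (thresholdPolicy hm γ).l (n + 1) ω = max (nextArrival N ((thresholdPolicy hm γ).l n ω) ω)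
      ((thresholdPolicy hm γ).l n ω + thresholdDelay er γ n ω) := rfl

end

namespace Policy

variable {T : ℝ≥0}

theorem lastSuccess_eq_of_startsEpoch {π : Policy N er} {n : ℕ} {ω : Ω} (h : π.l n ω ≤ T)
    (hs : StartsEpoch er n ω) : π.lastSuccess T n ω = π.attemptTime T n ω := by
  cases n with
  | zero => rw [attemptTime_zero, lastSuccess]
  | succ n => exact lastSuccess_succ_of_success (by simpa [StartsEpoch] using hs) h

variable [mΩ : MeasurableSpace Ω] {P : Measure Ω}

/-- The first attempt of an epoch has waited for γ, and the age at a retry is at least that at the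
erased attempt. Hence every attempt falls where `fullCost_eq_of_le` gives equality. -/
theorem threshold_le_age (hm : IsModel q N er P) {n : ℕ} {ω : Ω}
    (h : (thresholdPolicy hm γ).l (n + 1) ω ≤ T) :
    (γ : ℝ) ≤ (thresholdPolicy hm γ).attemptTime T (n + 1) ω -
      (thresholdPolicy hm γ).lastSuccess T n ω := by
  induction n with
  | zero =>
    have h1 : (γ : ℝ≥0∞) ≤ (thresholdPolicy hm γ).l (0 + 1) ω := by
      rw [thresholdPolicy_l_succ, thresholdDelay, if_pos (Or.inl rfl)]
      exact le_add_self.trans (le_max_right _ _)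
    rw [attemptTime_of_le h, lastSuccess, sub_zero]
    have := ENNReal.toReal_mono (h.trans_lt ENNReal.coe_lt_top).ne h1
    simpa using this
  | succ n ih =>
    have h0 : (thresholdPolicy hm γ).l (n + 1) ω ≤ T := ((thresholdPolicy hm γ).l_mono ω _).trans h
    by_cases hs : StartsEpoch er (n + 1) ω
    · rw [lastSuccess_eq_of_startsEpoch h0 hs]
      have h1 : (thresholdPolicy hm γ).l (n + 1) ω + γ ≤
          (thresholdPolicy hm γ).l (n + 1 + 1) ω := by
        rw [thresholdPolicy_l_succ _ _ (n + 1), thresholdDelay, if_pos hs]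
        exact le_max_right _ _
      have h2 := ENNReal.toReal_mono (h.trans_lt ENNReal.coe_lt_top).ne h1
      rw [ENNReal.toReal_add (h0.trans_lt ENNReal.coe_lt_top).ne ENNReal.coe_ne_top,
        ENNReal.coe_toReal] at h2
      rw [attemptTime_of_le h, attemptTime_of_le h0]
      linarith
    · have he : er n ω = true := by simpa [StartsEpoch] using hs
      rw [lastSuccess_succ_of_erased he]
      have := attemptTime_mono (π := thresholdPolicy hm γ) (T := T) ω (n + 1).le_succ
      simp only at this
      linarith [ih h0]

variable [IsProbabilityMeasure P]

/-- Waiting until age γ with a full battery is free, since `fullCost` is constant up to γ, and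
attempts from γ on attain equality. The boundary value `fullCost` is needed now, being the smaller
of the two. -/
theorem ae_drift_nonpos (hm : IsModel q N er P) (hq1 : q < 1) (T : ℝ≥0) (n : ℕ) :
    ∀ᵐ ω ∂P, (thresholdPolicy hm γ).drift q γ T (fullCost q γ) n ω ≤ 0 := by
  filter_upwards [(thresholdPolicy hm γ).ae_nextArrival_eq hm T n] with ω h
  set σ := thresholdPolicy hm γ with hσ
  rw [drift]
  by_cases h0 : σ.l n ω ≤ T
  · rw [if_pos h0]
    have hx := gap_nonneg (N := N) (σ.truncated T n ω) ω
    set x := gap N (σ.truncated T n ω) ω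
    have hl : σ.l (n + 1) ω = ENNReal.ofReal (max (σ.attemptTime T n ω + x)
        (σ.attemptTime T n ω + thresholdDelay er γ n ω)) := by
      rw [hσ, thresholdPolicy_l_succ, ← hσ, h h0, ENNReal.ofReal_max,
        ENNReal.ofReal_add (attemptTime_nonneg (π := σ) (T := T) n ω)
          (thresholdDelay er γ n ω).coe_nonneg,
        ofReal_attemptTime h0, ENNReal.ofReal_coe_nnreal]
    -- At the start of an epoch the age is zero and the imposed delay is γ; otherwise the imposed
    -- delay is zero.
    have hmax : max (σ.attemptTime T n ω + x) (σ.attemptTime T n ω + thresholdDelay er γ n ω) -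
        σ.lastSuccess T n ω ≤ max (σ.attemptTime T n ω - σ.lastSuccess T n ω + x) γ := by
      rw [sub_le_iff_le_add]
      refine max_le ?_ ?_
      · linarith [le_max_left (σ.attemptTime T n ω - σ.lastSuccess T n ω + x) (γ : ℝ)]
      · rw [thresholdDelay]
        split_ifs with hs
        · rw [lastSuccess_eq_of_startsEpoch h0 hs]
          linarith [le_max_right (σ.attemptTime T n ω - σ.attemptTime T n ω + x) (γ : ℝ)]
        · have := le_max_left (σ.attemptTime T n ω - σ.lastSuccess T n ω + x) (γ : ℝ)
          push_cast
          linarith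
    have hfull : fullCost q γ (max (σ.attemptTime T n ω - σ.lastSuccess T n ω + x) γ) =
        fullCost q γ (σ.attemptTime T n ω - σ.lastSuccess T n ω + x) := by
      rw [fullCost, fullCost, max_assoc, max_self]
    have hle : σ.l (n + 1) ω ≤ T → max (σ.attemptTime T n ω + x)
        (σ.attemptTime T n ω + thresholdDelay er γ n ω) = σ.attemptTime T (n + 1) ω := by
      intro h2
      rw [attemptTime_of_le h2, hl, ENNReal.toReal_ofReal]
      exact (add_nonneg (attemptTime_nonneg n ω) hx).trans (le_max_left _ _)
    split_ifs with h1
    · have h3 := attemptTime_le (π := σ) (T := T) (n + 1) ω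
      have h4 := le_max_left (σ.attemptTime T n ω + x)
        (σ.attemptTime T n ω + thresholdDelay er γ n ω)
      rw [hle h1] at hmax h4
      rw [nextCost, if_pos (by linarith), fullCost_eq_of_le hq1 (threshold_le_age hm h1), ← hfull]
      exact sub_nonpos.2 (fullCost_mono hmax)
    · rw [nextCost]
      split_ifs with h2
      · rw [← hfull]
        refine sub_nonpos.2 (fullCost_mono (le_trans ?_ hmax))
        rw [hl, ← ENNReal.ofReal_coe_nnreal, not_le, ENNReal.ofReal_lt_ofReal_iff'] at h1
        linarith [h1.1]
      · refine sub_nonpos.2 ((fullCost_le_emptyCost _).trans (le_of_eq ?_))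
        ring_nf
  · rw [if_neg h0]

theorem integral_potential_nonpos (hm : IsModel q N er P) (hq0 : 0 ≤ q) (hq1 : q < 1)
    (hγ : IsThreshold q γ) (T : ℝ≥0) (n : ℕ) :
    ∫ ω, (thresholdPolicy hm γ).potential q γ T (fullCost q γ) n ω ∂P ≤ 0 := by
  induction n with
  | zero => rw [integral_potential_zero hq1 hγ]
  | succ n ih =>
    rw [integral_potential_succ hm hq0 hq1 hγ _ T continuous_fullCost n]
    exact add_nonpos ih (integral_nonpos_of_ae (ae_drift_nonpos hm hq1 T n))

theorem exists_integral_area_le (hm : IsModel q N er P) (hq0 : 0 < q) (hq1 : q < 1)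
    (hγ : IsThreshold q γ) : ∃ C, ∀ T : ℝ≥0,
      ∫ ω, ((thresholdPolicy hm γ).area T ω).toReal ∂P ≤ optAoI q γ * T + C := by
  set σ := thresholdPolicy hm γ with hσ
  obtain ⟨C, hC⟩ : ∃ C, ∀ t : ℝ, 0 ≤ t → epochCost q γ t ≤ fullCost q γ t + C :=
    ⟨_, fun t ht => epochCost_le_fullCost hq0 hq1 hγ ht⟩
  refine ⟨C, fun T => le_of_tendsto' (σ.tendsto_integral_runningArea hm T) fun n => ?_⟩
  have hlam : 0 ≤ optAoI q γ := by
    have : 0 < q / (1 - q) := div_pos hq0 (by linarith)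
    have := hγ.pos
    rw [optAoI]
    linarith
  have h1 : ∀ ω, σ.runningArea T n ω - (optAoI q γ * T + C) ≤
      σ.potential q γ T (fullCost q γ) n ω := by
    intro ω
    have h2 : σ.completedCost q γ T n ω +
        fullCost q γ (σ.attemptTime T n ω - σ.lastSuccess T n ω) ≤
          σ.potential q γ T (fullCost q γ) n ω := by
      rw [potential]
      split_ifs with h
      · gcongr
        exact fullCost_le_emptyCost _
      · rw [attemptTime_of_ge (not_le.1 h).le]
    have h3 := hC _ (age_mem_Icc (π := σ) (T := T) n ω).1
    have h4 := completedCost_add_epochCost (q := q) (γ := γ) (π := σ) (T := T) n ω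
    have h5 := mul_le_mul_of_nonneg_left (attemptTime_le (π := σ) (T := T) n ω) hlam
    linarith
  have h2 := (integral_mono ((σ.integrable_runningArea hm T n).sub (integrable_const _))
    (σ.integrable_potential hm T continuous_fullCost n) h1).trans
      (integral_potential_nonpos hm hq0.le hq1 hγ T n)
  have h3 : ∫ ω, (σ.runningArea T n ω - (optAoI q γ * T + C)) ∂P ≤ 0 := h2
  rw [integral_sub (σ.integrable_runningArea hm T n) (integrable_const _)] at h3
  simp only [integral_const, probReal_univ, one_smul] at h3
  linarith

theorem averageAoI_thresholdPolicy_le (hm : IsModel q N er P) (hq0 : 0 < q) (hq1 : q < 1)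
    (hγ : IsThreshold q γ) :
    (thresholdPolicy hm γ).averageAoI P ≤ ENNReal.ofReal (optAoI q γ) := by
  obtain ⟨C, hC⟩ := exists_integral_area_le hm hq0 hq1 hγ
  have hlim : Tendsto (fun T : ℝ≥0 => ENNReal.ofReal (optAoI q γ + C / T)) atTop
      (𝓝 (ENNReal.ofReal (optAoI q γ))) := by
    refine ENNReal.tendsto_ofReal ?_
    have : Tendsto (fun T : ℝ≥0 => C / (T : ℝ)) atTop (𝓝 0) :=
      tendsto_const_nhds.div_atTop (NNReal.tendsto_coe_atTop.2 tendsto_id)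
    simpa using this.const_add (optAoI q γ)
  rw [← hlim.limsup_eq, averageAoI]
  refine limsup_le_limsup ?_
  filter_upwards [eventually_gt_atTop 0] with T hT
  have hT' : (0 : ℝ) < T := hT
  rw [lintegral_area hm, ← ENNReal.ofReal_coe_nnreal, ← ENNReal.ofReal_div_of_pos hT']
  refine ENNReal.ofReal_le_ofReal ?_
  rw [div_le_iff₀ hT', add_mul, div_mul_cancel₀ _ hT'.ne']
  exact hC T

end Policy

end StatusUpdate

/-! ### Blocks of an i.i.d. sequence -/

namespace StatusUpdate

/-- A finite index set is filled up to an initial segment with the trivial event. Initial segments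
suit the inductions over blocks and steps. -/
theorem iIndepFun_of_measure_iInter_range {Ω β : Type*} [MeasurableSpace Ω] [MeasurableSpace β]
    {P : Measure Ω} [IsProbabilityMeasure P] {X : ℕ → Ω → β}
    (h : ∀ n (B : ℕ → Set β), (∀ i, MeasurableSet (B i)) →
      P (⋂ i ∈ Finset.range n, X i ⁻¹' B i) = ∏ i ∈ Finset.range n, P (X i ⁻¹' B i)) :
    iIndepFun X P := by
  classical
  rw [iIndepFun_iff_measure_inter_preimage_eq_mul]
  intro S B hB
  have hS : S ⊆ Finset.range (S.sup id + 1) := fun i hi =>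
    Finset.mem_range.2 (Nat.lt_succ_of_le (Finset.le_sup (f := id) hi))
  have h1 := h (S.sup id + 1) (fun i => if i ∈ S then B i else Set.univ) fun i => by
    split_ifs with hi
    · exact hB i hi
    · exact MeasurableSet.univ
  have h2 : ⋂ i ∈ Finset.range (S.sup id + 1), X i ⁻¹' (if i ∈ S then B i else Set.univ) =
      ⋂ i ∈ S, X i ⁻¹' B i := by
    ext ω
    simp only [Set.mem_iInter, Set.mem_preimage]
    refine ⟨fun h i hi => by simpa [hi] using h i (hS hi), fun h i _ => ?_⟩
    split_ifs with hi
    · exact h i hi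
    · trivial
  rw [h2] at h1
  rw [h1, ← Finset.prod_subset hS]
  · exact Finset.prod_congr rfl fun i hi => by rw [if_pos hi]
  · intro i _ hi
    simp [hi]

section Blocks

variable {α : Type*}

open Classical in
/-- The length of the first block of `z`, where blocks end at the visits of `s`. -/
noncomputable def blockLength (s : Set α) (z : ℕ → α) : ℕ :=
  if h : ∃ n, z n ∈ s then Nat.find h + 1 else 0

theorem blockLength_eq_succ_iff {s : Set α} {z : ℕ → α} {n : ℕ} :
    blockLength s z = n + 1 ↔ z n ∈ s ∧ ∀ k < n, z k ∉ s := by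
  classical
  unfold blockLength
  split_ifs with h
  · rw [Nat.add_right_cancel_iff, Nat.find_eq_iff]
  · push Not at h
    simp [h]

theorem blockLength_eq_zero_iff {s : Set α} {z : ℕ → α} :
    blockLength s z = 0 ↔ ∀ n, z n ∉ s := by
  unfold blockLength
  split_ifs with h
  · simpa using h
  · push Not at h
    simpa using h

/-- The sequence that remains after the first block. -/
noncomputable def dropBlock (s : Set α) (z : ℕ → α) : ℕ → α := fun k => z (blockLength s z + k)

/-- The sum over the first block of weights that depend on the position in the block. -/
noncomputable def blockSum (s : Set α) (w : ℕ → α → ℝ≥0∞) (z : ℕ → α) : ℝ≥0∞ :=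
  ∑ j ∈ Finset.range (blockLength s z), w j (z j)

variable [MeasurableSpace α] {s : Set α} {w : ℕ → α → ℝ≥0∞}

theorem measurableSet_blockLength (hs : MeasurableSet s) {m : MeasurableSpace (ℕ → α)} {n : ℕ}
    (h : ∀ k ≤ n, Measurable[m] fun z : ℕ → α => z k) :
    MeasurableSet[m] {z : ℕ → α | blockLength s z = n + 1} := by
  have : {z : ℕ → α | blockLength s z = n + 1} =
      (fun z : ℕ → α => z n) ⁻¹' s ∩ ⋂ (k : ℕ) (_ : k < n), ((fun z : ℕ → α => z k) ⁻¹' s)ᶜ := by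
    ext z
    simp [blockLength_eq_succ_iff]
  rw [this]
  exact (h n le_rfl hs).inter
    (MeasurableSet.iInter fun k => MeasurableSet.iInter fun hk => (h k hk.le hs).compl)

theorem measurable_blockLength (hs : MeasurableSet s) :
    Measurable (blockLength s : (ℕ → α) → ℕ) := by
  refine measurable_to_countable' fun n => ?_
  cases n with
  | zero =>
    have : blockLength s ⁻¹' {0} = ⋂ k : ℕ, ((fun z : ℕ → α => z k) ⁻¹' s)ᶜ := by
      ext z
      simp [blockLength_eq_zero_iff]
    rw [this]
    exact MeasurableSet.iInter fun k => (measurable_pi_apply k hs).compl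
  | succ n => exact measurableSet_blockLength hs fun k _ => measurable_pi_apply k

theorem measurable_dropBlock (hs : MeasurableSet s) : Measurable (dropBlock s) := by
  refine measurable_pi_lambda _ fun k => ?_
  have h : Measurable fun p : ℕ × (ℕ → α) => p.2 (p.1 + k) :=
    measurable_from_prod_countable_right fun n => measurable_pi_apply (n + k)
  exact h.comp ((measurable_blockLength hs).prodMk measurable_id)

theorem measurable_blockSum (hs : MeasurableSet s) (hw : ∀ j, Measurable (w j)) :
    Measurable (blockSum s w) := by
  have h : Measurable fun p : ℕ × (ℕ → α) => ∑ j ∈ Finset.range p.1, w j (p.2 j) :=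
    measurable_from_prod_countable_right fun n =>
      Finset.measurable_fun_sum (f := fun j (z : ℕ → α) => w j (z j)) (Finset.range n)
        fun j _ => (hw j).comp (measurable_pi_apply j)
  exact h.comp ((measurable_blockLength hs).prodMk measurable_id)

variable {ν : Measure α} [IsProbabilityMeasure ν]

theorem indep_iSup_lt_iSup_ge (ν : Measure α) [IsProbabilityMeasure ν] (n : ℕ) :
    Indep (⨆ k ∈ Set.Iio n, MeasurableSpace.comap (fun z : ℕ → α => z k) inferInstance)
      (⨆ k ∈ Set.Ici n, MeasurableSpace.comap (fun z : ℕ → α => z k) inferInstance)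
      (Measure.infinitePi fun _ : ℕ => ν) :=
  indep_iSup_of_disjoint (fun k => (measurable_pi_apply k).comap_le)
    (iIndepFun_infinitePi (P := fun _ : ℕ => ν) (X := fun _ z => z) fun _ => measurable_id).iIndep
    (Set.disjoint_left.2 fun _ h h' => absurd (Set.mem_Iio.1 h) (not_lt.2 (Set.mem_Ici.1 h')))

theorem map_shift_infinitePi (ν : Measure α) [IsProbabilityMeasure ν] (n : ℕ) :
    (Measure.infinitePi fun _ : ℕ => ν).map (fun z k => z (n + k)) =
      Measure.infinitePi fun _ : ℕ => ν :=
  Measure.map_infinitePi_infinitePi_of_inj (P := fun _ : ℕ => ν) (add_right_injective n)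

theorem ae_frequently_mem (hs : MeasurableSet s) (hν : ν s ≠ 0) :
    ∀ᵐ z ∂(Measure.infinitePi fun _ : ℕ => ν), ∀ n, ∃ k, z (n + k) ∈ s := by
  rw [ae_all_iff]
  intro n
  have hlt : ν sᶜ < 1 := by
    rw [prob_compl_eq_one_sub hs]
    exact ENNReal.sub_lt_self ENNReal.one_ne_top one_ne_zero hν
  have h0 : (Measure.infinitePi fun _ : ℕ => ν) {z | ¬ ∃ k, z k ∈ s} = 0 := by
    refine le_antisymm (ge_of_tendsto' (ENNReal.tendsto_pow_atTop_nhds_zero_of_lt_one hlt)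
      fun m => ?_) zero_le
    calc _ ≤ (Measure.infinitePi fun _ : ℕ => ν)
          (Set.pi (Finset.range m : Set ℕ) fun _ => sᶜ) :=
          measure_mono fun z (hz : ¬ ∃ k, z k ∈ s) k _ hk => hz ⟨k, hk⟩
      _ = ν sᶜ ^ m := by
          rw [Measure.infinitePi_pi _ fun _ _ => hs.compl]
          simp
  have h1 : ∀ᵐ z ∂(Measure.infinitePi fun _ : ℕ => ν), ∃ k, z k ∈ s := h0
  rw [← map_shift_infinitePi ν n] at h1
  exact ae_of_ae_map (f := fun (z : ℕ → α) k => z (n + k))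
    (Measurable.aemeasurable (by fun_prop)) h1

/-- On the event that the block has length n + 1, its sum depends on the first n + 1 coordinates and
the remainder is the shift by n + 1, which is independent of them and has the original law. The
almost surely finite length allows summation over n. -/
theorem measure_blockSum_inter_dropBlock (hs : MeasurableSet s) (hν : ν s ≠ 0)
    (hw : ∀ j, Measurable (w j)) {B : Set ℝ≥0∞} (hB : MeasurableSet B) {C : Set (ℕ → α)}
    (hC : MeasurableSet C) :
    (Measure.infinitePi fun _ : ℕ => ν) (blockSum s w ⁻¹' B ∩ dropBlock s ⁻¹' C) =
      (Measure.infinitePi fun _ : ℕ => ν) (blockSum s w ⁻¹' B) *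
        (Measure.infinitePi fun _ : ℕ => ν) C := by
  set Q := Measure.infinitePi fun _ : ℕ => ν
  let A : ℕ → Set (ℕ → α) := fun n =>
    {z | blockLength s z = n + 1} ∩ {z | ∑ j ∈ Finset.range (n + 1), w j (z j) ∈ B}
  have hA : ∀ n, MeasurableSet[⨆ k ∈ Set.Iio (n + 1),
      MeasurableSpace.comap (fun z : ℕ → α => z k) inferInstance] (A n) := by
    intro n
    have hev : ∀ k < n + 1, Measurable[⨆ k ∈ Set.Iio (n + 1),
        MeasurableSpace.comap (fun z : ℕ → α => z k) inferInstance] fun z : ℕ → α => z k :=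
      fun k hk => measurable_iff_comap_le.2 (le_iSup₂ (f := fun (k : ℕ) (_ : k ∈ Set.Iio (n + 1)) =>
        MeasurableSpace.comap (fun z : ℕ → α => z k) inferInstance) k hk)
    refine (measurableSet_blockLength hs fun k hk => hev k (Nat.lt_succ_of_le hk)).inter ?_
    exact Finset.measurable_fun_sum _
      (fun j hj => (hw j).comp (hev j (Finset.mem_range.1 hj))) hB
  have hle : ∀ n, (⨆ k ∈ Set.Iio n,
      MeasurableSpace.comap (fun z : ℕ → α => z k) inferInstance) ≤
        (MeasurableSpace.pi : MeasurableSpace (ℕ → α)) :=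
    fun n => iSup₂_le fun k _ => (measurable_pi_apply k).comap_le
  have hA' : ∀ n, MeasurableSet (A n) := fun n => hle _ _ (hA n)
  have hsh : ∀ n, Measurable fun (z : ℕ → α) k => z (n + k) := fun n => by fun_prop
  have hsh' : ∀ n, MeasurableSet[⨆ k ∈ Set.Ici n,
      MeasurableSpace.comap (fun z : ℕ → α => z k) inferInstance]
        ((fun (z : ℕ → α) k => z (n + k)) ⁻¹' C) := by
    intro n
    refine @measurable_pi_lambda (ℕ → α) ℕ (fun _ => α) (_) _
      (fun (z : ℕ → α) k => z (n + k)) (fun k => ?_) _ hC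
    exact measurable_iff_comap_le.2 (le_iSup₂ (f := fun (k : ℕ) (_ : k ∈ Set.Ici n) =>
        MeasurableSpace.comap (fun z : ℕ → α => z k) inferInstance) (n + k)
          (Set.mem_Ici.2 (Nat.le_add_right n k)))
  have hdisj : Pairwise (Function.onFun Disjoint A) := by
    intro i j hij
    rw [Function.onFun, Set.disjoint_left]
    rintro z ⟨h1, -⟩ ⟨h2, -⟩
    exact hij (Nat.succ_injective (h1.symm.trans h2))
  have hae : ∀ᵐ z ∂Q, ∃ n, blockLength s z = n + 1 := by
    filter_upwards [ae_frequently_mem hs hν] with z hz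
    refine Nat.exists_eq_succ_of_ne_zero fun h0 => ?_
    obtain ⟨k, hk⟩ := hz 0
    exact blockLength_eq_zero_iff.1 h0 _ hk
  have e1 : Q (blockSum s w ⁻¹' B) = Q (⋃ n, A n) := by
    refine measure_congr ?_
    filter_upwards [hae] with z ⟨n, hn⟩
    refine propext ⟨fun h => Set.mem_iUnion.2 ⟨n, hn, ?_⟩, fun h => ?_⟩
    · have : blockSum s w z ∈ B := h
      rwa [blockSum, hn] at this
    · obtain ⟨m, hm, h⟩ := Set.mem_iUnion.1 h
      change blockSum s w z ∈ B
      rw [blockSum, hm]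
      exact h
  have e2 : Q (blockSum s w ⁻¹' B ∩ dropBlock s ⁻¹' C) =
      Q (⋃ n, A n ∩ (fun (z : ℕ → α) k => z (n + 1 + k)) ⁻¹' C) := by
    refine measure_congr ?_
    filter_upwards [hae] with z ⟨n, hn⟩
    refine propext ⟨fun h => Set.mem_iUnion.2 ⟨n, ⟨hn, ?_⟩, ?_⟩, fun h => ?_⟩
    · have : blockSum s w z ∈ B := h.1
      rwa [blockSum, hn] at this
    · have : dropBlock s z ∈ C := h.2
      unfold dropBlock at this
      rwa [hn] at this
    · obtain ⟨m, ⟨hm, h⟩, h'⟩ := Set.mem_iUnion.1 h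
      refine ⟨?_, ?_⟩
      · change blockSum s w z ∈ B
        rw [blockSum, hm]
        exact h
      · change dropBlock s z ∈ C
        unfold dropBlock
        rw [hm]
        exact h'
  rw [e1, e2, measure_iUnion hdisj hA', measure_iUnion, ← ENNReal.tsum_mul_right]
  · refine tsum_congr fun n => ?_
    rw [(Indep_iff _ _ _).1 (indep_iSup_lt_iSup_ge ν (n + 1)) _ _ (hA n) (hsh' (n + 1)),
      ← Measure.map_apply (hsh _) hC, map_shift_infinitePi]
  · exact fun i j hij => (hdisj hij).mono Set.inter_subset_left Set.inter_subset_left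
  · exact fun n => (hA' n).inter (hsh _ hC)

theorem measurePreserving_dropBlock (hs : MeasurableSet s) (hν : ν s ≠ 0) :
    MeasurePreserving (dropBlock s) (Measure.infinitePi fun _ : ℕ => ν)
      (Measure.infinitePi fun _ : ℕ => ν) := by
  refine ⟨measurable_dropBlock hs, Measure.ext fun C hC => ?_⟩
  have := measure_blockSum_inter_dropBlock (w := fun _ _ => 0) hs hν (fun _ => measurable_const)
    MeasurableSet.univ hC
  rw [Measure.map_apply (measurable_dropBlock hs) hC]
  simpa using this

/-- Induction on the number of blocks: the first one is split off, and the remainder is again an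
i.i.d. sequence of the same law. -/
theorem iIndepFun_blockSum (hs : MeasurableSet s) (hν : ν s ≠ 0) (hw : ∀ j, Measurable (w j)) :
    iIndepFun (fun i z => blockSum s w ((dropBlock s)^[i] z))
      (Measure.infinitePi fun _ : ℕ => ν) := by
  set Q := Measure.infinitePi fun _ : ℕ => ν
  have hm : ∀ i, Measurable fun z => blockSum s w ((dropBlock s)^[i] z) := fun i =>
    (measurable_blockSum hs hw).comp ((measurable_dropBlock hs).iterate i)
  have hmp : ∀ i, MeasurePreserving ((dropBlock s)^[i]) Q Q := fun i =>
    (measurePreserving_dropBlock hs hν).iterate i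
  have hone : ∀ i B, MeasurableSet B → Q ((fun z => blockSum s w ((dropBlock s)^[i] z)) ⁻¹' B) =
      Q (blockSum s w ⁻¹' B) := fun i B hB =>
    (hmp i).measure_preimage (measurable_blockSum hs hw hB).nullMeasurableSet
  refine iIndepFun_of_measure_iInter_range fun n => ?_
  induction n with
  | zero => simp
  | succ n ih =>
    intro B hB
    have h : ⋂ i ∈ Finset.range (n + 1), (fun z => blockSum s w ((dropBlock s)^[i] z)) ⁻¹' B i =
        blockSum s w ⁻¹' B 0 ∩ dropBlock s ⁻¹' (⋂ i ∈ Finset.range n,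
          (fun z => blockSum s w ((dropBlock s)^[i] z)) ⁻¹' B (i + 1)) := by
      ext z
      simp only [Set.mem_iInter, Finset.mem_range, Set.mem_preimage, Set.mem_inter_iff]
      constructor
      · exact fun h => ⟨h 0 n.succ_pos, fun i hi => h (i + 1) (Nat.succ_lt_succ hi)⟩
      · rintro ⟨h0, h1⟩ i hi
        cases i with
        | zero => exact h0
        | succ i => exact h1 i (Nat.lt_of_succ_lt_succ hi)
    rw [h, measure_blockSum_inter_dropBlock hs hν hw (hB 0)
      (Finset.measurableSet_biInter _ fun i _ => hm i (hB _)), ih (fun i => B (i + 1))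
      fun i => hB _, Finset.prod_range_succ', mul_comm]
    congr 1
    exact Finset.prod_congr rfl fun i _ => by rw [hone _ _ (hB _), hone _ _ (hB _)]

theorem map_blockSum_iterate_dropBlock (hs : MeasurableSet s) (hν : ν s ≠ 0)
    (hw : ∀ j, Measurable (w j)) (i : ℕ) : (Measure.infinitePi fun _ : ℕ => ν).map
      (fun z => blockSum s w ((dropBlock s)^[i] z)) =
      (Measure.infinitePi fun _ : ℕ => ν).map (blockSum s w) := by
  have h := (measurePreserving_dropBlock (ν := ν) hs hν).iterate i
  have h2 := Measure.map_map (μ := Measure.infinitePi fun _ : ℕ => ν)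
    (measurable_blockSum hs hw) h.measurable
  rw [h.map_eq] at h2
  exact h2.symm

theorem sq_sum_range_le (n : ℕ) (f : ℕ → ℝ≥0∞) :
    (∑ j ∈ Finset.range n, f j) ^ 2 ≤ n * ∑ j ∈ Finset.range n, f j ^ 2 := by
  have := ENNReal.rpow_sum_le_const_mul_sum_rpow (Finset.range n) f (p := 2) (by norm_num)
  have h1 : (2 : ℝ) - 1 = 1 := by norm_num
  simpa [h1] using this

theorem tsum_sq_mul_pow_lt_top {ρ : ℝ≥0∞} (hρ : ρ < 1) :
    ∑' n : ℕ, ((n + 1 : ℕ) : ℝ≥0∞) ^ 2 * ρ ^ (n - 1) < ⊤ := by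
  lift ρ to ℝ≥0 using hρ.ne_top
  have hρ' : ‖(ρ : ℝ)‖ < 1 := by
    rw [Real.norm_of_nonneg ρ.coe_nonneg]
    exact_mod_cast hρ
  have h : Summable fun n : ℕ => ((n + 1 : ℕ) : ℝ≥0) ^ 2 * ρ ^ (n - 1) := by
    rw [← NNReal.summable_coe, ← summable_nat_add_iff 1]
    have h1 := summable_pow_mul_geometric_of_norm_lt_one 2 hρ'
    have h2 := summable_pow_mul_geometric_of_norm_lt_one 1 hρ'
    have h3 := summable_pow_mul_geometric_of_norm_lt_one 0 hρ'
    refine ((h1.add (h2.mul_left 4)).add (h3.mul_left 4)).congr fun n => ?_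
    push_cast
    ring
  have := ENNReal.tsum_coe_ne_top_iff_summable.2 h
  push_cast at this ⊢
  exact this.lt_top

/-- On length n + 1, Cauchy–Schwarz bounds the square by n + 1 times the sum of the squared weights.
Each of these is integrated against the event that the other coordinates before n avoid `s`, so the
n-th term is of order (n + 1)² ν(sᶜ)^(n-1). -/
theorem lintegral_sq_blockSum_lt_top (hs : MeasurableSet s) (hν : ν s ≠ 0)
    (hw : ∀ j, Measurable (w j)) {C : ℝ≥0∞} (hC : C ≠ ⊤) (hwC : ∀ j, ∫⁻ a, w j a ^ 2 ∂ν ≤ C) :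
    ∫⁻ z, blockSum s w z ^ 2 ∂(Measure.infinitePi fun _ : ℕ => ν) < ⊤ := by
  classical
  set Q := Measure.infinitePi fun _ : ℕ => ν
  have hlt : ν sᶜ < 1 := by
    rw [prob_compl_eq_one_sub hs]
    exact ENNReal.sub_lt_self ENNReal.one_ne_top one_ne_zero hν
  -- Coordinate `j` carries only its weight and no avoidance condition, so the product has
  -- independent factors. This costs at most one power of ν(sᶜ), whence the exponent n - 1.
  let X : ℕ → ℕ → α → ℝ≥0∞ := fun j k a => if k = j then w j a ^ 2 else sᶜ.indicator 1 a
  have hX : ∀ j k, Measurable (X j k) := by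
    intro j k
    simp only [X]
    split_ifs
    · exact (hw j).pow_const 2
    · exact measurable_one.indicator hs.compl
  have hXi : ∀ j k, ∫⁻ z, X j k (z k) ∂Q = if k = j then ∫⁻ a, w j a ^ 2 ∂ν else ν sᶜ := by
    intro j k
    rw [← lintegral_map (μ := Q) (hX j k) (measurable_pi_apply k), Measure.infinitePi_map_eval]
    simp only [X]
    split_ifs
    · rfl
    · rw [lintegral_indicator_one hs.compl]
  have hterm : ∀ n j, ∫⁻ z, ∏ k ∈ insert j ((Finset.range n).erase j), X j k (z k) ∂Q ≤
      ν sᶜ ^ (n - 1) * C := by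
    intro n j
    rw [lintegral_prod_eq_prod_lintegral_of_indepFun _ (fun k (z : ℕ → α) => X j k (z k))
      (iIndepFun_infinitePi (P := fun _ : ℕ => ν) (hX j))
      fun k => (hX j k).comp (measurable_pi_apply k),
      Finset.prod_insert (Finset.notMem_erase _ _), hXi, if_pos rfl, mul_comm]
    refine mul_le_mul' ?_ (hwC j)
    calc _ = ∏ k ∈ (Finset.range n).erase j, ν sᶜ := Finset.prod_congr rfl fun k hk => by
            rw [hXi, if_neg (Finset.ne_of_mem_erase hk)]
      _ = ν sᶜ ^ ((Finset.range n).erase j).card := by rw [Finset.prod_const]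
      _ ≤ _ := by
          refine pow_le_pow_of_le_one zero_le hlt.le ?_
          have := Finset.pred_card_le_card_erase (s := Finset.range n) (a := j)
          simpa using this
  have hpt : ∀ z, blockSum s w z ^ 2 ≤ ∑' n : ℕ, ((n + 1 : ℕ) : ℝ≥0∞) *
      ∑ j ∈ Finset.range (n + 1), ∏ k ∈ insert j ((Finset.range n).erase j), X j k (z k) := by
    intro z
    cases hn : blockLength s z with
    | zero => simp [blockSum, hn]
    | succ n =>
      refine le_trans ?_ (ENNReal.le_tsum n)
      rw [blockSum, hn]
      refine (sq_sum_range_le _ _).trans ?_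
      gcongr with j hj
      rw [Finset.prod_insert (Finset.notMem_erase _ _),
        Finset.prod_eq_one, mul_one]
      · simp [X]
      · intro k hk
        have hk' := Finset.mem_range.1 (Finset.mem_of_mem_erase hk)
        have := (blockLength_eq_succ_iff.1 hn).2 k hk'
        simp [X, Finset.ne_of_mem_erase hk, this]
  have hmeas : ∀ n j, Measurable fun z : ℕ → α =>
      ∏ k ∈ insert j ((Finset.range n).erase j), X j k (z k) := fun n j =>
    Finset.measurable_fun_prod _ fun k _ => (hX j k).comp (measurable_pi_apply k)
  calc _ ≤ ∑' n : ℕ, ((n + 1 : ℕ) : ℝ≥0∞) * ∑ j ∈ Finset.range (n + 1), ν sᶜ ^ (n - 1) * C := by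
        refine (lintegral_mono hpt).trans ?_
        rw [lintegral_tsum fun n => ((Finset.measurable_fun_sum _
          fun j _ => hmeas n j).const_mul _).aemeasurable]
        refine ENNReal.tsum_le_tsum fun n => ?_
        rw [lintegral_const_mul _ (Finset.measurable_fun_sum _ fun j _ => hmeas n j),
          lintegral_finsetSum _ fun j _ => hmeas n j]
        gcongr with j
        exact hterm n j
    _ = (∑' n : ℕ, ((n + 1 : ℕ) : ℝ≥0∞) ^ 2 * ν sᶜ ^ (n - 1)) * C := by
        rw [← ENNReal.tsum_mul_right]
        refine tsum_congr fun n => ?_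
        rw [Finset.sum_const, Finset.card_range, nsmul_eq_mul]
        ring
    _ < ⊤ := ENNReal.mul_lt_top (tsum_sq_mul_pow_lt_top hlt) hC.lt_top

end Blocks

end StatusUpdate

/-! ### Energy waiting times and feedback form an i.i.d. sequence -/

namespace StatusUpdate

variable {Ω : Type*} {N : ℝ≥0 → Ω → ℕ} {er : ℕ → Ω → Bool} {q : ℝ} {γ : ℝ≥0}

namespace Policy

/-- The energy waiting time after the `n`-th attempt and the feedback on the next attempt. -/
noncomputable def step (π : Policy N er) (n : ℕ) (ω : Ω) : ℝ × Bool :=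
  (gap N (π.l n ω) ω, er n ω)

variable [mΩ : MeasurableSpace Ω] {P : Measure Ω}

/-- By energy causality the arrival that ends an earlier waiting time is no later than the `n`-th
attempt. -/
theorem measurable_gap_past (hm : IsModel q N er P) (π : Policy N er) {k n : ℕ} (h : k < n) :
    Measurable[(π.isStoppingTime_l hm n).measurableSpace] fun ω => gap N (π.l k ω) ω := by
  have h1 := π.isStoppingTime_l hm k
  have h2 := hm.isStoppingTime_nextArrival h1
  have h3 : ∀ ω, nextArrival N (π.l k ω) ω ≤ π.l n ω := fun ω =>
    (π.nextArrival_le_l k ω).trans (π.l_monotone ω h)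
  refine measurable_gap ?_ ?_
  · exact (hm.measurable_stoppingTime h1).mono
      (IsStoppingTime.measurableSpace_mono h1 _ fun ω => π.l_monotone ω h.le) le_rfl
  · exact (hm.measurable_stoppingTime h2).mono
      (IsStoppingTime.measurableSpace_mono h2 _ h3) le_rfl

theorem measurable_gap_arrivalsAndFeedback (hm : IsModel q N er P) (π : Policy N er) {k n : ℕ}
    (h : k ≤ n) : Measurable[arrivalsAndFeedback N er n] fun ω => gap N (π.l k ω) ω := by
  have h1 : ∀ t : ℝ≥0, MeasurableSet[arrivalsAndFeedback N er n] {ω | π.l k ω ≤ t} := fun t =>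
    info_le_arrivalsAndFeedback h t _ (π.measurableSet_info_l k t)
  refine measurable_gap (measurable_of_le_coe h1) (measurable_of_le_coe fun t => ?_)
  refine hm.measurableSet_nextArrival_le (fun u _ => ?_) fun u _ => h1 u
  exact measurable_iff_comap_le.2
    ((le_iSup (fun v => MeasurableSpace.comap (N v) ⊤) u).trans le_sup_left)

theorem measurable_gap_l (hm : IsModel q N er P) (π : Policy N er) (n : ℕ) :
    Measurable fun ω => gap N (π.l n ω) ω :=
  (π.measurable_gap_arrivalsAndFeedback hm le_rfl).mono (hm.arrivalsAndFeedback_le n) le_rfl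

theorem measurable_step (hm : IsModel q N er P) (π : Policy N er) (n : ℕ) :
    Measurable (π.step n) :=
  (π.measurable_gap_l hm n).prodMk (hm.erasures.measurable n)

variable [IsProbabilityMeasure P]

/-- The waiting time is independent of the past of the attempt, but this past contains all erasures,
the next one included. The second condition on `F` excludes that dependence; given it, the next
feedback is independent of `F` and the waiting time together. -/
theorem measure_inter_step (hm : IsModel q N er P) (π : Policy N er) {n : ℕ}
    (hfin : ∀ᵐ ω ∂P, π.l n ω < ⊤) {F : Set Ω}
    (hF : MeasurableSet[(π.isStoppingTime_l hm n).measurableSpace] F)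
    (hF' : MeasurableSet[arrivalsAndFeedback N er n] F) {B : Set (ℝ × Bool)}
    (hB : MeasurableSet B) : P (F ∩ π.step n ⁻¹' B) = P F * P (π.step n ⁻¹' B) := by
  have h1 := π.measurable_gap_arrivalsAndFeedback hm (le_refl n)
  have h := indep_sup_left_of_indep (P := P) (m := arrivalsAndFeedback N er n) h1.comap_le
    (inf_le_right : (π.isStoppingTime_l hm n).measurableSpace ⊓ arrivalsAndFeedback N er n ≤ _)
    (hm.arrivalsAndFeedback_le n) (hm.erasures.measurable n).comap_le
    (indep_of_indep_of_le_left (hm.indep_past_gap (π.isStoppingTime_l hm n) hfin)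
      inf_le_left).symm (hm.indep_feedback n)
  rw [Set.inter_comm, mul_comm]
  refine (Indep_iff _ _ _).1 h _ _ ?_ (MeasurableSpace.measurableSet_inf.2 ⟨hF, hF'⟩)
  refine Measurable.prodMk (measurable_iff_comap_le.2 le_sup_left)
    (measurable_iff_comap_le.2 le_sup_right) hB

theorem iIndepFun_step (hm : IsModel q N er P) (π : Policy N er)
    (hfin : ∀ n, ∀ᵐ ω ∂P, π.l n ω < ⊤) : iIndepFun π.step P := by
  refine iIndepFun_of_measure_iInter_range fun n B hB => ?_
  induction n with
  | zero => simp
  | succ n ih =>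
    rw [Finset.range_add_one, Finset.set_biInter_insert, Set.inter_comm, Finset.prod_insert
      Finset.notMem_range_self, mul_comm, ← ih]
    refine π.measure_inter_step hm (hfin n) ?_ ?_ (hB n)
    · refine Finset.measurableSet_biInter _ fun k hk => ?_
      exact Measurable.prodMk (π.measurable_gap_past hm (Finset.mem_range.1 hk))
        (hm.measurable_er_past (π.isStoppingTime_l hm n) k) (hB k)
    · refine Finset.measurableSet_biInter _ fun k hk => ?_
      refine Measurable.prodMk (π.measurable_gap_arrivalsAndFeedback hm (Finset.mem_range.1 hk).le)
        ?_ (hB k)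
      exact measurable_iff_comap_le.2 ((le_iSup₂ (f := fun (k : ℕ) (_ : k < n) =>
        MeasurableSpace.comap (er k) ⊤) k (Finset.mem_range.1 hk)).trans le_sup_right)

theorem map_er_eq (hm : IsModel q N er P) (n : ℕ) : P.map (er n) = P.map (er 0) := by
  have h : ∀ n, IsProbabilityMeasure (P.map (er n)) := fun n =>
    Measure.isProbabilityMeasure_map (hm.erasures.measurable n).aemeasurable
  have ht : ∀ n, P.map (er n) {true} = ENNReal.ofReal q := fun n => by
    rw [Measure.map_apply (hm.erasures.measurable n) (measurableSet_singleton _),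
      ← hm.erasures.prob_erased n]
    rfl
  have hf : ∀ n, P.map (er n) {false} = 1 - ENNReal.ofReal q := fun n => by
    have := h n
    rw [← ht n, ← prob_compl_eq_one_sub (measurableSet_singleton _)]
    congr 1
    ext b
    cases b <;> simp
  refine Measure.ext_of_singleton fun b => ?_
  cases b
  · rw [hf, hf]
  · rw [ht, ht]

theorem map_step (hm : IsModel q N er P) (π : Policy N er) {n : ℕ}
    (hfin : ∀ᵐ ω ∂P, π.l n ω < ⊤) :
    P.map (π.step n) = (expMeasure 1).prod (P.map (er 0)) := by
  have h : IndepFun (fun ω => gap N (π.l n ω) ω) (er n) P := by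
    rw [IndepFun_iff_Indep]
    exact indep_of_indep_of_le_left (hm.indep_feedback n)
      (π.measurable_gap_arrivalsAndFeedback hm le_rfl).comap_le
  have h1 := (indepFun_iff_map_prod_eq_prod_map_map (π.measurable_gap_l hm n).aemeasurable
    (hm.erasures.measurable n).aemeasurable).1 h
  rw [hm.map_gap (π.isStoppingTime_l hm n) hfin, map_er_eq hm n] at h1
  exact h1

theorem map_steps (hm : IsModel q N er P) (π : Policy N er)
    (hfin : ∀ n, ∀ᵐ ω ∂P, π.l n ω < ⊤) :
    P.map (fun ω n => π.step n ω) =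
      Measure.infinitePi fun _ : ℕ => (expMeasure 1).prod (P.map (er 0)) := by
  rw [(π.iIndepFun_step hm hfin).map_fun_eq_infinitePi_map (π.measurable_step hm)]
  simp_rw [fun n => π.map_step hm (hfin n)]

end Policy

end StatusUpdate

/-! ### The threshold policy is a renewal policy with bounded second moments -/

namespace StatusUpdate

variable {Ω : Type*} {N : ℝ≥0 → Ω → ℕ} {er : ℕ → Ω → Bool} {q : ℝ} {γ : ℝ≥0}

theorem lintegral_sq_ofReal_max_expMeasure_lt_top (γ : ℝ≥0) :
    ∫⁻ x, ENNReal.ofReal (max x γ) ^ 2 ∂(expMeasure 1) < ⊤ := by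
  have := isProbabilityMeasure_expMeasure (r := 1) one_pos
  have h1 : ∫⁻ x, ENNReal.ofReal x ^ 2 ∂(expMeasure 1) < ⊤ := by
    rw [expMeasure, gammaMeasure, lintegral_withDensity_eq_lintegral_mul _
      (f := gammaPDF 1 1) (measurable_gammaPDFReal 1 1).ennreal_ofReal (by fun_prop)]
    -- The second moment of the unit exponential law is Γ(3).
    have h2 := (Real.GammaIntegral_convergent (s := 3) (by norm_num)).lintegral_lt_top
    refine lt_of_le_of_lt ?_ h2
    rw [← lintegral_indicator measurableSet_Ioi]
    refine lintegral_mono fun x => ?_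
    by_cases hx : 0 < x
    · rw [Set.indicator_of_mem (Set.mem_Ioi.2 hx), Pi.mul_apply, gammaPDF_of_nonneg hx.le,
        ← ENNReal.ofReal_pow hx.le, ← ENNReal.ofReal_mul (by positivity)]
      refine ENNReal.ofReal_le_ofReal (le_of_eq ?_)
      have h3 : (3 : ℝ) - 1 = (2 : ℕ) := by norm_num
      rw [h3, Real.rpow_natCast]
      simp
    · simp [ENNReal.ofReal_of_nonpos (not_lt.1 hx)]
  calc _ ≤ ∫⁻ x, (ENNReal.ofReal x ^ 2 + (γ : ℝ≥0∞) ^ 2) ∂(expMeasure 1) := by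
        refine lintegral_mono fun x => ?_
        rw [ENNReal.ofReal_max, ENNReal.ofReal_coe_nnreal]
        rcases max_choice (ENNReal.ofReal x) γ with h | h <;> rw [h]
        · exact le_self_add
        · exact le_add_self
    _ < ⊤ := by
        rw [lintegral_add_right _ measurable_const, lintegral_const, measure_univ, mul_one]
        exact ENNReal.add_lt_top.2 ⟨h1, by finiteness⟩

/-- The delay that the threshold policy incurs before the `(j+1)`-st attempt of an epoch. -/
noncomputable def epochDelay (γ : ℝ≥0) (j : ℕ) (z : ℝ × Bool) : ℝ≥0∞ :=
  ENNReal.ofReal (max z.1 (if j = 0 then γ else 0 : ℝ≥0))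

theorem measurable_epochDelay (γ : ℝ≥0) (j : ℕ) : Measurable (epochDelay γ j) :=
  (measurable_fst.max measurable_const).ennreal_ofReal

theorem epochDelay_le (γ : ℝ≥0) (j : ℕ) (z : ℝ × Bool) :
    epochDelay γ j z ≤ ENNReal.ofReal (max z.1 γ) := by
  refine ENNReal.ofReal_le_ofReal (max_le_max le_rfl ?_)
  split_ifs <;> simp

/-- The successful outcomes of an attempt. -/
def successSet : Set (ℝ × Bool) := {z | z.2 = false}

theorem measurableSet_successSet : MeasurableSet successSet :=
  measurable_snd (measurableSet_singleton false)

namespace Policy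

theorem l_add_sum_x (π : Policy N er) (n m : ℕ) (ω : Ω) :
    π.l n ω + ∑ j ∈ Finset.range m, π.x (n + j) ω = π.l (n + m) ω := by
  induction m with
  | zero => simp
  | succ m ih =>
    rw [Finset.sum_range_succ, ← add_assoc, ih, x, add_tsub_cancel_of_le (π.l_mono ω _)]
    rfl

variable [mΩ : MeasurableSpace Ω] {P : Measure Ω}

theorem thresholdPolicy_x_eq (hm : IsModel q N er P) {n : ℕ} {ω : Ω}
    (h : ∀ n, (thresholdPolicy hm γ).l n ω < ⊤) :
    (thresholdPolicy hm γ).x n ω = ENNReal.ofReal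
      (max (gap N ((thresholdPolicy hm γ).l n ω) ω) (thresholdDelay er γ n ω)) := by
  have h1 := ((thresholdPolicy hm γ).nextArrival_le_l n ω).trans_lt (h (n + 1))
  have h2 : nextArrival N ((thresholdPolicy hm γ).l n ω) ω = (thresholdPolicy hm γ).l n ω +
      ENNReal.ofReal (gap N ((thresholdPolicy hm γ).l n ω) ω) := by
    rw [gap, ENNReal.ofReal_toReal (tsub_le_self.trans_lt h1).ne,
      add_tsub_cancel_of_le (le_nextArrival _ _)]
  rw [x, thresholdPolicy_l_succ, h2, max_add_add_left, ENNReal.add_sub_cancel_left (h n).ne,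
    ENNReal.ofReal_max, ENNReal.ofReal_coe_nnreal]

/-- Inside a block every attempt before the last is erased, so the delay γ is imposed at position 0
only. The weights thus depend only on the position in the block, which makes every epoch the same
functional of its block. -/
theorem epoch_step (hm : IsModel q N er P) {n i m : ℕ} {ω : Ω}
    (hfin : ∀ n, (thresholdPolicy hm γ).l n ω < ⊤) (hn : StartsEpoch er n ω)
    (hi : successCount er n ω = i)
    (hs : (thresholdPolicy hm γ).s i ω = (thresholdPolicy hm γ).l n ω)
    (hmb : blockLength successSet (fun k => (thresholdPolicy hm γ).step (n + k) ω) = m + 1) :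
    StartsEpoch er (n + (m + 1)) ω ∧ successCount er (n + (m + 1)) ω = i + 1 ∧
      (thresholdPolicy hm γ).s (i + 1) ω = (thresholdPolicy hm γ).l (n + (m + 1)) ω ∧
      (thresholdPolicy hm γ).y i ω = blockSum successSet (epochDelay γ)
        (fun k => (thresholdPolicy hm γ).step (n + k) ω) := by
  obtain ⟨h1, h2⟩ := blockLength_eq_succ_iff.1 hmb
  replace h1 : er (n + m) ω = false := h1
  replace h2 : ∀ k < m, er (n + k) ω = true := fun k hk => by
    have : ¬ er (n + k) ω = false := h2 k hk
    simpa using this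
  have hc : ∀ k ≤ m, successCount er (n + k) ω = i := by
    intro k
    induction k with
    | zero => exact fun _ => hi
    | succ k ih =>
      intro hk
      have := ih (Nat.le_of_succ_le hk)
      rw [successCount] at this
      rw [← add_assoc, successCount, Nat.count_succ, this, if_neg (by simp [h2 k hk]), add_zero]
  have hs1 : (thresholdPolicy hm γ).s (i + 1) ω = (thresholdPolicy hm γ).l (n + (m + 1)) ω :=
    s_succ_eq h1 (hc m le_rfl)
  refine ⟨Or.inr h1, ?_, hs1, ?_⟩
  · have := hc m le_rfl
    rw [successCount] at this
    rw [← add_assoc, successCount, Nat.count_succ, this, if_pos h1]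
  · rw [y, hs1, hs, ← l_add_sum_x, ENNReal.add_sub_cancel_left (hfin n).ne, blockSum, hmb]
    refine Finset.sum_congr rfl fun j hj => ?_
    rw [thresholdPolicy_x_eq hm hfin, epochDelay, step, thresholdDelay]
    congr 3
    cases j with
    | zero => rw [if_pos rfl, add_zero, if_pos hn]
    | succ j =>
      rw [if_neg j.succ_ne_zero, if_neg]
      have := h2 j (Nat.lt_of_succ_lt_succ (Finset.mem_range.1 hj))
      simp [StartsEpoch, ← add_assoc, this]

theorem exists_epoch_start (hm : IsModel q N er P) {ω : Ω}
    (hfin : ∀ n, (thresholdPolicy hm γ).l n ω < ⊤) (hs : ∀ n, ∃ k, er (n + k) ω = false) (i : ℕ) :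
    ∃ n, StartsEpoch er n ω ∧ successCount er n ω = i ∧
      (thresholdPolicy hm γ).s i ω = (thresholdPolicy hm γ).l n ω ∧
      (dropBlock successSet)^[i] (fun k => (thresholdPolicy hm γ).step k ω) =
        fun k => (thresholdPolicy hm γ).step (n + k) ω := by
  induction i with
  | zero => exact ⟨0, Or.inl rfl, Nat.count_zero _, ((thresholdPolicy hm γ).l_zero ω).symm, by simp⟩
  | succ i ih =>
    obtain ⟨n, h1, h2, h3, h4⟩ := ih
    obtain ⟨m, hmb⟩ : ∃ m, blockLength successSet
        (fun k => (thresholdPolicy hm γ).step (n + k) ω) = m + 1 := by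
      refine Nat.exists_eq_succ_of_ne_zero fun h0 => ?_
      obtain ⟨k, hk⟩ := hs n
      exact blockLength_eq_zero_iff.1 h0 k hk
    obtain ⟨e1, e2, e3, -⟩ := epoch_step hm hfin h1 h2 h3 hmb
    refine ⟨n + (m + 1), e1, e2, e3, ?_⟩
    rw [Function.iterate_succ_apply', h4]
    unfold dropBlock
    rw [hmb]
    simp only [add_assoc]

theorem y_eq_blockSum (hm : IsModel q N er P) {ω : Ω} (hγ : 0 < γ)
    (hfin : ∀ n, (thresholdPolicy hm γ).l n ω < ⊤) (hs : ∀ n, ∃ k, er (n + k) ω = false) (i : ℕ) :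
    (thresholdPolicy hm γ).y i ω = blockSum successSet (epochDelay γ)
        ((dropBlock successSet)^[i] fun k => (thresholdPolicy hm γ).step k ω) ∧
      0 < (thresholdPolicy hm γ).y i ω ∧ (thresholdPolicy hm γ).y i ω < ⊤ := by
  obtain ⟨n, h1, h2, h3, h4⟩ := exists_epoch_start hm hfin hs i
  obtain ⟨m, hmb⟩ : ∃ m, blockLength successSet
      (fun k => (thresholdPolicy hm γ).step (n + k) ω) = m + 1 := by
    refine Nat.exists_eq_succ_of_ne_zero fun h0 => ?_
    obtain ⟨k, hk⟩ := hs n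
    exact blockLength_eq_zero_iff.1 h0 k hk
  have h5 := (epoch_step hm hfin h1 h2 h3 hmb).2.2.2
  rw [h4, ← h5]
  refine ⟨rfl, ?_, ?_⟩ <;> rw [h5, blockSum, hmb]
  · refine lt_of_lt_of_le (b := epochDelay γ 0 ((thresholdPolicy hm γ).step (n + 0) ω)) ?_
      (Finset.single_le_sum (f := fun j => epochDelay γ j ((thresholdPolicy hm γ).step (n + j) ω))
        (fun _ _ => zero_le) (Finset.mem_range.2 m.succ_pos))
    rw [epochDelay, if_pos rfl, ENNReal.ofReal_pos]
    exact lt_max_of_lt_right hγ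
  · exact ENNReal.sum_lt_top.2 fun j _ => ENNReal.ofReal_lt_top

variable [IsProbabilityMeasure P]

theorem ae_thresholdPolicy_l_lt_top (hm : IsModel q N er P) (γ : ℝ≥0) (n : ℕ) :
    ∀ᵐ ω ∂P, (thresholdPolicy hm γ).l n ω < ⊤ := by
  induction n with
  | zero => exact Eventually.of_forall fun ω => by simp [(thresholdPolicy hm γ).l_zero ω]
  | succ n ih =>
    filter_upwards [ih, hm.ae_nextArrival_lt_top ((thresholdPolicy hm γ).isStoppingTime_l hm n) ih]
      with ω h1 h2
    rw [thresholdPolicy_l_succ]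
    exact max_lt h2 (ENNReal.add_lt_top.2 ⟨h1, ENNReal.coe_lt_top⟩)

theorem prob_successSet_ne_zero (hm : IsModel q N er P) (hq1 : q < 1) :
    ((expMeasure 1).prod (P.map (er 0))) successSet ≠ 0 := by
  have := isProbabilityMeasure_expMeasure (r := 1) one_pos
  have := Measure.isProbabilityMeasure_map (μ := P) (hm.erasures.measurable 0).aemeasurable
  have h : successSet = Set.univ ×ˢ ({true}ᶜ : Set Bool) := by
    ext z
    simp [successSet]
  rw [h, Measure.prod_prod, measure_univ, one_mul,
    prob_compl_eq_one_sub (measurableSet_singleton _),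
    Measure.map_apply (hm.erasures.measurable 0) (measurableSet_singleton _)]
  have h2 : P (er 0 ⁻¹' {true}) = ENNReal.ofReal q := hm.erasures.prob_erased 0
  rw [h2]
  exact (tsub_pos_of_lt (ENNReal.ofReal_lt_one.2 hq1)).ne'

theorem ae_thresholdPolicy_regular (hm : IsModel q N er P) (hq1 : q < 1) (γ : ℝ≥0) :
    ∀ᵐ ω ∂P, (∀ n, (thresholdPolicy hm γ).l n ω < ⊤) ∧ ∀ n, ∃ k, er (n + k) ω = false := by
  have := isProbabilityMeasure_expMeasure (r := 1) one_pos
  have := Measure.isProbabilityMeasure_map (μ := P) (hm.erasures.measurable 0).aemeasurable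
  have h1 := ae_frequently_mem measurableSet_successSet (prob_successSet_ne_zero hm hq1)
  rw [← (thresholdPolicy hm γ).map_steps hm (ae_thresholdPolicy_l_lt_top hm γ)] at h1
  have h2 := ae_of_ae_map
    (measurable_pi_lambda _ ((thresholdPolicy hm γ).measurable_step hm)).aemeasurable h1
  filter_upwards [ae_all_iff.2 (ae_thresholdPolicy_l_lt_top hm γ), h2] with ω h3 h4
  exact ⟨h3, h4⟩

/-- Independence and the common law of the block sums are pulled back along the map from ω to the
sequence of steps, whose law is the product measure. The epochs equal the block sums only almost
surely, off the null set where attempts or successes run out. -/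
theorem isRenewal_thresholdPolicy (hm : IsModel q N er P) (hq1 : q < 1) (hγ : 0 < γ) :
    (thresholdPolicy hm γ).IsRenewal P := by
  have := isProbabilityMeasure_expMeasure (r := 1) one_pos
  have := Measure.isProbabilityMeasure_map (μ := P) (hm.erasures.measurable 0).aemeasurable
  have hreg := ae_thresholdPolicy_regular hm hq1 γ
  have hν := prob_successSet_ne_zero hm hq1
  have hs := measurableSet_successSet
  have hw := measurable_epochDelay γ
  have hlaw := (thresholdPolicy hm γ).map_steps hm (ae_thresholdPolicy_l_lt_top hm γ)
  have hZ : Measurable fun ω n => (thresholdPolicy hm γ).step n ω :=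
    measurable_pi_lambda _ ((thresholdPolicy hm γ).measurable_step hm)
  have hY : ∀ i, Measurable fun z =>
      blockSum successSet (epochDelay γ) ((dropBlock successSet)^[i] z) := fun i =>
    (measurable_blockSum hs hw).comp ((measurable_dropBlock hs).iterate i)
  have hae : ∀ i, (fun ω => blockSum successSet (epochDelay γ) ((dropBlock successSet)^[i]
      fun k => (thresholdPolicy hm γ).step k ω)) =ᵐ[P] (thresholdPolicy hm γ).y i := fun i => by
    filter_upwards [hreg] with ω h
    exact (y_eq_blockSum hm hγ h.1 h.2 i).1.symm
  have hYm : ∀ i, AEMeasurable ((thresholdPolicy hm γ).y i) P := fun i =>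
    ((hY i).comp hZ).aemeasurable.congr (hae i)
  have hmap : ∀ i, P.map ((thresholdPolicy hm γ).y i) =
      (Measure.infinitePi fun _ : ℕ => (expMeasure 1).prod (P.map (er 0))).map
        (blockSum successSet (epochDelay γ)) := fun i => by
    rw [← map_blockSum_iterate_dropBlock hs hν hw i, ← hlaw, Measure.map_map (hY i) hZ]
    exact (Measure.map_congr (hae i)).symm
  refine ⟨?_, fun i => ⟨hYm i, hYm 0, by rw [hmap, hmap]⟩, ?_⟩
  · refine (iIndepFun_congr hae).1 ?_
    have h := iIndepFun_blockSum hs hν hw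
    rw [← hlaw] at h
    rw [iIndepFun_iff_measure_inter_preimage_eq_mul] at h ⊢
    intro S B hB
    have h1 := h S hB
    rw [Measure.map_apply hZ (Finset.measurableSet_biInter _ fun i hi => hY i (hB i hi))] at h1
    rw [Set.preimage_iInter₂] at h1
    refine h1.trans (Finset.prod_congr rfl fun i hi => ?_)
    rw [Measure.map_apply hZ (hY i (hB i hi))]
    rfl
  · filter_upwards [hreg] with ω h i
    exact (y_eq_blockSum hm hγ h.1 h.2 i).2

theorem attemptDelaysBounded_thresholdPolicy (hm : IsModel q N er P) (γ : ℝ≥0) :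
    (thresholdPolicy hm γ).AttemptDelaysBounded P := by
  have hC := lintegral_sq_ofReal_max_expMeasure_lt_top γ
  refine ⟨_, fun n => le_of_le_of_eq ?_ (ENNReal.coe_toNNReal hC.ne).symm⟩
  rw [← hm.map_gap ((thresholdPolicy hm γ).isStoppingTime_l hm n)
    (ae_thresholdPolicy_l_lt_top hm γ n), lintegral_map (by fun_prop)
    ((thresholdPolicy hm γ).measurable_gap_l hm n)]
  refine lintegral_mono_ae ?_
  filter_upwards [ae_all_iff.2 (ae_thresholdPolicy_l_lt_top hm γ)] with ω h
  rw [thresholdPolicy_x_eq hm h]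
  gcongr
  rw [thresholdDelay]
  split_ifs <;> simp

/-- The epochs being identically distributed, it is enough to bound the first one, a block sum whose
weights are all dominated by the maximum of the waiting time and γ. -/
theorem epochLengthsBounded_thresholdPolicy (hm : IsModel q N er P) (hq1 : q < 1) (hγ : 0 < γ) :
    (thresholdPolicy hm γ).EpochLengthsBounded P := by
  have := isProbabilityMeasure_expMeasure (r := 1) one_pos
  have := Measure.isProbabilityMeasure_map (μ := P) (hm.erasures.measurable 0).aemeasurable
  have hs := measurableSet_successSet
  have hw := measurable_epochDelay γ
  have hZ : Measurable fun ω n => (thresholdPolicy hm γ).step n ω :=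
    measurable_pi_lambda _ ((thresholdPolicy hm γ).measurable_step hm)
  have hC : ∫⁻ z, blockSum successSet (epochDelay γ) z ^ 2 ∂(Measure.infinitePi fun _ : ℕ =>
      (expMeasure 1).prod (P.map (er 0))) < ⊤ := by
    refine lintegral_sq_blockSum_lt_top hs (prob_successSet_ne_zero hm hq1) hw
      (lintegral_sq_ofReal_max_expMeasure_lt_top γ).ne fun j => ?_
    calc _ ≤ ∫⁻ z, ENNReal.ofReal (max z.1 γ) ^ 2 ∂((expMeasure 1).prod (P.map (er 0))) := by
          gcongr with z
          exact epochDelay_le γ j z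
      _ = ∫⁻ x, ENNReal.ofReal (max x γ) ^ 2
            ∂(((expMeasure 1).prod (P.map (er 0))).map Prod.fst) :=
          (lintegral_map (f := fun x : ℝ => ENNReal.ofReal (max x γ) ^ 2) (by fun_prop)
            measurable_fst).symm
      _ = _ := by rw [Measure.map_fst_prod, measure_univ, one_smul]
  have h0 : ∫⁻ ω, (thresholdPolicy hm γ).y 0 ω ^ 2 ∂P < ⊤ := by
    rw [← (thresholdPolicy hm γ).map_steps hm (ae_thresholdPolicy_l_lt_top hm γ),
      lintegral_map ((measurable_blockSum hs hw).pow_const 2) hZ] at hC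
    refine lt_of_le_of_lt (lintegral_mono_ae ?_) hC
    filter_upwards [ae_thresholdPolicy_regular hm hq1 γ] with ω h
    rw [(y_eq_blockSum hm hγ h.1 h.2 0).1]
    rfl
  refine ⟨_, fun i => le_of_eq ((((isRenewal_thresholdPolicy hm hq1 hγ).identDistrib i).comp
    (measurable_id.pow_const 2)).lintegral_eq.trans (ENNReal.coe_toNNReal h0.ne).symm)⟩

end Policy

end StatusUpdate

theorem theorem3 {Ω : Type*} [MeasurableSpace Ω] (P : Measure Ω) [IsProbabilityMeasure P]
    (q : ℝ) (hq0 : 0 < q) (hq1 : q < 1) (N : ℝ≥0 → Ω → ℕ) (er : ℕ → Ω → Bool)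
    (hmodel : StatusUpdate.IsModel q N er P)
    (π : StatusUpdate.Policy N er)
    (hπ : π.AttemptDelaysBounded P ∨ π.EpochLengthsBounded P) :
    ∃ σ : StatusUpdate.Policy N er,
      σ.IsRenewal P ∧ σ.AttemptDelaysBounded P ∧ σ.EpochLengthsBounded P ∧
        σ.averageAoI P ≤ π.averageAoI P := by
  obtain ⟨γ, hγ⟩ := StatusUpdate.exists_isThreshold hq0 hq1
  lift γ to ℝ≥0 using hγ.pos.le
  have hγ0 : 0 < γ := hγ.pos
  exact ⟨StatusUpdate.thresholdPolicy hmodel γ,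
    StatusUpdate.Policy.isRenewal_thresholdPolicy hmodel hq1 hγ0,
    StatusUpdate.Policy.attemptDelaysBounded_thresholdPolicy hmodel γ,
    StatusUpdate.Policy.epochLengthsBounded_thresholdPolicy hmodel hq1 hγ0,
    (StatusUpdate.Policy.averageAoI_thresholdPolicy_le hmodel hq0 hq1 hγ).trans
      (π.optAoI_le_averageAoI hmodel hq0 hq1 hγ)⟩
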